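/- Work in the real projective plane $\mathbf P(\mathbb R^3)$; lines are identified with points of $\mathbf P(\mathbb R^{3*})$. For points $v,w$ let $vw$ be the line through them, and for lines $L,M$ let $LM$ be their intersection point. **Boxes.** An overmarked box is a pair of 6-tuples $\big((p,q,r,s,t,b),(P,Q,R,S,T,B)\big)$ of points and lines such that $p,t,q\in T$; $s,b,r\in B$; $s,t\in P$; $r,t\in Q$; $q,b\in R$; $p,b\in S$; and such that $p,q,r,s$ are, in this order, the vertices of a nondegenerate convex quadrilateral (in some affine chart), with $t$ in the open edge $pq$ and $b$ in the open edge $rs$. A marked box $\mathfrak B$ is a class of overmarked boxes under the involution $\big((p,q,r,s,t,b),(P,Q,R,S,T,B)\big)\mapsto\big((q,p,s,r,t,b),(Q,P,S,R,T,B)\big)$. **Projective symmetries.** Let $\mathcal G=\mathrm{PGL}(3,\mathbb R)\rtimes\mathbb Z/2$ be the group of projective transformations and dualities of the plane. A projective transformation acts on boxes entrywise, and a duality $D$ maps the class of $\big((p,q,r,s,t,b),(P,Q,R,S,T,B)\big)$ to that of $\big((DP,DQ,DS,DR,DT,DB),(Dq,Dp,Dr,Ds,Dt,Db)\big)$. On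 pairs (point, line), a projective transformation $g$ acts by $g(v,\ell)=(gv,g\ell)$ and a duality $D$ by $D(v,\ell)=(D\ell,Dv)$. **Representations.** In $\mathrm{PSL}(2,\mathbb Z)=\langle a,d: a^3=d^2=1\rangle$ let $a=\begin{bmatrix}-1&1\\-1&0\end{bmatrix}$, $d=\begin{bmatrix}0&1\\-1&0\end{bmatrix}$. A Pappus–Schwartz representation of $\mathfrak B=[((p,q,r,s,t,b),(P,Q,R,S,T,B))]$ is a homomorphism $\rho_{\mathfrak B}:\mathrm{PSL}(2,\mathbb Z)\to\mathcal G$ such that $\rho_{\mathfrak B}(d)$ is a duality sending $\mathfrak B$ to its dual box $[((s,r,p,q,b,t),(R,S,Q,P,B,T))]$, and $\rho_{\mathfrak B}(a)$ is a projective transformation sending $\mathfrak B$ to $$[((PS,QR,p,q,(qs)(pr),t),(qs,pr,Q,P,(QR)(PS),T))],$$ the latter to $$[((s,r,PS,QR,b,(qs)(pr)),(R,S,pr,qs,B,(QR)(PS)))],$$ and the latter back to $\mathfrak B$. **Proposition.** Every marked box $\mathfrak B$ has a Pappus–Schwartz representation, and for every Pappus–Schwartz representation $\rho=\rho_{\mathfrak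 B}$ of $\mathfrak B$ the following hold. 1. There is a continuous map $\xi=(\xi^1,\xi^2):\partial_\infty\mathbb H^2\to\mathbf P(\mathbb R^3)\times\mathbf P(\mathbb R^{3*})$ that is $\rho$-equivariant, transverse ($\xi^1(x)\notin\xi^2(y)$ for $x\ne y$), and strongly dynamics preserving: if $\gamma_n\in\mathrm{PSL}(2,\mathbb Z)$, $\gamma_n\to x\in\partial_\infty\mathbb H^2$ and $\gamma_n^{-1}\to y\in\partial_\infty\mathbb H^2$ (convergence of orbits in $\mathbb H^2\cup\partial_\infty\mathbb H^2$), then $\rho(\gamma_n)(v,\ell)\to\xi(x)$ for every point $v\notin\xi^2(y)$ and every line $\ell\not\ni\xi^1(y)$. In particular, when every $\rho(\gamma_n)$ is a projective transformation, $\rho(\gamma_n)v\to\xi^1(x)$ for every $v\notin\xi^2(y)$. 2. For every set $\mathcal P$ of representatives of the conjugacy classes of maximal parabolic subgroups of $\mathrm{PSL}(2,\mathbb Z)$, the pair $(\mathrm{PSL}(2,\mathbb Z),\mathcal P)$ is relatively hyperbolic with Bowditch boundary $\partial_\infty\mathbb H^2$. 3. Let $\Gamma_o=\rho^{-1}(\mathrm{PGL}(3,\mathbb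 R))$, a subgroup of index two. For every set $\mathcal P_o$ of representatives of the conjugacy classes of maximal parabolic (cusp) subgroups of $\Gamma_o$, the pair $(\Gamma_o,\mathcal P_o)$ is relatively hyperbolic and $\rho|_{\Gamma_o}:\Gamma_o\to\mathrm{PGL}(3,\mathbb R)$ is $\mathsf P_1$-Anosov relative to $\mathcal P_o$: there is a continuous, equivariant, transverse map $\xi=(\xi^1,\xi^2)$ from the Bowditch boundary $\partial(\Gamma_o,\mathcal P_o)$ to $\mathbf P(\mathbb R^3)\times\mathbf P(\mathbb R^{3*})$ such that, if $\gamma_n\in\Gamma_o$, $\gamma_n\to x$ and $\gamma_n^{-1}\to y$ in $\partial(\Gamma_o,\mathcal P_o)$, then $\rho(\gamma_n)v\to\xi^1(x)$ for all $v\notin\xi^2(y)$. Here $(\Gamma,\mathcal P)$ is relatively hyperbolic with Bowditch boundary $M$ if $\Gamma$ is finitely generated, $\mathcal P$ is a finite collection of finitely generated subgroups, and $\Gamma$ acts on the nonempty perfect compact metrizable space $M$ as a geometrically finite convergence group (every point is a conical limit point or a bounded parabolic point) whose maximal parabolic subgroups are exactly the conjugates of the members of $\mathcal P$. -/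

import Mathlib

open Filter Topology UpperHalfPlane
open scoped MatrixGroups LinearAlgebra.Projectivization

noncomputable section

/-! ### Projective space, its dual, and projective symmetries -/

/-- The quotient topology on real projective space. -/
instance projTopology (d : ℕ) : TopologicalSpace (ℙ ℝ (Fin d → ℝ)) :=
  inferInstanceAs (TopologicalSpace (Quotient (projectivizationSetoid ℝ (Fin d → ℝ))))

/-- Points of `P(ℝ^d)`. -/
abbrev Pt (d : ℕ) : Type := ℙ ℝ (Fin d → ℝ)

/-- Points of the dual projective space `P(ℝ^{d*})`, i.e. hyperplanes of `P(ℝ^d)`. A covector is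
written as a row vector `ℓ`; its hyperplane is `{[v] | ℓ ⬝ᵥ v = 0}`. For `d = 3` these are the
projective lines. -/
abbrev Hyp (d : ℕ) : Type := ℙ ℝ (Fin d → ℝ)

/-- The point `v` lies on the hyperplane `l`. -/
def Incident {d : ℕ} (v : Pt d) (l : Hyp d) : Prop := Projectivization.orthogonal l v

/-- The line through two (distinct) points of the projective plane. -/
def join (v w : Pt 3) : Hyp 3 := Projectivization.cross v w

/-- The intersection point of two (distinct) lines of the projective plane. -/
def meet (l m : Hyp 3) : Pt 3 := Projectivization.cross l m

/-- Inverse transpose on `GL(d, ℝ)`. -/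
def glContra (d : ℕ) : GL (Fin d) ℝ →* GL (Fin d) ℝ where
  toFun g := ⟨(g⁻¹.val).transpose, (g.val).transpose,
    by rw [← Matrix.transpose_mul, Units.mul_inv, Matrix.transpose_one],
    by rw [← Matrix.transpose_mul, Units.inv_mul, Matrix.transpose_one]⟩
  map_one' := by
    apply Units.ext
    simp
  map_mul' g h := by
    apply Units.ext
    simp [mul_inv_rev, Matrix.transpose_mul]

lemma glContra_glContra (d : ℕ) (g : GL (Fin d) ℝ) : glContra d (glContra d g) = g := by
  apply Units.ext
  change ((g.val).transpose).transpose = g.val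
  simp

lemma glContra_scalar (d : ℕ) (u : ℝˣ) :
    glContra d (Matrix.GeneralLinearGroup.scalar (Fin d) u) =
      Matrix.GeneralLinearGroup.scalar (Fin d) u⁻¹ := by
  apply Units.ext
  change ((((Matrix.GeneralLinearGroup.scalar (Fin d) u)⁻¹ : GL (Fin d) ℝ)).val).transpose = _
  rw [← map_inv, Matrix.GeneralLinearGroup.coe_scalar]
  simp [Matrix.scalar_apply]

/-- Inverse transpose on `PGL(d, ℝ)`. -/
def contra (d : ℕ) : PGL(d, ℝ) →* PGL(d, ℝ) :=
  Matrix.ProjGenLinGroup.lift (Matrix.ProjGenLinGroup.mk.comp (glContra d)) (by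
    ext u
    simp [glContra_scalar])

lemma contra_contra (d : ℕ) (g : PGL(d, ℝ)) : contra d (contra d g) = g := by
  induction g using Matrix.ProjGenLinGroup.induction_on with
  | mk g => simp [contra, glContra_glContra]

/-- Inverse transpose as an automorphism of `PGL(d, ℝ)`. -/
def contraAut (d : ℕ) : MulAut (PGL(d, ℝ)) where
  toFun := contra d
  invFun := contra d
  left_inv := contra_contra d
  right_inv := contra_contra d
  map_mul' := map_mul _

/-- A projective transformation `[A]` maps the hyperplane of `ℓ` to that of `ℓ A⁻¹`. -/
def hypAct {d : ℕ} (g : PGL(d, ℝ)) (l : Hyp d) : Hyp d := contra d g • l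

/-- The action of `{1, -1}` on `PGL(3, ℝ)` in which `-1` acts by inverse transpose. -/
def signAct : ℤˣ →* MulAut (PGL(3, ℝ)) where
  toFun e := if e = 1 then 1 else contraAut 3
  map_one' := by simp
  map_mul' a b := by
    have h : contraAut 3 * contraAut 3 = 1 := by
      ext g : 1
      exact contra_contra 3 g
    rcases Int.units_eq_one_or a with rfl | rfl <;> rcases Int.units_eq_one_or b with rfl | rfl <;>
      simp [h]

/-- The group of projective symmetries of the projective plane: projective transformations `(A, 1)`
and dualities `(A, -1)`. The element `(1, -1)` is the standard polarity, which exchanges the point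
`[v]` and the line `{x | v ⬝ᵥ x = 0}`, and `(A, -1)` is the standard polarity followed by `A`. -/
abbrev ProjSym : Type := PGL(3, ℝ) ⋊[signAct] ℤˣ

/-- `g` is a projective transformation (maps points to points and lines to lines). -/
def ProjSym.IsProjective (g : ProjSym) : Prop := g.right = 1

/-- `g` is a duality (maps points to lines and lines to points). -/
def ProjSym.IsDuality (g : ProjSym) : Prop := g.right = -1

/-- The action of projective symmetries on pairs (point, line): a projective transformation acts on
each entry; a duality `D` maps `(v, l)` to `(D l, D v)`. -/
def ProjSym.act (g : ProjSym) (f : Pt 3 × Hyp 3) : Pt 3 × Hyp 3 :=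
  if g.right = 1 then (g.left • f.1, hypAct g.left f.2) else (g.left • f.2, hypAct g.left f.1)

/-- For a homomorphism `ρ` to the group of projective symmetries, the subgroup of elements that
`ρ` sends to projective transformations. -/
def projSubgroup {Γ : Type*} [Group Γ] (ρ : Γ →* ProjSym) : Subgroup Γ :=
  (SemidirectProduct.rightHom.comp ρ).ker

/-- The restriction of `ρ` to `projSubgroup ρ`, as a representation into `PGL(3, ℝ)`. -/
def projRestrict {Γ : Type*} [Group Γ] (ρ : Γ →* ProjSym) : projSubgroup ρ →* PGL(3, ℝ) where
  toFun g := (ρ g).left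
  map_one' := by simp
  map_mul' g h := by
    have hg : (ρ g).right = 1 := g.2
    simp [hg]

/-! ### Marked boxes -/

/-- A pair of 6-tuples `((p, q, r, s, t, b), (P, Q, R, S, T, B))` of points and lines. -/
@[ext]
structure BoxData where
  p : Pt 3
  q : Pt 3
  r : Pt 3
  s : Pt 3
  t : Pt 3
  b : Pt 3
  P : Hyp 3
  Q : Hyp 3
  R : Hyp 3
  S : Hyp 3
  T : Hyp 3
  B : Hyp 3

namespace BoxData

/-- The incidence relations of an overmarked box. -/
structure Incidences (Θ : BoxData) : Prop where
  pT : Incident Θ.p Θ.T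
  tT : Incident Θ.t Θ.T
  qT : Incident Θ.q Θ.T
  sB : Incident Θ.s Θ.B
  bB : Incident Θ.b Θ.B
  rB : Incident Θ.r Θ.B
  sP : Incident Θ.s Θ.P
  tP : Incident Θ.t Θ.P
  rQ : Incident Θ.r Θ.Q
  tQ : Incident Θ.t Θ.Q
  qR : Incident Θ.q Θ.R
  bR : Incident Θ.b Θ.R
  pS : Incident Θ.p Θ.S
  bS : Incident Θ.b Θ.S

/-- The points `p, q, r, s` are, in this order, the vertices of a nondegenerate convex quadrilateral
(with vectors representing the vertices scaled so that `p + r = q + s` spans the crossing point of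
the diagonals), the point `t` lies in the open edge from `p` to `q`, and `b` lies in the open edge
from `r` to `s`. -/
def Convex (Θ : BoxData) : Prop :=
  ∃ p q r s : Fin 3 → ℝ, ∃ k l : ℝ, LinearIndependent ℝ ![p, q, r] ∧ p + r = q + s ∧
    0 < k ∧ 0 < l ∧
    Θ.p.submodule = Submodule.span ℝ {p} ∧ Θ.q.submodule = Submodule.span ℝ {q} ∧
    Θ.r.submodule = Submodule.span ℝ {r} ∧ Θ.s.submodule = Submodule.span ℝ {s} ∧
    Θ.t.submodule = Submodule.span ℝ {p + k • q} ∧ Θ.b.submodule = Submodule.span ℝ {r + l • s}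

/-- Overmarked boxes (with the standing convexity of the configuration). -/
structure IsOvermarkedBox (Θ : BoxData) : Prop where
  incidences : Θ.Incidences
  convex : Θ.Convex

/-- The involution flipping a box around its central axis `tb`. -/
def flip (Θ : BoxData) : BoxData :=
  ⟨Θ.q, Θ.p, Θ.s, Θ.r, Θ.t, Θ.b, Θ.Q, Θ.P, Θ.S, Θ.R, Θ.T, Θ.B⟩

/-- Two overmarked boxes define the same marked box. -/
def SameMarkedBox (Θ Θ' : BoxData) : Prop := Θ' = Θ ∨ Θ' = Θ.flip

/-- The dual (exterior) box. -/
def dual (Θ : BoxData) : BoxData :=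
  ⟨Θ.s, Θ.r, Θ.p, Θ.q, Θ.b, Θ.t, Θ.R, Θ.S, Θ.Q, Θ.P, Θ.B, Θ.T⟩

/-- The dual of the top box produced by Pappus's theorem. -/
def dualTop (Θ : BoxData) : BoxData :=
  ⟨meet Θ.P Θ.S, meet Θ.Q Θ.R, Θ.p, Θ.q, meet (join Θ.q Θ.s) (join Θ.p Θ.r), Θ.t,
    join Θ.q Θ.s, join Θ.p Θ.r, Θ.Q, Θ.P, join (meet Θ.Q Θ.R) (meet Θ.P Θ.S), Θ.T⟩

/-- The dual of the bottom box produced by Pappus's theorem. -/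
def dualBottom (Θ : BoxData) : BoxData :=
  ⟨Θ.s, Θ.r, meet Θ.P Θ.S, meet Θ.Q Θ.R, Θ.b, meet (join Θ.q Θ.s) (join Θ.p Θ.r),
    Θ.R, Θ.S, join Θ.p Θ.r, join Θ.q Θ.s, Θ.B, join (meet Θ.Q Θ.R) (meet Θ.P Θ.S)⟩

/-- The action of projective symmetries on boxes. A projective transformation acts on each entry. A
duality `D` maps `((p, q, r, s, t, b), (P, Q, R, S, T, B))` to
`((D P, D Q, D S, D R, D T, D B), (D q, D p, D r, D s, D t, D b))`. -/
def act (g : ProjSym) (Θ : BoxData) : BoxData :=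
  if g.right = 1 then
    ⟨g.left • Θ.p, g.left • Θ.q, g.left • Θ.r, g.left • Θ.s, g.left • Θ.t, g.left • Θ.b,
      hypAct g.left Θ.P, hypAct g.left Θ.Q, hypAct g.left Θ.R, hypAct g.left Θ.S,
      hypAct g.left Θ.T, hypAct g.left Θ.B⟩
  else
    ⟨g.left • Θ.P, g.left • Θ.Q, g.left • Θ.S, g.left • Θ.R, g.left • Θ.T, g.left • Θ.B,
      hypAct g.left Θ.q, hypAct g.left Θ.p, hypAct g.left Θ.r, hypAct g.left Θ.s,
      hypAct g.left Θ.t, hypAct g.left Θ.b⟩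

end BoxData

/-! ### The modular group and its actions -/

/-- The modular group `PSL(2, ℤ)`. -/
abbrev PSL2Z : Type := Matrix.ProjectiveSpecialLinearGroup (Fin 2) ℤ

/-- The element of order three. -/
def genA : PSL2Z :=
  QuotientGroup.mk (⟨!![-1, 1; -1, 0], by simp [Matrix.det_fin_two]⟩ : SL(2, ℤ))

/-- The element of order two. -/
def genD : PSL2Z :=
  QuotientGroup.mk (⟨!![0, 1; -1, 0], by simp [Matrix.det_fin_two]⟩ : SL(2, ℤ))

/-- The homomorphism `PSL(2, ℤ) → PGL(2, ℝ)`. -/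
def pslToPGL : PSL2Z →* PGL(2, ℝ) :=
  QuotientGroup.lift _
    ((Matrix.ProjGenLinGroup.mk).comp (Matrix.SpecialLinearGroup.mapGL ℝ : SL(2, ℤ) →* _)) (by
      intro g hg
      obtain ⟨r, hr, hrg⟩ := Matrix.SpecialLinearGroup.mem_center_iff.mp hg
      have hu : IsUnit (r : ℝ) := by
        have : IsUnit r := IsUnit.of_pow_eq_one hr (by simp)
        exact this.map (Int.castRingHom ℝ)
      obtain ⟨u, hu⟩ := hu
      have : (Matrix.SpecialLinearGroup.mapGL ℝ g : GL (Fin 2) ℝ) =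
          Matrix.GeneralLinearGroup.scalar (Fin 2) u := by
        apply Units.ext
        rw [Matrix.SpecialLinearGroup.mapGL_coe_matrix, Matrix.GeneralLinearGroup.coe_scalar]
        ext i j
        have h := congrArg (Int.cast : ℤ → ℝ) (congrFun (congrFun hrg i) j)
        refine h.symm.trans ?_
        simp only [Matrix.scalar_apply, Matrix.diagonal_apply]
        split_ifs <;> simp [hu]
      rw [MonoidHom.mem_ker, MonoidHom.comp_apply, this]
      simp)

/-- `PSL(2, ℤ)` acts on the upper half-plane by Möbius transformations. -/
instance pslActH : MulAction PSL2Z ℍ := MulAction.compHom ℍ pslToPGL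

/-- Möbius action of `PGL(2, ℝ)` on the ideal boundary `ℝ ∪ {∞}` of the hyperbolic plane. -/
@[reducible]
def pglActBoundary : MulAction (PGL(2, ℝ)) (OnePoint ℝ) :=
  Matrix.ProjGenLinGroup.mulActionOfGL (fun u x => by
    cases x with
    | infty => simp [OnePoint.smul_infty_eq_ite]
    | coe x => simp [OnePoint.smul_some_eq_ite])

/-- `PSL(2, ℤ)` acts on the ideal boundary `ℝ ∪ {∞}` by Möbius transformations. -/
instance pslActBoundary : MulAction PSL2Z (OnePoint ℝ) :=
  letI := pglActBoundary
  MulAction.compHom (OnePoint ℝ) pslToPGL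

/-- A sequence in `PSL(2, ℤ)` converges to the ideal point `x`: some orbit of it in the upper
half-plane converges to `x` in the closed upper half-plane, viewed in the Riemann sphere. -/
def TendsToIdeal (γ : ℕ → PSL2Z) (x : OnePoint ℝ) : Prop :=
  ∃ z : ℍ, Tendsto (fun n => (((γ n • z : ℍ) : ℂ) : OnePoint ℂ)) atTop
    (𝓝 (OnePoint.map (fun a : ℝ => (a : ℂ)) x))

/-! ### Relatively hyperbolic groups through their Bowditch boundary -/

section Convergence

variable {Γ : Type*} [Group Γ] {M : Type*} [TopologicalSpace M] [MulAction Γ M]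

/-- `γ n` converges to the constant `x` uniformly on compact subsets of `M \ {y}`. -/
def TendsToAway (γ : ℕ → Γ) (x y : M) : Prop :=
  ∀ K : Set M, IsCompact K → y ∉ K → ∀ U ∈ 𝓝 x, ∀ᶠ n in atTop, ∀ z ∈ K, γ n • z ∈ U

/-- Convergence `γ n → x ∈ M` in the compactification `Γ ∪ M` of a convergence group. -/
def TendsToBoundary (γ : ℕ → Γ) (x : M) : Prop :=
  ∀ φ : ℕ → ℕ, StrictMono φ → ∃ ψ : ℕ → ℕ, StrictMono ψ ∧
    ∃ y : M, TendsToAway (fun n => γ (φ (ψ n))) x y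

variable (Γ M) in
/-- `Γ` acts on `M` by homeomorphisms as a (discrete) convergence group. -/
structure IsConvergenceAction : Prop where
  continuous_smul : ∀ g : Γ, Continuous (fun x : M => g • x)
  convergence : ∀ γ : ℕ → Γ, Function.Injective γ → ∃ φ : ℕ → ℕ, StrictMono φ ∧
    ∃ x y : M, TendsToAway (fun n => γ (φ n)) x y

variable (M) in
/-- Loxodromic elements: infinite order and exactly two fixed points. -/
def IsLoxodromicOn (g : Γ) : Prop := orderOf g = 0 ∧ {x : M | g • x = x}.ncard = 2

variable (M) in
/-- Parabolic subgroups: infinite, with a global fixed point, and without loxodromic elements. -/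
def IsParabolicSubgroup (H : Subgroup Γ) : Prop :=
  (H : Set Γ).Infinite ∧ (∃ x : M, ∀ h ∈ H, h • x = x) ∧ ∀ h ∈ H, ¬ IsLoxodromicOn M h

variable (M) in
/-- Maximal parabolic subgroups. -/
def IsMaximalParabolic (H : Subgroup Γ) : Prop :=
  IsParabolicSubgroup M H ∧ ∀ K : Subgroup Γ, IsParabolicSubgroup M K → H ≤ K → K = H

variable (Γ) in
/-- Conical limit points. -/
def IsConicalPoint (x : M) : Prop :=
  ∃ (γ : ℕ → Γ) (a b : M), a ≠ b ∧ Tendsto (fun n => γ n • x) atTop (𝓝 a) ∧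
    ∀ z : M, z ≠ x → Tendsto (fun n => γ n • z) atTop (𝓝 b)

variable (Γ) in
/-- Bounded parabolic points: the stabilizer is parabolic and acts cocompactly on `M \ {x}`. -/
def IsBoundedParabolicPoint (x : M) : Prop :=
  IsParabolicSubgroup M (MulAction.stabilizer Γ x) ∧
    ∃ K : Set M, IsCompact K ∧ x ∉ K ∧ ∀ z : M, z ≠ x → ∃ h ∈ MulAction.stabilizer Γ x, h • z ∈ K

/-- `H` is conjugate to `P`. -/
def IsConjSubgroup (P H : Subgroup Γ) : Prop := ∃ g : Γ, H = P.map (MulAut.conj g).toMonoidHom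

variable (M) in
/-- `Ps` is a set of representatives of the conjugacy classes of maximal parabolic subgroups. -/
def IsParabolicRepresentatives (Ps : Set (Subgroup Γ)) : Prop :=
  (∀ P ∈ Ps, IsMaximalParabolic M P) ∧
    ∀ H : Subgroup Γ, IsMaximalParabolic M H → ∃! P : Subgroup Γ, P ∈ Ps ∧ IsConjSubgroup P H

variable (M) in
/-- `(Γ, Ps)` is relatively hyperbolic with Bowditch boundary `M`: the finitely generated group `Γ`
acts on the perfect compact metrizable space `M` as a geometrically finite convergence group, and
its maximal parabolic subgroups are the conjugates of the members of `Ps`, a finite collection of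
finitely generated subgroups. -/
structure IsBowditchBoundary (Ps : Set (Subgroup Γ)) : Prop where
  fg : Group.FG Γ
  finite : Ps.Finite
  fg_peripheral : ∀ P ∈ Ps, P.FG
  nonempty : Nonempty M
  compact : CompactSpace M
  metrizable : TopologicalSpace.MetrizableSpace M
  perfect : PerfectSpace M
  convergence : IsConvergenceAction Γ M
  geometricallyFinite : ∀ x : M, IsConicalPoint Γ x ∨ IsBoundedParabolicPoint Γ x
  maximalParabolic : ∀ H : Subgroup Γ, IsMaximalParabolic M H ↔ ∃ P ∈ Ps, IsConjSubgroup P H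

/-- Transversality of a map to `P(ℝ^d) × P(ℝ^{d*})`. -/
def IsTransverse {d : ℕ} (ξ : M → Pt d × Hyp d) : Prop :=
  ∀ x y : M, x ≠ y → ¬ Incident (ξ x).1 (ξ y).2

/-- Continuous, equivariant, transverse, strongly dynamics preserving boundary maps of a
representation into `PGL(d, ℝ)`. -/
structure IsAnosovBoundaryMap {d : ℕ} (ρ : Γ →* PGL(d, ℝ)) (ξ : M → Pt d × Hyp d) : Prop where
  continuous : Continuous ξ
  equivariant : ∀ (g : Γ) (x : M), ξ (g • x) = (ρ g • (ξ x).1, hypAct (ρ g) (ξ x).2)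
  transverse : IsTransverse ξ
  stronglyDynamicsPreserving : ∀ (γ : ℕ → Γ) (x y : M),
    TendsToBoundary γ x → TendsToBoundary (fun n => (γ n)⁻¹) y →
    ∀ v : Pt d, ¬ Incident v (ξ y).2 → Tendsto (fun n => ρ (γ n) • v) atTop (𝓝 (ξ x).1)

/-- `(Γ, Ps)` is relatively hyperbolic and `ρ` is `P₁`-Anosov relative to `Ps`. -/
def IsP1AnosovRelative {d : ℕ} (Ps : Set (Subgroup Γ)) (ρ : Γ →* PGL(d, ℝ)) : Prop :=
  ∃ (N : Type) (_ : TopologicalSpace N) (_ : MulAction Γ N),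
    IsBowditchBoundary N Ps ∧ ∃ ξ : N → Pt d × Hyp d, IsAnosovBoundaryMap ρ ξ

end Convergence

/-! ### Pappus–Schwartz representations -/

/-- `ρ` is the Pappus–Schwartz representation of the marked box of `Θ`: `ρ(d)` is a duality taking
the box to its dual box, and `ρ(a)` is a projective transformation cycling the box, the dual of its
top box and the dual of its bottom box. -/
structure IsPappusSchwartz (Θ : BoxData) (ρ : PSL2Z →* ProjSym) : Prop where
  duality : (ρ genD).IsDuality
  box_to_dual : BoxData.SameMarkedBox Θ.dual (Θ.act (ρ genD))
  projective : (ρ genA).IsProjective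
  box_to_top : BoxData.SameMarkedBox Θ.dualTop (Θ.act (ρ genA))
  top_to_bottom : BoxData.SameMarkedBox Θ.dualBottom (Θ.dualTop.act (ρ genA))
  bottom_to_box : BoxData.SameMarkedBox Θ (Θ.dualBottom.act (ρ genA))

/-- Continuous, equivariant, transverse, strongly dynamics preserving boundary maps on
`∂ℍ² = ℝ ∪ {∞}` of a homomorphism from `PSL(2, ℤ)` to the group of projective symmetries. -/
structure IsPappusBoundaryMap (ρ : PSL2Z →* ProjSym) (ξ : OnePoint ℝ → Pt 3 × Hyp 3) : Prop where
  continuous : Continuous ξ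
  equivariant : ∀ (g : PSL2Z) (x : OnePoint ℝ), ξ (g • x) = (ρ g).act (ξ x)
  transverse : IsTransverse ξ
  stronglyDynamicsPreserving : ∀ (γ : ℕ → PSL2Z) (x y : OnePoint ℝ),
    TendsToIdeal γ x → TendsToIdeal (fun n => (γ n)⁻¹) y →
    ∀ (v : Pt 3) (l : Hyp 3), ¬ Incident v (ξ y).2 → ¬ Incident (ξ y).1 l →
      Tendsto (fun n => (ρ (γ n)).act (v, l)) atTop (𝓝 (ξ x))

end

/-!
The proof rests on a normal form, a free product decomposition and a contraction argument.

*Existence and uniqueness of the representation.* Every overmarked box is the projective image of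
a standard box depending on two parameters (`exists_eq_act_stdBox`). For a standard box the cyclic
symmetry of order three is an explicit matrix (`stdMat`) and the box is carried to its dual by an
explicit polarity. Since `PSL(2,ℤ)` is the free product of the subgroups generated by its elements
of orders three and two, proved here by ping-pong on the projective line
(`exists_hom_of_relations`), these two elements define a representation (`exists_isStdRep`). A
marked box determines each symmetry only up to the projective involution that exchanges the two
orders of its marking. That involution centralizes the standard representation; the relation
`a ^ 3 = 1` excludes it from the image of `a`, so that at most the image of `d` is multiplied by
it (`eq_or_eq_mul_of_isPappusSchwartz`). It fixes the flag attached to the cusp `∞`, and therefore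
the boundary map of the standard representation is equivariant for both representations.

*The boundary map.* The parabolic elements `x ↦ x + 1` and `x ↦ x / (x + 1)` generate the semigroup
that maps the arc `[0, ∞]` into itself, and both map the closed flag box of the marking into itself
(`letter_smul_mem`). Along the Farey expansion of an irrational number the letter changes infinitely
often, and at each change the box is mapped into the interior, with uniform constants; hence the
nested images shrink to a single flag (`eq_smul_of_nested_cones`). Along the powers of a single
parabolic they shrink to its fixed flag, by direct computation with unipotent matrices. Hence the images of the box under all group elements whose arcs shrink to `x` converge
to one flag `ξ x` (`exists_boundaryMap`), which gives continuity and equivariance. Two distinct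
points of the projective line are separated by a Farey edge, and their flags then lie in two
opposite boxes; transversality is a matter of signs.

*Dynamics.* If `γ n → x` and `γ n ⁻¹ → y`, the matrices of `ρ (γ n)`, normalized, have limits of
rank one only, with image `ξ¹ x` and kernel `ξ² y` (`tendsto_pgl_smul_of_contracting`); this is the
strong dynamics preserving property, and its dual version is the statement on lines.

*Relative hyperbolicity.* The group `PSL(2,ℤ)` and its subgroup of index two act on the real
projective line as geometrically finite convergence groups: rational points are bounded parabolic,
irrational points are conical by Dirichlet approximation, and the maximal parabolic subgroups are
the stabilizers of the rational points (`isBowditchBoundary_of_hom`).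
-/

noncomputable section

/-! ### Topology of real projective spaces -/

lemma continuous_projMk (d : ℕ) :
    Continuous (fun v : {v : Fin d → ℝ // v ≠ 0} => Projectivization.mk ℝ v.1 v.2) :=
  continuous_quotient_mk'

lemma isQuotientMap_projMk (d : ℕ) :
    IsQuotientMap (fun v : {v : Fin d → ℝ // v ≠ 0} => Projectivization.mk ℝ v.1 v.2) :=
  isQuotientMap_quotient_mk'

lemma tendsto_projMk {d : ℕ} {ι : Type*} {f : Filter ι} {v : ι → Fin d → ℝ} {w : Fin d → ℝ}
    (hv : ∀ i, v i ≠ 0) (hw : w ≠ 0) (h : Tendsto v f (𝓝 w)) :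
    Tendsto (fun i => Projectivization.mk ℝ (v i) (hv i)) f (𝓝 (Projectivization.mk ℝ w hw)) := by
  have h' : Tendsto (fun i => (⟨v i, hv i⟩ : {v : Fin d → ℝ // v ≠ 0})) f (𝓝 ⟨w, hw⟩) :=
    tendsto_subtype_rng.mpr h
  exact ((continuous_projMk d).tendsto _).comp h'

/-- The matrix of the orthogonal projection onto a line, for the standard dot product. It embeds the
projective space into the space of matrices, which makes it a Hausdorff space. -/
def projMatrix {d : ℕ} (x : Pt d) : Matrix (Fin d) (Fin d) ℝ :=
  Projectivization.lift (fun v => (v.1 ⬝ᵥ v.1)⁻¹ • Matrix.vecMulVec v.1 v.1) (by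
    rintro ⟨v, hv⟩ ⟨w, hw⟩ t rfl
    have ht : t ≠ 0 := by rintro rfl; simp at hv
    ext i j
    simp only [Matrix.smul_apply, Matrix.vecMulVec_apply, Pi.smul_apply, smul_eq_mul,
      dotProduct_smul, smul_dotProduct]
    have : w ⬝ᵥ w ≠ 0 := fun h => hw (dotProduct_self_eq_zero.mp h)
    field_simp) x

lemma continuous_projMatrix (d : ℕ) : Continuous (projMatrix (d := d)) := by
  rw [(isQuotientMap_projMk d).continuous_iff]
  change Continuous (fun v : {v : Fin d → ℝ // v ≠ 0} =>
    (v.1 ⬝ᵥ v.1)⁻¹ • Matrix.vecMulVec v.1 v.1)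
  have h1 : Continuous (fun v : {v : Fin d → ℝ // v ≠ 0} => v.1 ⬝ᵥ v.1) := by
    exact continuous_finsetSum _ fun i _ => ((continuous_apply i).comp continuous_subtype_val).mul
      ((continuous_apply i).comp continuous_subtype_val)
  have h2 : Continuous (fun v : {v : Fin d → ℝ // v ≠ 0} => Matrix.vecMulVec v.1 v.1) := by
    refine continuous_matrix fun i j => ?_
    exact ((continuous_apply i).comp continuous_subtype_val).mul
      ((continuous_apply j).comp continuous_subtype_val)
  exact (h1.inv₀ fun v h => v.2 (dotProduct_self_eq_zero.mp h)).smul h2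

lemma projMatrix_injective (d : ℕ) : Function.Injective (projMatrix (d := d)) := by
  intro x y
  induction x using Projectivization.ind with | h v hv => ?_
  induction y using Projectivization.ind with | h w hw => ?_
  intro h
  change (v ⬝ᵥ v)⁻¹ • Matrix.vecMulVec v v = (w ⬝ᵥ w)⁻¹ • Matrix.vecMulVec w w at h
  have hv' : v ⬝ᵥ v ≠ 0 := fun h => hv (dotProduct_self_eq_zero.mp h)
  rw [Projectivization.mk_eq_mk_iff']
  refine ⟨(w ⬝ᵥ w)⁻¹ * (w ⬝ᵥ v), ?_⟩
  have h' := congrArg (fun M => Matrix.mulVec M v) h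
  simp only [Matrix.smul_mulVec, Matrix.vecMulVec_mulVec] at h'
  rw [mul_smul]
  simpa [smul_smul, hv'] using h'.symm

instance (d : ℕ) : T2Space (Pt d) :=
  T2Space.of_injective_continuous (projMatrix_injective d) (continuous_projMatrix d)

instance (d : ℕ) : CompactSpace (Pt d) := by
  have hc : IsCompact (Metric.sphere (0 : Fin d → ℝ) 1) := isCompact_sphere _ _
  have : CompactSpace (Metric.sphere (0 : Fin d → ℝ) 1) := isCompact_iff_compactSpace.mp hc
  let f : Metric.sphere (0 : Fin d → ℝ) 1 → Pt d := fun v =>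
    Projectivization.mk ℝ v.1 (ne_zero_of_mem_unit_sphere v)
  have hf : Continuous f :=
    (continuous_projMk d).comp (continuous_subtype_val.subtype_mk ne_zero_of_mem_unit_sphere)
  have hs : Function.Surjective f := by
    intro x
    induction x using Projectivization.ind with | h v hv => ?_
    refine ⟨⟨‖v‖⁻¹ • v, by simp [norm_smul, hv]⟩, ?_⟩
    rw [Projectivization.mk_eq_mk_iff']
    exact ⟨‖v‖⁻¹, rfl⟩
  exact hs.compactSpace hf

/-! ### Projective symmetries acting on flags -/

lemma incident_mk {d : ℕ} {v l : Fin d → ℝ} (hv : v ≠ 0) (hl : l ≠ 0) :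
    Incident (Projectivization.mk ℝ v hv) (Projectivization.mk ℝ l hl) ↔ l ⬝ᵥ v = 0 := Iff.rfl

lemma incident_swap {d : ℕ} (v l : Pt d) : Incident v l ↔ Incident l v :=
  Projectivization.orthogonal_comm

lemma gl_smul_ne_zero {d : ℕ} (g : GL (Fin d) ℝ) {v : Fin d → ℝ} (hv : v ≠ 0) :
    g.val.mulVec v ≠ 0 := (smul_ne_zero_iff_ne g).2 hv

lemma pgl_smul_mk {d : ℕ} (g : GL (Fin d) ℝ) {v : Fin d → ℝ} (hv : v ≠ 0) :
    (Matrix.ProjGenLinGroup.mk g : PGL(d, ℝ)) • Projectivization.mk ℝ v hv =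
      Projectivization.mk ℝ (g.val.mulVec v) (gl_smul_ne_zero g hv) := rfl

lemma contra_mk {d : ℕ} (g : GL (Fin d) ℝ) :
    contra d (Matrix.ProjGenLinGroup.mk g) = Matrix.ProjGenLinGroup.mk (glContra d g) := rfl

lemma continuous_pgl_smul {d : ℕ} (g : PGL(d, ℝ)) : Continuous (fun x : Pt d => g • x) := by
  induction g using Matrix.ProjGenLinGroup.induction_on with | mk g => ?_
  rw [(isQuotientMap_projMk d).continuous_iff]
  refine (continuous_projMk d).comp (Continuous.subtype_mk (?_ : Continuous
    (fun v : {v : Fin d → ℝ // v ≠ 0} => g.val.mulVec v.1)) fun v => gl_smul_ne_zero g v.2)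
  exact Continuous.matrix_mulVec continuous_const continuous_subtype_val

lemma incident_smul {d : ℕ} (g : PGL(d, ℝ)) (v : Pt d) (l : Hyp d) :
    Incident (g • v) (hypAct g l) ↔ Incident v l := by
  induction g using Matrix.ProjGenLinGroup.induction_on with | mk g => ?_
  induction v using Projectivization.ind with | h v hv => ?_
  induction l using Projectivization.ind with | h l hl => ?_
  rw [hypAct, contra_mk, pgl_smul_mk, pgl_smul_mk, incident_mk, incident_mk]
  have : (glContra d g).val = (g⁻¹.val).transpose := rfl
  rw [this, Matrix.mulVec_transpose, ← Matrix.dotProduct_mulVec, Matrix.mulVec_mulVec,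
    Units.inv_mul, Matrix.one_mulVec]

lemma hypAct_mul {d : ℕ} (g h : PGL(d, ℝ)) (l : Hyp d) :
    hypAct (g * h) l = hypAct g (hypAct h l) := by
  simp [hypAct, mul_smul]

lemma hypAct_one {d : ℕ} (l : Hyp d) : hypAct (1 : PGL(d, ℝ)) l = l := by
  simp [hypAct]

lemma hypAct_contra {d : ℕ} (g : PGL(d, ℝ)) (l : Hyp d) : hypAct (contra d g) l = g • l := by
  simp [hypAct, contra_contra]

lemma signAct_one_apply (g : PGL(3, ℝ)) : signAct 1 g = g := by simp

lemma signAct_neg_one_apply (g : PGL(3, ℝ)) : signAct (-1) g = contra 3 g := by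
  change (if (-1 : ℤˣ) = 1 then (1 : MulAut (PGL(3, ℝ))) else contraAut 3) g = _
  rw [if_neg (by decide)]; rfl

namespace ProjSym

lemma right_eq (g : ProjSym) : g.right = 1 ∨ g.right = -1 := Int.units_eq_one_or _

lemma act_of_right_one {g : ProjSym} (hg : g.right = 1) (f : Pt 3 × Hyp 3) :
    g.act f = (g.left • f.1, hypAct g.left f.2) := by
  rw [act, if_pos hg]

lemma act_of_right_neg {g : ProjSym} (hg : g.right = -1) (f : Pt 3 × Hyp 3) :
    g.act f = (g.left • f.2, hypAct g.left f.1) := by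
  rw [act, if_neg (by rw [hg]; decide)]

lemma act_one (f : Pt 3 × Hyp 3) : (1 : ProjSym).act f = f := by
  rw [act_of_right_one rfl]
  simp [hypAct_one]

lemma act_mul (g h : ProjSym) (f : Pt 3 × Hyp 3) : (g * h).act f = g.act (h.act f) := by
  rcases right_eq g with hg | hg <;> rcases right_eq h with hh | hh
  · rw [act_of_right_one (by simp [hg, hh]), act_of_right_one hg, act_of_right_one hh]
    simp [hg, hypAct_mul, mul_smul]
  · rw [act_of_right_neg (by simp [hg, hh]), act_of_right_one hg, act_of_right_neg hh]
    simp [hg, hypAct_mul, mul_smul]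
  · rw [act_of_right_neg (by simp [hg, hh]), act_of_right_neg hg, act_of_right_one hh]
    simp only [SemidirectProduct.mul_left, hg, signAct_neg_one_apply, hypAct_mul, mul_smul,
      hypAct_contra]
    simp [hypAct]
  · rw [act_of_right_one (by simp [hg, hh]), act_of_right_neg hg, act_of_right_neg hh]
    simp only [SemidirectProduct.mul_left, hg, signAct_neg_one_apply, hypAct_mul, mul_smul,
      hypAct_contra]
    simp [hypAct]

/-- Projective symmetries act on pairs (point, line). -/
instance : MulAction ProjSym (Pt 3 × Hyp 3) where
  smul g f := g.act f
  one_smul := act_one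
  mul_smul := act_mul

lemma smul_def (g : ProjSym) (f : Pt 3 × Hyp 3) : g • f = g.act f := rfl

lemma continuous_act (g : ProjSym) : Continuous g.act := by
  have h1 := continuous_pgl_smul g.left
  have h2 := continuous_pgl_smul (contra 3 g.left)
  rcases right_eq g with hg | hg
  · rw [show g.act = _ from funext (act_of_right_one hg)]
    exact (h1.comp continuous_fst).prodMk (h2.comp continuous_snd)
  · rw [show g.act = _ from funext (act_of_right_neg hg)]
    exact (h1.comp continuous_snd).prodMk (h2.comp continuous_fst)

/-- Projective transformations preserve incidence. -/
lemma incident_act_of_right_one {g : ProjSym} (hg : g.right = 1) (f f' : Pt 3 × Hyp 3) :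
    Incident (g.act f).1 (g.act f').2 ↔ Incident f.1 f'.2 := by
  rw [act_of_right_one hg, act_of_right_one hg]
  exact incident_smul _ _ _

/-- Dualities reverse incidence. -/
lemma incident_act_of_right_neg {g : ProjSym} (hg : g.right = -1) (f f' : Pt 3 × Hyp 3) :
    Incident (g.act f).1 (g.act f').2 ↔ Incident f'.1 f.2 := by
  rw [act_of_right_neg hg, act_of_right_neg hg, incident_swap f'.1]
  exact incident_smul _ _ _

end ProjSym

/-! ### Homogeneous coordinates on the ideal boundary -/

/-- The ideal point `u / v ∈ ℝ ∪ {∞}` with homogeneous coordinates `(u, v) ≠ 0`. -/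
def hpt (u v : ℝ) : OnePoint ℝ := if v = 0 then OnePoint.infty else ((u / v : ℝ) : OnePoint ℝ)

lemma hpt_zero (u : ℝ) : hpt u 0 = OnePoint.infty := if_pos rfl

lemma hpt_of_ne {u v : ℝ} (h : v ≠ 0) : hpt u v = ((u / v : ℝ) : OnePoint ℝ) := if_neg h

lemma hpt_one (u : ℝ) : hpt u 1 = (u : OnePoint ℝ) := by rw [hpt_of_ne one_ne_zero, div_one]

lemma exists_eq_hpt (x : OnePoint ℝ) : ∃ u v : ℝ, (u ≠ 0 ∨ v ≠ 0) ∧ x = hpt u v := by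
  induction x using OnePoint.rec with
  | infty => exact ⟨1, 0, by simp, (hpt_zero _).symm⟩
  | coe r => exact ⟨r, 1, by simp, (hpt_one r).symm⟩

lemma hpt_eq_hpt_iff {u v u' v' : ℝ} (h : u ≠ 0 ∨ v ≠ 0) (h' : u' ≠ 0 ∨ v' ≠ 0) :
    hpt u v = hpt u' v' ↔ u * v' = u' * v := by
  by_cases hv : v = 0 <;> by_cases hv' : v' = 0
  · simp [hpt, hv, hv']
  · have : u ≠ 0 := by tauto
    simp [hpt, hv, hv', this]
  · have : u' ≠ 0 := by tauto
    simp [hpt, hv, hv', this]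
  · rw [hpt_of_ne hv, hpt_of_ne hv', OnePoint.coe_eq_coe, div_eq_div_iff hv hv']

lemma exists_abs_le_of_mem_nhds_infty {U : Set (OnePoint ℝ)} (hU : U ∈ 𝓝 (OnePoint.infty)) :
    ∃ M : ℝ, 0 < M ∧ ∀ r : ℝ, M ≤ |r| → (r : OnePoint ℝ) ∈ U := by
  obtain ⟨s, ⟨-, hs⟩, hsU⟩ := OnePoint.hasBasis_nhds_infty.mem_iff.mp hU
  obtain ⟨M, hM⟩ := hs.isBounded.exists_norm_le
  refine ⟨|M| + 1, by positivity, fun r hr => hsU (Or.inl ⟨r, fun h => ?_, rfl⟩)⟩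
  have := hM r h
  rw [Real.norm_eq_abs] at this
  linarith [le_abs_self M]

lemma mem_nhds_infty_of_abs {U : Set (OnePoint ℝ)} (M : ℝ) (h0 : OnePoint.infty ∈ U)
    (h : ∀ r : ℝ, M < |r| → (r : OnePoint ℝ) ∈ U) : U ∈ 𝓝 (OnePoint.infty) := by
  refine OnePoint.hasBasis_nhds_infty.mem_iff.mpr
    ⟨Set.Icc (-M) M, ⟨isClosed_Icc, isCompact_Icc⟩, ?_⟩
  rintro x (⟨r, hr, rfl⟩ | rfl)
  · refine h r (lt_of_not_ge fun h' => hr ?_)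
    exact abs_le.mp h'
  · exact h0

lemma tendsto_hpt {ι : Type*} {f : Filter ι} {u v : ι → ℝ} {a b : ℝ} (hu : Tendsto u f (𝓝 a))
    (hv : Tendsto v f (𝓝 b)) (h : a ≠ 0 ∨ b ≠ 0) :
    Tendsto (fun i => hpt (u i) (v i)) f (𝓝 (hpt a b)) := by
  by_cases hb : b = 0
  · subst hb
    have ha : a ≠ 0 := by simpa using h
    rw [hpt_zero]
    intro U hU
    obtain ⟨M, hM, hMU⟩ := exists_abs_le_of_mem_nhds_infty hU
    have ha' : 0 < |a| := abs_pos.mpr ha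
    rw [mem_map]
    have h1 : ∀ᶠ i in f, |a| / 2 < |u i| := hu.abs.eventually (lt_mem_nhds (by linarith))
    have h2 : ∀ᶠ i in f, |v i| < |a| / 2 / M :=
      hv.abs.eventually (gt_mem_nhds (by simp only [abs_zero]; positivity))
    filter_upwards [h1, h2] with i hi1 hi2
    by_cases hvi : v i = 0
    · simp only [Set.mem_preimage, hvi, hpt_zero]
      exact mem_of_mem_nhds hU
    · simp only [Set.mem_preimage, hpt_of_ne hvi]
      apply hMU
      have hvi' : 0 < |v i| := abs_pos.mpr hvi
      rw [abs_div, le_div_iff₀ hvi']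
      rw [lt_div_iff₀ hM] at hi2
      linarith
  · rw [hpt_of_ne hb]
    have h1 : Tendsto (fun i => ((u i / v i : ℝ) : OnePoint ℝ)) f (𝓝 ((a / b : ℝ) : OnePoint ℝ)) :=
      (OnePoint.continuous_coe.tendsto _).comp (hu.div hv hb)
    refine h1.congr' ?_
    filter_upwards [hv.eventually_ne hb] with i hi
    rw [hpt_of_ne hi]

/-- The integer matrix with given entries, as an element of `SL(2, ℤ)`. -/
def slMat (a b c d : ℤ) (h : a * d - b * c = 1) : SL(2, ℤ) :=
  ⟨!![a, b; c, d], by rw [Matrix.det_fin_two_of]; exact h⟩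

lemma slMat_val (a b c d : ℤ) (h : a * d - b * c = 1) :
    (slMat a b c d h).1 = !![a, b; c, d] := rfl

/-- The element of `PSL(2, ℤ)` given by an integer matrix of determinant one. -/
def psl (a b c d : ℤ) (h : a * d - b * c = 1) : PSL2Z :=
  QuotientGroup.mk (slMat a b c d h)

/-- The center of `SL(2, ℤ)` is `{1, -1}`. -/
lemma mk_eq_mk_iff_exists {M N : SL(2, ℤ)} : (QuotientGroup.mk M : PSL2Z) = QuotientGroup.mk N ↔
    ∃ r : ℤ, (r = 1 ∨ r = -1) ∧ ∀ i j, N.1 i j = r * M.1 i j := by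
  rw [QuotientGroup.eq, Matrix.SpecialLinearGroup.mem_center_iff]
  have hr2 : ∀ r : ℤ, r ^ Fintype.card (Fin 2) = 1 ↔ (r = 1 ∨ r = -1) := fun r => by
    rw [Fintype.card_fin]
    refine ⟨fun h => ?_, by rintro (rfl | rfl) <;> norm_num⟩
    rcases mul_eq_zero.mp (show (r - 1) * (r + 1) = 0 by linear_combination h) with h | h <;> omega
  constructor
  · rintro ⟨r, hr, e⟩
    refine ⟨r, (hr2 r).mp hr, fun i j => ?_⟩
    have e' : M.1 * (Matrix.scalar (Fin 2) r) = N.1 := by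
      rw [e, ← Matrix.SpecialLinearGroup.coe_mul, mul_inv_cancel_left]
    rw [← e', Matrix.scalar_apply, Matrix.mul_diagonal, mul_comm]
  · rintro ⟨r, hr, e⟩
    refine ⟨r, (hr2 r).mpr hr, ?_⟩
    have e' : N.1 = M.1 * (Matrix.scalar (Fin 2) r) := by
      ext i j
      rw [Matrix.scalar_apply, Matrix.mul_diagonal, e, mul_comm]
    rw [Matrix.SpecialLinearGroup.coe_mul, e', ← mul_assoc, ← Matrix.SpecialLinearGroup.coe_mul,
      inv_mul_cancel, Matrix.SpecialLinearGroup.coe_one, one_mul]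

lemma exists_eq_psl (g : PSL2Z) : ∃ (a b c d : ℤ) (h : a * d - b * c = 1), g = psl a b c d h := by
  induction g using QuotientGroup.induction_on with | H M => ?_
  refine ⟨M.1 0 0, M.1 0 1, M.1 1 0, M.1 1 1, ?_, ?_⟩
  · rw [← Matrix.det_fin_two]; exact M.2
  · rw [psl]; congr 1; ext i j; fin_cases i <;> fin_cases j <;> rfl

lemma psl_mul {a b c d a' b' c' d' : ℤ} (h : a * d - b * c = 1) (h' : a' * d' - b' * c' = 1) :
    psl a b c d h * psl a' b' c' d' h' =
      psl (a * a' + b * c') (a * b' + b * d') (c * a' + d * c') (c * b' + d * d')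
        (by linear_combination h * (a' * d' - b' * c') + h') := by
  refine congrArg (QuotientGroup.mk : SL(2, ℤ) → PSL2Z)
    (?_ : slMat a b c d h * slMat a' b' c' d' h' = _)
  ext i j
  rw [Matrix.SpecialLinearGroup.coe_mul, slMat_val, slMat_val, slMat_val]
  fin_cases i <;> fin_cases j <;> simp [Matrix.mul_apply, Fin.sum_univ_two]

lemma psl_one : psl 1 0 0 1 (by norm_num) = 1 := by
  refine congrArg (QuotientGroup.mk : SL(2, ℤ) → PSL2Z) (?_ : slMat 1 0 0 1 _ = 1)
  ext i j
  fin_cases i <;> fin_cases j <;> rfl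

lemma psl_congr {a b c d a' b' c' d' : ℤ} {h : a * d - b * c = 1} {h' : a' * d' - b' * c' = 1}
    (ha : a = a') (hb : b = b') (hc : c = c') (hd : d = d') :
    psl a b c d h = psl a' b' c' d' h' := by subst ha hb hc hd; rfl

lemma psl_inv {a b c d : ℤ} (h : a * d - b * c = 1) :
    (psl a b c d h)⁻¹ = psl d (-b) (-c) a (by linarith) := by
  rw [inv_eq_iff_mul_eq_one, psl_mul, ← psl_one]
  apply psl_congr <;> linarith

lemma psl_neg {a b c d : ℤ} (h : a * d - b * c = 1) :
    psl a b c d h = psl (-a) (-b) (-c) (-d) (by linarith) := by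
  refine mk_eq_mk_iff_exists.mpr ⟨-1, by simp, fun i j => ?_⟩
  fin_cases i <;> fin_cases j <;> simp [slMat_val]

lemma psl_eq_psl {a b c d a' b' c' d' : ℤ} {h : a * d - b * c = 1} {h' : a' * d' - b' * c' = 1}
    (e : psl a b c d h = psl a' b' c' d' h') :
    (a = a' ∧ b = b' ∧ c = c' ∧ d = d') ∨ (a = -a' ∧ b = -b' ∧ c = -c' ∧ d = -d') := by
  obtain ⟨r, hr, e⟩ := mk_eq_mk_iff_exists.mp e
  have e00 := e 0 0
  have e01 := e 0 1
  have e10 := e 1 0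
  have e11 := e 1 1
  simp only [slMat_val, Matrix.of_apply, Matrix.cons_val', Matrix.cons_val_zero,
    Matrix.cons_val_one, Matrix.cons_val_fin_one] at e00 e01 e10 e11
  rcases hr with rfl | rfl
  · left; refine ⟨?_, ?_, ?_, ?_⟩ <;> linarith
  · right; refine ⟨?_, ?_, ?_, ?_⟩ <;> linarith

/-- In homogeneous coordinates `PSL(2, ℤ)` acts linearly on the ideal boundary. -/
lemma psl_smul_hpt {a b c d : ℤ} (h : a * d - b * c = 1) {u v : ℝ} (huv : u ≠ 0 ∨ v ≠ 0) :
    psl a b c d h • hpt u v = hpt (a * u + b * v) (c * u + d * v) := by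
  have key : ∀ x : OnePoint ℝ, psl a b c d h • x =
      (Matrix.SpecialLinearGroup.mapGL ℝ (slMat a b c d h) : GL (Fin 2) ℝ) • x := fun x => rfl
  rw [key]
  by_cases hv : v = 0
  · have hu : u ≠ 0 := by tauto
    rw [hv, hpt_zero, OnePoint.smul_infty_eq_ite]
    simp only [Matrix.SpecialLinearGroup.mapGL_coe_matrix, Matrix.SpecialLinearGroup.map_apply_coe,
      RingHom.mapMatrix_apply, Matrix.map_apply, slMat_val]
    by_cases hc : (c : ℝ) = 0
    · simp [hc, hpt_zero]
    · rw [mul_zero, mul_zero, add_zero, add_zero, hpt_of_ne (mul_ne_zero hc hu)]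
      simp [hc, mul_div_mul_right _ _ hu]
  · rw [hpt_of_ne hv, OnePoint.smul_some_eq_ite]
    simp only [Matrix.SpecialLinearGroup.mapGL_coe_matrix, Matrix.SpecialLinearGroup.map_apply_coe,
      RingHom.mapMatrix_apply, Matrix.map_apply, slMat_val]
    have e : (c : ℝ) * (u / v) + d = (c * u + d * v) / v := by field_simp
    have e' : (a : ℝ) * (u / v) + b = (a * u + b * v) / v := by field_simp
    by_cases hc : (c : ℝ) * u + d * v = 0
    · simp [e, hc, hpt_zero]
    · rw [hpt_of_ne hc]
      simp [e, e', hc, hv]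
      field_simp

lemma psl_coords_ne {a b c d : ℤ} (h : a * d - b * c = 1) {u v : ℝ} (huv : u ≠ 0 ∨ v ≠ 0) :
    (a * u + b * v : ℝ) ≠ 0 ∨ (c * u + d * v : ℝ) ≠ 0 := by
  by_contra! hh
  have h' : (a * d - b * c : ℝ) = 1 := by exact_mod_cast h
  have h1 : u = 0 := by linear_combination d * hh.1 - b * hh.2 - u * h'
  have h2 : v = 0 := by linear_combination a * hh.2 - c * hh.1 - v * h'
  tauto

lemma continuous_psl_smul (g : PSL2Z) : Continuous (fun x : OnePoint ℝ => g • x) := by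
  obtain ⟨a, b, c, d, h, rfl⟩ := exists_eq_psl g
  rw [continuous_iff_continuousAt]
  intro x
  induction x using OnePoint.rec with
  | infty =>
    rw [OnePoint.continuousAt_infty']
    have h1 : Tendsto (fun r : ℝ => hpt (a * 1 + b * r⁻¹) (c * 1 + d * r⁻¹)) (coclosedCompact ℝ)
        (𝓝 (hpt (a * 1 + b * 0) (c * 1 + d * 0))) := by
      have h0 : Tendsto (fun r : ℝ => r⁻¹) (coclosedCompact ℝ) (𝓝 0) := by
        rw [coclosedCompact_eq_cocompact, ← Metric.cobounded_eq_cocompact]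
        exact tendsto_inv₀_cobounded
      refine tendsto_hpt ?_ ?_ (psl_coords_ne h (by simp))
      · exact tendsto_const_nhds.add (tendsto_const_nhds.mul h0)
      · exact tendsto_const_nhds.add (tendsto_const_nhds.mul h0)
    have e0 : psl a b c d h • (OnePoint.infty : OnePoint ℝ) =
        hpt (a * 1 + b * 0) (c * 1 + d * 0) := by
      rw [← psl_smul_hpt h (by simp), hpt_zero]
    rw [e0]
    refine h1.congr' ?_
    have : ∀ᶠ r : ℝ in coclosedCompact ℝ, r ≠ 0 := by
      rw [coclosedCompact_eq_cocompact]
      exact (isCompact_singleton (x := (0 : ℝ))).compl_mem_cocompact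
    filter_upwards [this] with r hr
    rw [← psl_smul_hpt h (by simp), hpt_of_ne (inv_ne_zero hr)]
    simp
  | coe r =>
    rw [OnePoint.continuousAt_coe]
    have e : ((fun x : OnePoint ℝ => psl a b c d h • x) ∘ fun r : ℝ => (r : OnePoint ℝ)) =
        fun r : ℝ => hpt (a * r + b * 1) (c * r + d * 1) := by
      funext r
      rw [← psl_smul_hpt h (by simp), hpt_one]; rfl
    change ContinuousAt
      ((fun x : OnePoint ℝ => psl a b c d h • x) ∘ fun r : ℝ => (r : OnePoint ℝ)) r
    rw [e]
    refine tendsto_hpt ?_ ?_ (psl_coords_ne h (by simp))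
    · exact Continuous.tendsto (by fun_prop) r
    · exact Continuous.tendsto (by fun_prop) r

/-! ### Farey arcs -/

/-- The parabolic translation `x ↦ x + 1`. -/
def psT : PSL2Z := psl 1 1 0 1 (by norm_num)

/-- The parabolic element `x ↦ x / (x + 1)`. -/
def psL : PSL2Z := psl 1 0 1 1 (by norm_num)

lemma genA_eq : genA = psl (-1) 1 (-1) 0 (by norm_num) := rfl

lemma genD_eq : genD = psl 0 1 (-1) 0 (by norm_num) := rfl

lemma genA_mul_genD : genA * genD = psT := by
  rw [genA_eq, genD_eq, psl_mul, psl_neg]; rfl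

lemma genA_sq_mul_genD : genA ^ 2 * genD = psL := by
  rw [genA_eq, genD_eq, sq, psl_mul, psl_mul]; rfl

lemma genD_sq : genD * genD = 1 := by
  rw [genD_eq, psl_mul, psl_neg, ← psl_one]; rfl

lemma genA_cube : genA ^ 3 = 1 := by
  rw [pow_succ, sq, genA_eq, psl_mul, psl_mul, ← psl_one]; rfl

lemma genD_inv : genD⁻¹ = genD := inv_eq_of_mul_eq_one_left genD_sq

lemma psT_zpow (n : ℤ) : psT ^ n = psl 1 n 0 1 (by norm_num) := by
  induction n using Int.induction_on with
  | zero => rw [zpow_zero, ← psl_one]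
  | succ n ih => rw [zpow_add_one, ih, psT, psl_mul]; apply psl_congr <;> ring
  | pred n ih => rw [zpow_sub_one, ih, psT, psl_inv, psl_mul]; apply psl_congr <;> ring

lemma psT_pow (n : ℕ) : psT ^ n = psl 1 n 0 1 (by norm_num) := by
  rw [← zpow_natCast, psT_zpow]

/-- Conjugation by the involution exchanges the two parabolic generators. -/
lemma psT_inv_pow_mul_genD (n : ℕ) : (psT ^ n)⁻¹ * genD = genD * psL ^ n := by
  have h1 : psT⁻¹ * genD = genD * psL := by
    rw [psT, psL, genD_eq, psl_inv, psl_mul, psl_mul]; apply psl_congr <;> norm_num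
  induction n with
  | zero => simp
  | succ n ih => rw [pow_succ, mul_inv_rev, mul_assoc, ih, ← mul_assoc, h1, mul_assoc, pow_succ']

/-- The closed arc `[0, ∞]`. -/
def nonnegArc : Set (OnePoint ℝ) := insert OnePoint.infty ((↑) '' Set.Ici (0 : ℝ))

/-- The closed arc `[-∞, 0]`. -/
def nonposArc : Set (OnePoint ℝ) := insert OnePoint.infty ((↑) '' Set.Iic (0 : ℝ))

lemma infty_mem_nonnegArc : OnePoint.infty ∈ nonnegArc := Or.inl rfl

lemma coe_mem_nonnegArc {r : ℝ} : (r : OnePoint ℝ) ∈ nonnegArc ↔ 0 ≤ r := by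
  simp [nonnegArc]

lemma coe_mem_nonposArc {r : ℝ} : (r : OnePoint ℝ) ∈ nonposArc ↔ r ≤ 0 := by
  simp [nonposArc]

lemma hpt_mem_nonnegArc {u v : ℝ} : hpt u v ∈ nonnegArc ↔ 0 ≤ u * v := by
  by_cases hv : v = 0
  · simp [hv, hpt_zero, nonnegArc]
  · rw [hpt_of_ne hv, coe_mem_nonnegArc, ← mul_div_mul_right u v hv,
      le_div_iff₀ (mul_self_pos.mpr hv), zero_mul]

lemma hpt_mem_nonposArc {u v : ℝ} : hpt u v ∈ nonposArc ↔ u * v ≤ 0 := by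
  by_cases hv : v = 0
  · simp [hv, hpt_zero, nonposArc]
  · rw [hpt_of_ne hv, coe_mem_nonposArc, ← mul_div_mul_right u v hv,
      div_le_iff₀ (mul_self_pos.mpr hv), zero_mul]

lemma isClosed_nonnegArc : IsClosed nonnegArc := by
  rw [OnePoint.isClosed_iff_of_mem infty_mem_nonnegArc]
  convert isClosed_Ici (a := (0 : ℝ)) using 1
  ext r; simp [coe_mem_nonnegArc]

lemma genD_smul_hpt {u v : ℝ} (h : u ≠ 0 ∨ v ≠ 0) : genD • hpt u v = hpt v (-u) := by
  rw [genD_eq, psl_smul_hpt _ h]; simp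

lemma genD_smul_mem_nonnegArc {x : OnePoint ℝ} : genD • x ∈ nonnegArc ↔ x ∈ nonposArc := by
  obtain ⟨u, v, h, rfl⟩ := exists_eq_hpt x
  rw [genD_smul_hpt h, hpt_mem_nonnegArc, hpt_mem_nonposArc]
  constructor <;> intro h <;> linarith

lemma psl_smul_infty {a b c d : ℤ} (h : a * d - b * c = 1) :
    psl a b c d h • (OnePoint.infty : OnePoint ℝ) = hpt a c := by
  rw [← hpt_zero 1, psl_smul_hpt h (by simp)]; simp

lemma psl_smul_coe {a b c d : ℤ} (h : a * d - b * c = 1) (r : ℝ) :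
    psl a b c d h • (r : OnePoint ℝ) = hpt (a * r + b) (c * r + d) := by
  rw [← hpt_one r, psl_smul_hpt h (by simp)]; simp

lemma psT_pow_smul_coe (n : ℕ) (r : ℝ) :
    psT ^ n • (r : OnePoint ℝ) = ((r + n : ℝ) : OnePoint ℝ) := by
  rw [psT_pow, psl_smul_coe, ← hpt_one]; congr 1 <;> push_cast <;> ring

lemma psT_zpow_smul_coe (n : ℤ) (r : ℝ) :
    psT ^ n • (r : OnePoint ℝ) = ((r + n : ℝ) : OnePoint ℝ) := by
  rw [psT_zpow, psl_smul_coe, ← hpt_one]; congr 1 <;> push_cast <;> ring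

lemma psT_zpow_smul_infty (n : ℤ) : psT ^ n • (OnePoint.infty : OnePoint ℝ) = OnePoint.infty := by
  rw [psT_zpow, psl_smul_infty]; simp [hpt_zero]

/-- A matrix of determinant one with nonnegative entries is a product of the two parabolic
generators: unless it is trivial, one of its rows dominates the other, and subtracting the smaller
row splits off a generator. -/
lemma nonneg_psl_induction {p : PSL2Z → Prop} (h1 : p 1) (hT : ∀ g, p g → p (psT * g))
    (hL : ∀ g, p g → p (psL * g)) (a b c d : ℕ) (h : (a : ℤ) * d - b * c = 1) :
    p (psl a b c d h) := by
  induction hn : a + b + c + d using Nat.strong_induction_on generalizing a b c d with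
  | _ n ih => ?_
  by_cases h2 : c ≤ a ∧ d ≤ b
  · obtain ⟨a', rfl⟩ := Nat.exists_eq_add_of_le h2.1
    obtain ⟨b', rfl⟩ := Nat.exists_eq_add_of_le h2.2
    have h' : (a' : ℤ) * d - b' * c = 1 := by push_cast at h; linarith
    have hcd : 0 < c + d := by
      rcases Nat.eq_zero_or_pos (c + d) with h0 | h0
      · have : c = 0 ∧ d = 0 := by omega
        simp [this.1, this.2] at h'
      · exact h0
    have := hT _ (ih _ (by omega) a' b' c d h' rfl)
    convert this using 1
    rw [psT, psl_mul]; apply psl_congr <;> push_cast <;> ring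
  by_cases h3 : a ≤ c ∧ b ≤ d
  · obtain ⟨c', rfl⟩ := Nat.exists_eq_add_of_le h3.1
    obtain ⟨d', rfl⟩ := Nat.exists_eq_add_of_le h3.2
    have h' : (a : ℤ) * d' - b * c' = 1 := by push_cast at h; linarith
    have hab : 0 < a + b := by
      rcases Nat.eq_zero_or_pos (a + b) with h0 | h0
      · have : a = 0 ∧ b = 0 := by omega
        simp [this.1, this.2] at h'
      · exact h0
    have := hL _ (ih _ (by omega) a b c' d' h' rfl)
    convert this using 1
    rw [psL, psl_mul]; apply psl_congr <;> push_cast <;> ring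
  · have h4 : (c < a ∧ b < d) ∨ (a < c ∧ d < b) := by omega
    rcases h4 with ⟨h4, h5⟩ | ⟨h4, h5⟩
    · obtain ⟨a', rfl⟩ := Nat.exists_eq_add_of_lt h4
      obtain ⟨d', rfl⟩ := Nat.exists_eq_add_of_lt h5
      push_cast at h
      have e : (c : ℤ) * d' + c + a' * b + a' * d' + a' + b + d' = 0 := by linarith
      have z : a' = 0 ∧ b = 0 ∧ c = 0 ∧ d' = 0 := by
        have : 0 ≤ (c : ℤ) * d' := by positivity
        have : 0 ≤ (a' : ℤ) * d' := by positivity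
        have : 0 ≤ (a' : ℤ) * b := by positivity
        refine ⟨?_, ?_, ?_, ?_⟩ <;> · zify; linarith
      obtain ⟨rfl, rfl, rfl, rfl⟩ := z
      convert h1 using 1
      rw [← psl_one]; apply psl_congr <;> norm_num
    · exfalso
      have h4' : (a : ℤ) + 1 ≤ c := by exact_mod_cast h4
      have h5' : (d : ℤ) + 1 ≤ b := by exact_mod_cast h5
      nlinarith [mul_le_mul h5' h4' (by positivity) (by positivity)]

/-- If `g` maps the arc `[0, ∞]` into itself, then it is a product of the two parabolic
generators. -/
lemma nonnegArc_induction {p : PSL2Z → Prop} (h1 : p 1) (hT : ∀ g, p g → p (psT * g))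
    (hL : ∀ g, p g → p (psL * g)) (g : PSL2Z) (hg : ∀ x ∈ nonnegArc, g • x ∈ nonnegArc) : p g := by
  obtain ⟨a, b, c, d, h, rfl⟩ := exists_eq_psl g
  have key : ∀ u v : ℤ, 0 ≤ u → 0 ≤ v → (u ≠ 0 ∨ v ≠ 0) →
      0 ≤ (a * u + b * v) * (c * u + d * v) := by
    intro u v hu hv huv
    have h0 : 0 ≤ u * v := mul_nonneg hu hv
    have h' := hg (hpt u v) (hpt_mem_nonnegArc.mpr (by exact_mod_cast h0))
    rw [psl_smul_hpt h (by exact_mod_cast huv), hpt_mem_nonnegArc] at h'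
    exact_mod_cast h'
  have k1 := key 1 0 (by simp) (by simp) (by simp)
  have k2 := key 0 1 (by simp) (by simp) (by simp)
  simp only [mul_one, mul_zero, add_zero, zero_add] at k1 k2
  have main : ∀ (a b c d : ℤ) (h : a * d - b * c = 1), 0 ≤ a → 0 ≤ c → 0 ≤ b * d →
      (∀ u v : ℤ, 0 ≤ u → 0 ≤ v → (u ≠ 0 ∨ v ≠ 0) → 0 ≤ (a * u + b * v) * (c * u + d * v)) →
      p (psl a b c d h) := by
    intro a b c d h ha hc hbd key
    have hbd' : 0 ≤ b ∧ 0 ≤ d := by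
      rcases mul_nonneg_iff.mp hbd with hbd | hbd
      · exact hbd
      · exfalso
        have hne : -(b + d) ≠ 0 ∨ a + c ≠ 0 := by
          by_contra! hh
          have : a = 0 := by linarith
          have : c = 0 := by linarith
          subst a c; simp at h
        -- the mediant of the two zeros is a point of the arc that leaves it
        have := key (-(b + d)) (a + c) (by linarith) (by linarith) hne
        have e : (a * -(b + d) + b * (a + c)) * (c * -(b + d) + d * (a + c)) = -1 := by
          linear_combination (-(a * d - b * c) - 1) * h
        rw [e] at this; norm_num at this
    lift a to ℕ using ha
    lift b to ℕ using hbd'.1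
    lift c to ℕ using hc
    lift d to ℕ using hbd'.2
    exact nonneg_psl_induction h1 hT hL a b c d h
  rcases mul_nonneg_iff.mp k1 with hac | hac
  · exact main a b c d h hac.1 hac.2 k2 key
  · rw [psl_neg]
    refine main _ _ _ _ _ (by linarith) (by linarith) (by linarith) fun u v hu hv huv => ?_
    have := key u v hu hv huv
    linarith

/-- A Farey arc that avoids `0` lies on one side of it. -/
lemma smul_nonnegArc_subset_or {g : PSL2Z}
    (hg : ∀ x ∈ nonnegArc, g • x ≠ ((0 : ℝ) : OnePoint ℝ)) :
    (∀ x ∈ nonnegArc, g • x ∈ nonnegArc) ∨ (∀ x ∈ nonnegArc, g • x ∈ nonposArc) := by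
  obtain ⟨a, b, c, d, h, rfl⟩ := exists_eq_psl g
  have main : ∀ (a b c d : ℤ) (h : a * d - b * c = 1), 0 < a →
      (∀ x ∈ nonnegArc, psl a b c d h • x ≠ ((0 : ℝ) : OnePoint ℝ)) →
      (∀ x ∈ nonnegArc, psl a b c d h • x ∈ nonnegArc) ∨
        (∀ x ∈ nonnegArc, psl a b c d h • x ∈ nonposArc) := by
    intro a b c d h ha hg
    have ha' : (0 : ℝ) < a := by exact_mod_cast ha
    have hb : 0 < b := by
      by_contra! hb
      have hb' : (b : ℝ) ≤ 0 := by exact_mod_cast hb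
      apply hg ((-b / a : ℝ) : OnePoint ℝ) (coe_mem_nonnegArc.mpr (div_nonneg (by linarith) ha'.le))
      rw [psl_smul_coe, ← hpt_one]
      have hne := psl_coords_ne h (u := -b / a) (v := 1) (by simp)
      rw [mul_one, mul_one] at hne
      rw [hpt_eq_hpt_iff hne (by simp)]
      field_simp; ring
    have hb' : (0 : ℝ) < b := by exact_mod_cast hb
    have hcd : (0 ≤ c ∧ 0 ≤ d) ∨ (c ≤ 0 ∧ d ≤ 0) := by
      by_contra! hh
      rcases lt_trichotomy c 0 with hc | hc | hc
      · have hd : 1 ≤ d := by have := hh.2 hc.le; omega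
        nlinarith [mul_pos ha (by omega : 0 < d), mul_pos hb (by omega : 0 < -c)]
      · subst hc
        have := hh.1 le_rfl
        have := hh.2 le_rfl
        omega
      · have hd : d ≤ -1 := by have := hh.1 hc.le; omega
        nlinarith [mul_pos ha (by omega : 0 < -d), mul_pos hb hc]
    refine hcd.imp (fun hcd x hx => ?_) (fun hcd x hx => ?_)
    · have hc : (0 : ℝ) ≤ c := by exact_mod_cast hcd.1
      have hd : (0 : ℝ) ≤ d := by exact_mod_cast hcd.2
      induction x using OnePoint.rec with
      | infty => rw [psl_smul_infty, hpt_mem_nonnegArc]; positivity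
      | coe r =>
        rw [coe_mem_nonnegArc] at hx
        rw [psl_smul_coe, hpt_mem_nonnegArc]; positivity
    · have hc : (c : ℝ) ≤ 0 := by exact_mod_cast hcd.1
      have hd : (d : ℝ) ≤ 0 := by exact_mod_cast hcd.2
      induction x using OnePoint.rec with
      | infty =>
        rw [psl_smul_infty, hpt_mem_nonposArc]
        exact mul_nonpos_of_nonneg_of_nonpos ha'.le hc
      | coe r =>
        rw [coe_mem_nonnegArc] at hx
        rw [psl_smul_coe, hpt_mem_nonposArc]
        refine mul_nonpos_of_nonneg_of_nonpos (by positivity) ?_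
        nlinarith [mul_nonneg hx (by linarith : (0 : ℝ) ≤ -c)]
  rcases lt_trichotomy a 0 with ha | ha | ha
  · rw [psl_neg] at hg ⊢
    exact main _ _ _ _ _ (by linarith) hg
  · exfalso
    subst ha
    apply hg _ infty_mem_nonnegArc
    have hc : (c : ℝ) ≠ 0 := by rintro hc; have : c = 0 := by exact_mod_cast hc
                                subst this; simp at h
    rw [psl_smul_infty, hpt_of_ne hc]; simp
  · exact main a b c d h ha hg

/-! ### Rational ideal points -/

lemma eq_psT_zpow_of_smul_infty {g : PSL2Z}
    (hg : g • (OnePoint.infty : OnePoint ℝ) = OnePoint.infty) :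
    ∃ n : ℤ, g = psT ^ n := by
  obtain ⟨a, b, c, d, h, rfl⟩ := exists_eq_psl g
  have hc : c = 0 := by
    by_contra hc
    have hc' : (c : ℝ) ≠ 0 := by exact_mod_cast hc
    rw [psl_smul_infty, hpt_of_ne hc'] at hg
    exact OnePoint.coe_ne_infty _ hg
  subst hc
  have had : a * d = 1 := by linarith
  rcases Int.eq_one_or_neg_one_of_mul_eq_one had with rfl | rfl
  · exact ⟨b, by rw [psT_zpow]; apply psl_congr <;> linarith⟩
  · exact ⟨-b, by rw [psT_zpow, psl_neg]; apply psl_congr <;> linarith⟩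

lemma exists_psl_smul_infty_eq_hpt (a c : ℤ) (h : IsCoprime a c) :
    ∃ g : PSL2Z, g • (OnePoint.infty : OnePoint ℝ) = hpt a c := by
  obtain ⟨u, v, huv⟩ := h
  exact ⟨psl a (-v) c u (by linarith), psl_smul_infty _⟩

lemma exists_smul_infty_eq_ratCast (q : ℚ) :
    ∃ g : PSL2Z, g • (OnePoint.infty : OnePoint ℝ) = ((q : ℝ) : OnePoint ℝ) := by
  obtain ⟨g, hg⟩ := exists_psl_smul_infty_eq_hpt q.num q.den
    (Int.isCoprime_iff_gcd_eq_one.mpr (by simpa [Int.gcd] using q.reduced))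
  refine ⟨g, ?_⟩
  rw [hg, hpt_of_ne (by exact_mod_cast q.den_nz)]
  congr 1
  exact_mod_cast (Rat.cast_def (K := ℝ) q).symm

/-- The rational ideal points form the orbit of `∞`. -/
lemma notMem_orbit_infty_iff {x : OnePoint ℝ} :
    (¬ ∃ g : PSL2Z, g • (OnePoint.infty : OnePoint ℝ) = x) ↔ ∃ r : ℝ, Irrational r ∧ x = r := by
  constructor
  · intro h
    induction x using OnePoint.rec with
    | infty => exact absurd ⟨1, one_smul _ _⟩ h
    | coe r =>
      refine ⟨r, ?_, rfl⟩
      rintro ⟨q, rfl⟩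
      exact h (exists_smul_infty_eq_ratCast q)
  · rintro ⟨r, hr, rfl⟩ ⟨g, hg⟩
    obtain ⟨a, b, c, d, h, rfl⟩ := exists_eq_psl g
    rw [psl_smul_infty] at hg
    by_cases hc : (c : ℝ) = 0
    · rw [hc, hpt_zero] at hg
      exact OnePoint.infty_ne_coe _ hg
    · rw [hpt_of_ne hc, OnePoint.coe_eq_coe] at hg
      exact hr ⟨(a : ℚ) / c, by rw [← hg]; push_cast; rfl⟩

/-- The action preserves irrational ideal points. -/
lemma exists_irrational_smul (g : PSL2Z) {r : ℝ} (hr : Irrational r) :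
    ∃ r' : ℝ, Irrational r' ∧ g • (r : OnePoint ℝ) = r' := by
  rw [← notMem_orbit_infty_iff]
  rintro ⟨k, hk⟩
  exact notMem_orbit_infty_iff.mpr ⟨r, hr, rfl⟩ ⟨g⁻¹ * k, by rw [mul_smul, hk, inv_smul_smul]⟩

lemma rational_or_irrational (x : OnePoint ℝ) :
    (∃ g : PSL2Z, g • (OnePoint.infty : OnePoint ℝ) = x) ∨ ∃ r : ℝ, Irrational r ∧ x = r := by
  rw [← notMem_orbit_infty_iff]; exact em _

/-! ### Farey expansions of irrational points -/

/-- The parabolic generator named by a letter: `psT` for `true` and `psL` for `false`. -/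
def letter (e : Bool) : PSL2Z := if e then psT else psL

/-- The prefixes of an infinite word in the two parabolic generators. -/
def wordProd (ε : ℕ → Bool) : ℕ → PSL2Z
  | 0 => 1
  | n + 1 => wordProd ε n * letter (ε n)

/-- One step of the Farey expansion of a positive real number: the inverse of the parabolic
generator whose image of the arc `[0, ∞]` contains the number. -/
def fareyStep (r : ℝ) : ℝ := if 1 < r then r - 1 else r / (1 - r)

lemma fareyStep_pos_irrational {r : ℝ} (h : 0 < r ∧ Irrational r) :
    0 < fareyStep r ∧ Irrational (fareyStep r) ∧
      letter (decide (1 < r)) • (fareyStep r : OnePoint ℝ) = (r : OnePoint ℝ) := by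
  obtain ⟨h0, hr⟩ := h
  by_cases h1 : 1 < r
  · have e : fareyStep r = r - 1 := if_pos h1
    refine ⟨by rw [e]; linarith, by rw [e]; exact_mod_cast hr.sub_intCast 1, ?_⟩
    rw [e, decide_eq_true h1, letter, if_pos rfl, psT, psl_smul_coe, ← hpt_one]
    congr 1 <;> push_cast <;> ring
  · have e : fareyStep r = r / (1 - r) := if_neg h1
    have h2 : r < 1 := lt_of_le_of_ne (not_lt.mp h1) hr.ne_one
    have h3 : (0 : ℝ) < 1 - r := by linarith
    have e' : letter (decide (1 < r)) • ((r / (1 - r) : ℝ) : OnePoint ℝ) = (r : OnePoint ℝ) := by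
      rw [decide_eq_false h1, letter, if_neg (by simp), psL, psl_smul_coe, ← hpt_one]
      have hne : (1 : ℤ) * (r / (1 - r)) + (1 : ℤ) ≠ 0 := by
        push_cast; have : 0 < r / (1 - r) := by positivity
        linarith
      rw [hpt_eq_hpt_iff (Or.inr hne) (by simp)]
      push_cast; field_simp; ring
    rw [e]
    refine ⟨by positivity, ?_, e'⟩
    obtain ⟨r', hr', e''⟩ := exists_irrational_smul (letter (decide (1 < r)))⁻¹ hr
    rw [← e', inv_smul_smul, OnePoint.coe_eq_coe] at e''
    rwa [e'']

/-- The Farey expansion of a positive irrational number: it lies in the interior of a nested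
sequence of Farey arcs, obtained by infinitely often changing the generator. -/
lemma exists_farey_expansion {r : ℝ} (h0 : 0 < r) (hr : Irrational r) :
    ∃ ε : ℕ → Bool, (∀ N, ∃ n, N ≤ n ∧ ε n ≠ ε (n + 1)) ∧
      ∀ n, ∃ s : ℝ, 0 < s ∧ Irrational s ∧ wordProd ε n • (s : OnePoint ℝ) = r := by
  let R : ℕ → ℝ := fun n => fareyStep^[n] r
  have hsucc : ∀ n, R (n + 1) = fareyStep (R n) := fun n => Function.iterate_succ_apply' _ _ _
  have hR : ∀ n, 0 < R n ∧ Irrational (R n) := by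
    intro n
    induction n with
    | zero => exact ⟨h0, hr⟩
    | succ n ih =>
      rw [hsucc]
      exact ⟨(fareyStep_pos_irrational ih).1, (fareyStep_pos_irrational ih).2.1⟩
  let ε : ℕ → Bool := fun n => decide (1 < R n)
  have hw : ∀ n, wordProd ε n • (R n : OnePoint ℝ) = r := by
    intro n
    induction n with
    | zero => exact one_smul _ _
    | succ n ih =>
      rw [wordProd, mul_smul, hsucc]
      change wordProd ε n • letter (decide (1 < R n)) • _ = _
      rw [(fareyStep_pos_irrational (hR n)).2.2, ih]
  refine ⟨ε, fun N => ?_, fun n => ⟨R n, (hR n).1, (hR n).2, hw n⟩⟩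
  -- otherwise the expansion is eventually constant, and `R` decreases by a constant step, directly
  -- or after inversion, without ever becoming negative
  by_contra! hN
  have hconst : ∀ k, ε (N + k) = ε N := by
    intro k
    induction k with
    | zero => rfl
    | succ k ih => rw [← add_assoc, ← hN (N + k) (by omega), ih]
  cases he : ε N with
  | true =>
    have h1 : ∀ k : ℕ, R (N + k) = R N - k := by
      intro k
      induction k with
      | zero => simp
      | succ k ih =>
        have : 1 < R (N + k) := by
          have := hconst k
          rw [he] at this
          exact of_decide_eq_true this
        rw [← add_assoc, hsucc, fareyStep, if_pos this, ih]; push_cast; ring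
    obtain ⟨k, hk⟩ := exists_nat_gt (R N)
    have := (hR (N + k)).1
    rw [h1] at this
    linarith
  | false =>
    have h1 : ∀ k : ℕ, (R (N + k))⁻¹ = (R N)⁻¹ - k := by
      intro k
      induction k with
      | zero => simp
      | succ k ih =>
        have hlt : ¬ 1 < R (N + k) := by
          have := hconst k
          rw [he] at this
          exact of_decide_eq_false this
        have hpos := (hR (N + k)).1
        rw [← add_assoc, hsucc, fareyStep, if_neg hlt, inv_div, sub_div, div_self hpos.ne',
          one_div, ih]
        push_cast; ring
    obtain ⟨k, hk⟩ := exists_nat_gt (R N)⁻¹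
    have := inv_pos.mpr (hR (N + k)).1
    rw [h1] at this
    linarith

/-- Two distinct irrational numbers are separated by a Farey edge: the rational number of least
denominator between them is joined by such an edge to a point outside the interval. -/
lemma exists_separating_of_lt {x y : ℝ} (hx : Irrational x) (hxy : x < y) :
    ∃ (g : PSL2Z) (s s' : ℝ), 0 < s ∧ s' < 0 ∧
      g • (s : OnePoint ℝ) = x ∧ g • (s' : OnePoint ℝ) = y := by
  have hex : ∃ q : ℕ, 0 < q ∧ ∃ p : ℤ, x * q < p ∧ p < y * q := by
    obtain ⟨t, h1, h2⟩ := exists_rat_btwn hxy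
    have hd : (0 : ℝ) < t.den := by exact_mod_cast t.den_pos
    refine ⟨t.den, t.den_pos, t.num, ?_, ?_⟩
    · rw [← lt_div_iff₀ hd]; rwa [Rat.cast_def] at h1
    · rw [← div_lt_iff₀ hd]; rwa [Rat.cast_def] at h2
  classical
  obtain ⟨hq0, p, hp1, hp2⟩ := Nat.find_spec hex
  set q := Nat.find hex with hq
  have hmin : ∀ m : ℕ, m < q → 0 < m → ∀ p' : ℤ, ¬ (x * m < p' ∧ p' < y * m) := by
    intro m hm hm0 p' hp'
    exact Nat.find_min hex hm ⟨hm0, p', hp'⟩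
  have hcop : IsCoprime p (q : ℤ) := by
    rw [Int.isCoprime_iff_gcd_eq_one]
    by_contra hg
    set e := Int.gcd p q with he
    have hepos : 0 < e := Int.gcd_pos_of_ne_zero_right _ (by exact_mod_cast hq0.ne')
    obtain ⟨p', hp'⟩ : (e : ℤ) ∣ p := Int.gcd_dvd_left _ _
    obtain ⟨q', hq'⟩ : e ∣ q := by exact_mod_cast Int.gcd_dvd_right p (q : ℤ)
    have hq'0 : 0 < q' := Nat.pos_of_ne_zero (by rintro rfl; simp at hq'; omega)
    have h2e : 2 ≤ e := by omega
    have hlt : q' < q := by rw [hq']; nlinarith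
    have hee : (0 : ℝ) < e := by exact_mod_cast hepos
    refine hmin q' hlt hq'0 p' ⟨?_, ?_⟩
    · have : x * (e * q') < e * p' := by
        have := hp1; rw [hq', hp'] at this; push_cast at this; linarith
      nlinarith
    · have : e * p' < y * (e * q') := by
        have := hp2; rw [hq', hp'] at this; push_cast at this; linarith
      nlinarith
  -- the Farey parent `p' / q'` of `p / q`
  obtain ⟨p', q', hdet, hq'0, hq'q⟩ : ∃ p' q' : ℤ, p * q' - p' * q = 1 ∧ 0 ≤ q' ∧ q' < q := by
    obtain ⟨u, v, huv⟩ := hcop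
    have hqz : (0 : ℤ) < q := by exact_mod_cast hq0
    refine ⟨-(v + p * (u / q)), u % q, ?_, Int.emod_nonneg _ hqz.ne', Int.emod_lt_of_pos _ hqz⟩
    have := Int.emod_add_mul_ediv u q
    linear_combination huv + p * this
  have hdetR : (p * q' - p' * q : ℝ) = 1 := by exact_mod_cast hdet
  have hqR : (0 : ℝ) < q := by exact_mod_cast hq0
  have hq'R : (0 : ℝ) ≤ q' := by exact_mod_cast hq'0
  -- the parent lies to the left of `x`: otherwise it is a fraction between `x` and `y` with a
  -- denominator smaller than `q`
  have hxp' : 0 < x * q' - p' := by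
    by_contra! hneg
    rcases hq'0.eq_or_lt with h0 | h0
    · have e1 : -(p' : ℤ) * q = 1 := by rw [← h0] at hdet; linarith
      have : p' < 0 := by nlinarith
      have : (p' : ℝ) < 0 := by exact_mod_cast this
      rw [← h0] at hneg; push_cast at hneg; linarith
    · have h0R : (0 : ℝ) < q' := by exact_mod_cast h0
      have hne : x * q' ≠ p' := by
        intro e
        exact hx ⟨(p' : ℚ) / q', by push_cast; rw [← e]; field_simp⟩
      have hlt : x * q' < p' := lt_of_le_of_ne (by linarith) hne
      lift q' to ℕ using hq'0
      refine hmin q' (by exact_mod_cast hq'q) (by exact_mod_cast h0) p' ⟨by exact_mod_cast hlt, ?_⟩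
      push_cast at *
      have h3 : p * (q' : ℝ) < y * q * q' := by nlinarith
      have h4 : (p' : ℝ) * q < y * q' * q := by linarith
      exact lt_of_mul_lt_mul_right h4 hqR.le
  have hyp' : 0 < y * q' - p' := by nlinarith
  have hx1 : 0 < p - x * q := by linarith
  have hy1 : p - y * q < 0 := by linarith
  have hsol : ∀ z : ℝ, p - z * q ≠ 0 →
      psl p p' q q' hdet • (((z * q' - p') / (p - z * q) : ℝ) : OnePoint ℝ) = (z : OnePoint ℝ) := by
    intro z hz
    have hne := psl_coords_ne hdet (u := (z * q' - p') / (p - z * q)) (v := 1) (by simp)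
    rw [mul_one, mul_one] at hne
    rw [psl_smul_coe, ← hpt_one z, hpt_eq_hpt_iff hne (by simp)]
    push_cast
    field_simp
    ring
  exact ⟨psl p p' q q' hdet, _, _, div_pos hxp' hx1, div_neg_of_pos_of_neg hyp' hy1,
    hsol x hx1.ne', hsol y hy1.ne⟩

lemma exists_separating {x y : ℝ} (hx : Irrational x) (hy : Irrational y) (hxy : x ≠ y) :
    ∃ (g : PSL2Z) (s s' : ℝ), 0 < s ∧ s' < 0 ∧
      g • (s : OnePoint ℝ) = x ∧ g • (s' : OnePoint ℝ) = y := by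
  rcases lt_or_gt_of_ne hxy with h | h
  · exact exists_separating_of_lt hx h
  · obtain ⟨g, s, s', hs, hs', e, e'⟩ := exists_separating_of_lt hy h
    refine ⟨g * genD, -s'⁻¹, -s⁻¹, by simpa using hs', by simpa using hs, ?_, ?_⟩
    · rw [mul_smul, ← hpt_one, genD_smul_hpt (by simp), ← e', neg_neg,
        hpt_of_ne (inv_ne_zero hs'.ne)]
      simp
    · rw [mul_smul, ← hpt_one, genD_smul_hpt (by simp), ← e, neg_neg,
        hpt_of_ne (inv_ne_zero hs.ne')]
      simp

/-! ### Generators and the universal property -/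

lemma closure_genA_genD : Subgroup.closure {genA, genD} = ⊤ := by
  have hA : genA ∈ Subgroup.closure {genA, genD} := Subgroup.subset_closure (by simp)
  have hD : genD ∈ Subgroup.closure {genA, genD} := Subgroup.subset_closure (by simp)
  let π : SL(2, ℤ) →* PSL2Z := QuotientGroup.mk' _
  have hπ : Function.Surjective π := QuotientGroup.mk'_surjective _
  have hS : π ModularGroup.S = genD := by
    have : π ModularGroup.S = psl 0 (-1) 1 0 (by norm_num) := rfl
    rw [this, psl_neg]; rfl
  have hT : π ModularGroup.T = genA * genD := by rw [genA_mul_genD]; rfl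
  have : (⊤ : Subgroup SL(2, ℤ)) ≤ (Subgroup.closure {genA, genD}).comap π := by
    rw [← SpecialLinearGroup.SL2Z_generators, Subgroup.closure_le]
    rintro x (rfl | rfl)
    · change π ModularGroup.S ∈ Subgroup.closure {genA, genD}; rw [hS]; exact hD
    · change π ModularGroup.T ∈ Subgroup.closure {genA, genD}; rw [hT]; exact mul_mem hA hD
  rw [eq_top_iff]
  intro g _
  obtain ⟨M, rfl⟩ := hπ g
  exact this (Subgroup.mem_top M)

lemma psl2z_induction {p : PSL2Z → Prop} (h1 : p 1) (hA : ∀ g, p g → p (genA * g))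
    (hD : ∀ g, p g → p (genD * g)) (g : PSL2Z) : p g := by
  have hg : g ∈ Subgroup.closure {genA, genD} := by rw [closure_genA_genD]; trivial
  induction hg using Subgroup.closure_induction_left with
  | one => exact h1
  | mul_left x hx y _ ih =>
    rcases hx with rfl | rfl
    · exact hA _ ih
    · exact hD _ ih
  | inv_mul_cancel x hx y _ ih =>
    rcases hx with rfl | rfl
    · rw [show genA⁻¹ = genA * genA by
        rw [inv_eq_iff_mul_eq_one, ← sq, ← pow_succ', genA_cube], mul_assoc]
      exact hA _ (hA _ ih)
    · rw [genD_inv]; exact hD _ ih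

instance : Group.FG PSL2Z :=
  Group.fg_iff.mpr ⟨{genA, genD}, closure_genA_genD, by simp⟩

/-- The cyclic factors of the modular group: order three for `true`, order two for `false`. -/
abbrev Factor (i : Bool) : Type := Multiplicative (ZMod (cond i 3 2))

/-- The homomorphism from a cyclic group of order `n` determined by an element with `g ^ n = 1`. -/
def cyclicHom {G : Type*} [Group G] (n : ℕ) (g : G) (h : g ^ n = 1) :
    Multiplicative (ZMod n) →* G :=
  AddMonoidHom.toMultiplicativeLeft
    (ZMod.lift n ⟨(zmultiplesHom (Additive G)) (Additive.ofMul g), by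
      rw [zmultiplesHom_apply, natCast_zsmul, ← ofMul_pow, h]; rfl⟩)

lemma cyclicHom_natCast {G : Type*} [Group G] (n : ℕ) (g : G) (h : g ^ n = 1) (k : ℕ) :
    cyclicHom n g h (Multiplicative.ofAdd (k : ZMod n)) = g ^ k := by
  have := ZMod.lift_coe n ⟨(zmultiplesHom (Additive G)) (Additive.ofMul g), by
      rw [zmultiplesHom_apply, natCast_zsmul, ← ofMul_pow, h]; rfl⟩ (k : ℤ)
  rw [Int.cast_natCast] at this
  change Additive.toMul _ = _
  erw [this]
  rw [zmultiplesHom_apply, natCast_zsmul]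
  rfl

lemma cyclicHom_surj {n : ℕ} [NeZero n] {p : Multiplicative (ZMod n) → Prop}
    (hp : ∀ k : ℕ, k < n → p (Multiplicative.ofAdd (k : ZMod n))) (x : Multiplicative (ZMod n)) :
    p x := by
  have := hp (Multiplicative.toAdd x).val (ZMod.val_lt _)
  rwa [ZMod.natCast_zmod_val] at this

/-- The two cyclic factors inside the modular group. -/
def factorHom : ∀ i, Factor i →* PSL2Z
  | true => cyclicHom 3 genA genA_cube
  | false => cyclicHom 2 genD (by rw [sq, genD_sq])

lemma factorHom_true (k : ℕ) :
    factorHom true (Multiplicative.ofAdd (k : ZMod 3)) = genA ^ k :=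
  cyclicHom_natCast 3 genA genA_cube k

lemma factorHom_false (k : ℕ) :
    factorHom false (Multiplicative.ofAdd (k : ZMod 2)) = genD ^ k :=
  cyclicHom_natCast 2 genD (by rw [sq, genD_sq]) k

/-- The modular group is the free product of its two cyclic factors: they play ping-pong on the
positive and negative half-lines. -/
lemma lift_factorHom_bijective : Function.Bijective (Monoid.CoprodI.lift factorHom) := by
  constructor
  · let X : Bool → Set (OnePoint ℝ) := fun i =>
      cond i ((↑) '' Set.Ioi (0 : ℝ)) ((↑) '' Set.Iio (0 : ℝ))
    refine Monoid.CoprodI.lift_injective_of_ping_pong factorHom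
      (Or.inr ⟨true, by change (3 : Cardinal) ≤ Cardinal.mk (ZMod 3); simp⟩) X ?_ ?_ ?_
    · rintro (_ | _)
      · exact ⟨_, -1, by simp, rfl⟩
      · exact ⟨_, 1, by simp, rfl⟩
    · have h : Disjoint ((↑) '' Set.Ioi (0 : ℝ) : Set (OnePoint ℝ)) ((↑) '' Set.Iio (0 : ℝ)) := by
        rw [Set.disjoint_image_iff OnePoint.coe_injective]
        exact Set.disjoint_left.mpr fun x (hx : 0 < x) (hx' : x < 0) => lt_asymm hx hx'
      rintro (_ | _) (_ | _) hij
      · exact absurd rfl hij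
      · exact h.symm
      · exact h
      · exact absurd rfl hij
    · rintro (_ | _) (_ | _) hij
      · exact absurd rfl hij
      · refine cyclicHom_surj (n := 2) fun k hk hne => ?_
        have hk' := factorHom_false k
        rw [hk']
        interval_cases k
        · exact absurd rfl hne
        · rintro _ ⟨_, ⟨r, hr, rfl⟩, rfl⟩
          have hr' : (0 : ℝ) < r := hr
          refine ⟨-r⁻¹, by simpa using hr', ?_⟩
          change _ = genD ^ 1 • (r : OnePoint ℝ)
          rw [pow_one, ← hpt_one r, genD_smul_hpt (by simp), hpt_of_ne (by linarith)]
          congr 1; field_simp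
      · refine cyclicHom_surj (n := 3) fun k hk hne => ?_
        have hk' := factorHom_true k
        rw [hk']
        interval_cases k
        · exact absurd rfl hne
        · rintro _ ⟨_, ⟨r, hr, rfl⟩, rfl⟩
          have hr' : r < (0 : ℝ) := hr
          refine ⟨1 + (-r)⁻¹, by have : 0 < (-r)⁻¹ := inv_pos.mpr (by linarith)
                                 exact add_pos one_pos this, ?_⟩
          change _ = genA ^ 1 • (r : OnePoint ℝ)
          rw [pow_one, genA_eq, psl_smul_coe, hpt_of_ne (ne_of_gt (by push_cast; linarith))]
          have hr0 := hr'.ne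
          congr 1
          rw [inv_neg, eq_div_iff (ne_of_gt (by push_cast; linarith))]
          push_cast; field_simp; ring
        · rintro _ ⟨_, ⟨r, hr, rfl⟩, rfl⟩
          have hr' : r < (0 : ℝ) := hr
          have h1r : (0 : ℝ) < 1 - r := by linarith
          refine ⟨(1 - r)⁻¹, inv_pos.mpr h1r, ?_⟩
          change _ = genA ^ 2 • (r : OnePoint ℝ)
          have hden : ((-1 * -1 + 0 * -1 : ℤ) : ℝ) * r + ((-1 * 1 + 0 * 0 : ℤ) : ℝ) < 0 := by
            norm_num; linarith
          rw [sq, genA_eq, psl_mul, psl_smul_coe, hpt_of_ne hden.ne]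
          have hr1 : 1 - r ≠ 0 := by linarith
          have hr2 : r - 1 ≠ 0 := by linarith
          congr 1
          rw [eq_div_iff hden.ne]
          norm_num; field_simp; ring
      · exact absurd rfl hij
  · rw [← MonoidHom.range_eq_top, eq_top_iff, ← closure_genA_genD, Subgroup.closure_le]
    rintro x (rfl | rfl)
    · refine ⟨Monoid.CoprodI.of (i := true) (Multiplicative.ofAdd ((1 : ℕ) : ZMod 3)), ?_⟩
      rw [Monoid.CoprodI.lift_of]
      exact (factorHom_true 1).trans (pow_one _)
    · refine ⟨Monoid.CoprodI.of (i := false) (Multiplicative.ofAdd ((1 : ℕ) : ZMod 2)), ?_⟩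
      rw [Monoid.CoprodI.lift_of]
      exact (factorHom_false 1).trans (pow_one _)

/-- The universal property of the presentation `⟨a, d : a³ = d² = 1⟩` of the modular group. -/
lemma exists_hom_of_relations {G : Type} [Group G] (x y : G) (hx : x ^ 3 = 1) (hy : y ^ 2 = 1) :
    ∃ ρ : PSL2Z →* G, ρ genA = x ∧ ρ genD = y := by
  let e := MulEquiv.ofBijective _ lift_factorHom_bijective
  let f : ∀ i, Factor i →* G
    | true => cyclicHom 3 x hx
    | false => cyclicHom 2 y hy
  have heA : e (Monoid.CoprodI.of (i := true) (Multiplicative.ofAdd ((1 : ℕ) : ZMod 3))) = genA :=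
    (Monoid.CoprodI.lift_of _ _).trans ((factorHom_true 1).trans (pow_one _))
  have heD : e (Monoid.CoprodI.of (i := false) (Multiplicative.ofAdd ((1 : ℕ) : ZMod 2))) = genD :=
    (Monoid.CoprodI.lift_of _ _).trans ((factorHom_false 1).trans (pow_one _))
  refine ⟨(Monoid.CoprodI.lift f).comp e.symm.toMonoidHom, ?_, ?_⟩
  · change Monoid.CoprodI.lift f (e.symm genA) = x
    rw [← heA, e.symm_apply_apply, Monoid.CoprodI.lift_of]
    exact (cyclicHom_natCast 3 x hx 1).trans (pow_one _)
  · change Monoid.CoprodI.lift f (e.symm genD) = y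
    rw [← heD, e.symm_apply_apply, Monoid.CoprodI.lift_of]
    exact (cyclicHom_natCast 2 y hy 1).trans (pow_one _)

/-! ### Convergence dynamics on the ideal boundary -/

/-- Two-by-two matrices written as quadruples of entries, row by row, acting on vectors. -/
def quadAct (m : Fin 4 → ℝ) (w : ℝ × ℝ) : ℝ × ℝ := (m 0 * w.1 + m 1 * w.2, m 2 * w.1 + m 3 * w.2)

lemma exists_entries (g : PSL2Z) :
    ∃ m : Fin 4 → ℤ, ∃ h : m 0 * m 3 - m 1 * m 2 = 1, g = psl (m 0) (m 1) (m 2) (m 3) h := by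
  obtain ⟨a, b, c, d, h, e⟩ := exists_eq_psl g
  exact ⟨![a, b, c, d], h, e⟩

/-- A choice of matrix entries, row by row, for an element of the modular group. -/
def entries (g : PSL2Z) : Fin 4 → ℤ := (exists_entries g).choose

lemma entries_det (g : PSL2Z) : entries g 0 * entries g 3 - entries g 1 * entries g 2 = 1 :=
  (exists_entries g).choose_spec.choose

lemma eq_psl_entries (g : PSL2Z) :
    g = psl (entries g 0) (entries g 1) (entries g 2) (entries g 3) (entries_det g) :=
  (exists_entries g).choose_spec.choose_spec

lemma entries_injective : Function.Injective entries := by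
  intro g g' h
  rw [eq_psl_entries g, eq_psl_entries g']
  exact psl_congr (congrFun h 0) (congrFun h 1) (congrFun h 2) (congrFun h 3)

/-- The entries of an element of the modular group as real numbers. -/
def realEntries (g : PSL2Z) : Fin 4 → ℝ := fun i => entries g i

lemma tendsto_norm_realEntries {γ : ℕ → PSL2Z} (hγ : Tendsto γ atTop cofinite) :
    Tendsto (fun n => ‖realEntries (γ n)‖) atTop atTop := by
  have h1 : Tendsto (fun n => entries (γ n)) atTop cofinite :=
    entries_injective.tendsto_cofinite.comp hγ
  rw [tendsto_atTop]
  intro B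
  have hfin : {m : Fin 4 → ℤ | ‖(fun i => (m i : ℝ))‖ ≤ B}.Finite := by
    refine (Set.finite_Icc (fun _ => -⌈B⌉ : Fin 4 → ℤ) (fun _ => ⌈B⌉)).subset fun m hm => ?_
    have hb : ∀ i, |(m i : ℝ)| ≤ (⌈B⌉ : ℝ) := fun i =>
      ((norm_le_pi_norm (fun i => (m i : ℝ)) i).trans hm).trans (Int.le_ceil B)
    have hb' : ∀ i, |m i| ≤ ⌈B⌉ := fun i => by exact_mod_cast hb i
    exact ⟨fun i => (abs_le.mp (hb' i)).1, fun i => (abs_le.mp (hb' i)).2⟩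
  filter_upwards [h1.eventually hfin.compl_mem_cofinite] with n hn
  by_contra! h
  exact hn h.le

lemma smul_hpt_eq_quadAct (g : PSL2Z) {w : ℝ × ℝ} (hw : w.1 ≠ 0 ∨ w.2 ≠ 0) {c : ℝ} (hc : c ≠ 0) :
    g • hpt w.1 w.2 =
      hpt (quadAct (c • realEntries g) w).1 (quadAct (c • realEntries g) w).2 := by
  conv_lhs => rw [eq_psl_entries g]
  rw [psl_smul_hpt _ hw]
  have hne := psl_coords_ne (entries_det g) hw
  simp only [quadAct, realEntries, Pi.smul_apply, smul_eq_mul]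
  rw [hpt_eq_hpt_iff hne]
  · ring
  · refine hne.imp (fun h h' => h ?_) (fun h h' => h ?_)
    · have : c * (entries g 0 * w.1 + entries g 1 * w.2) = 0 := by linarith
      exact (mul_eq_zero.mp this).resolve_left hc
    · have : c * (entries g 2 * w.1 + entries g 3 * w.2) = 0 := by linarith
      exact (mul_eq_zero.mp this).resolve_left hc

/-- The convergence property of the modular group: a sequence leaving every finite set has a
subsequence whose normalized matrices converge to a matrix of rank one, with image `x` and kernel
`y`. -/
lemma exists_subseq_tendsToAway {γ : ℕ → PSL2Z} (hγ : Tendsto γ atTop cofinite) :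
    ∃ φ : ℕ → ℕ, StrictMono φ ∧ ∃ x y : OnePoint ℝ, TendsToAway (fun n => γ (φ n)) x y ∧
      ∀ z : ℍ, Tendsto (fun n => (((γ (φ n) • z : ℍ) : ℂ) : OnePoint ℂ)) atTop
        (𝓝 (OnePoint.map (fun a : ℝ => (a : ℂ)) x)) := by
  have hN := tendsto_norm_realEntries hγ
  let m : ℕ → Fin 4 → ℝ := fun n => ‖realEntries (γ n)‖⁻¹ • realEntries (γ n)
  have hmball : ∀ n, m n ∈ Metric.closedBall (0 : Fin 4 → ℝ) 1 := by
    intro n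
    rw [mem_closedBall_zero_iff, norm_smul, norm_inv, norm_norm]
    exact inv_mul_le_one
  obtain ⟨A, -, φ, hφ, hA⟩ := (isCompact_closedBall (0 : Fin 4 → ℝ) 1).tendsto_subseq hmball
  have hN' := hN.comp hφ.tendsto_atTop
  have hpos : ∀ᶠ n in atTop, 0 < ‖realEntries (γ (φ n))‖ := hN'.eventually_gt_atTop 0
  have hAnorm : ‖A‖ = 1 := by
    refine tendsto_nhds_unique hA.norm (tendsto_const_nhds.congr' ?_)
    filter_upwards [hpos] with n hn
    simp only [m, Function.comp, norm_smul, norm_inv, norm_norm]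
    rw [inv_mul_cancel₀ hn.ne']
  have hAi : ∀ i, Tendsto (fun n => m (φ n) i) atTop (𝓝 (A i)) := fun i =>
    (continuous_apply i).continuousAt.tendsto.comp hA
  have hdet : A 0 * A 3 - A 1 * A 2 = 0 := by
    have h1 := ((hAi 0).mul (hAi 3)).sub ((hAi 1).mul (hAi 2))
    have h2 : Tendsto (fun n => ‖realEntries (γ (φ n))‖⁻¹ ^ 2) atTop (𝓝 0) := by
      simpa using (tendsto_inv_atTop_zero.comp hN').pow 2
    refine tendsto_nhds_unique h1 (h2.congr fun n => ?_)
    have h3 : realEntries (γ (φ n)) 0 * realEntries (γ (φ n)) 3 -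
        realEntries (γ (φ n)) 1 * realEntries (γ (φ n)) 2 = 1 := by
      have := entries_det (γ (φ n))
      simp only [realEntries]
      exact_mod_cast this
    simp only [m, Pi.smul_apply, smul_eq_mul]
    linear_combination (-‖realEntries (γ (φ n))‖⁻¹ ^ 2) * h3
  have hAne : A ≠ 0 := by rintro rfl; simp at hAnorm
  -- image and kernel of the limit matrix
  obtain ⟨x1, x2, hx, y1, y2, hy, hxA, hyA⟩ : ∃ x1 x2 : ℝ, (x1 ≠ 0 ∨ x2 ≠ 0) ∧
      ∃ y1 y2 : ℝ, (y1 ≠ 0 ∨ y2 ≠ 0) ∧ (A 0 * x2 = x1 * A 2 ∧ A 1 * x2 = x1 * A 3) ∧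
        (∀ w : ℝ × ℝ, A 0 * w.1 + A 1 * w.2 = 0 → A 2 * w.1 + A 3 * w.2 = 0 →
          w.1 * y2 = y1 * w.2) := by
    have hx : ∃ x1 x2 : ℝ, (x1 ≠ 0 ∨ x2 ≠ 0) ∧ (A 0 * x2 = x1 * A 2 ∧ A 1 * x2 = x1 * A 3) := by
      by_cases h : A 0 ≠ 0 ∨ A 2 ≠ 0
      · exact ⟨A 0, A 2, h, rfl, by linarith⟩
      · refine ⟨A 1, A 3, ?_, by push Not at h; simp [h.1, h.2], rfl⟩
        by_contra! h'
        push Not at h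
        apply hAne; ext i; fin_cases i <;> simp [h.1, h.2, h'.1, h'.2]
    have hy : ∃ y1 y2 : ℝ, (y1 ≠ 0 ∨ y2 ≠ 0) ∧ (∀ w : ℝ × ℝ, A 0 * w.1 + A 1 * w.2 = 0 →
        A 2 * w.1 + A 3 * w.2 = 0 → w.1 * y2 = y1 * w.2) := by
      by_cases h : A 1 ≠ 0 ∨ A 0 ≠ 0
      · exact ⟨-A 1, A 0, h.imp_left neg_ne_zero.mpr, fun w h1 _ => by linarith⟩
      · refine ⟨-A 3, A 2, ?_, fun w _ h2 => by linarith⟩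
        by_contra! h'
        push Not at h
        apply hAne; ext i; fin_cases i <;> simp [h.1, h.2, h'.2, neg_eq_zero.mp h'.1]
    obtain ⟨x1, x2, hx, hxA⟩ := hx
    obtain ⟨y1, y2, hy, hyA⟩ := hy
    exact ⟨x1, x2, hx, y1, y2, hy, hxA, hyA⟩
  refine ⟨φ, hφ, hpt x1 x2, hpt y1 y2, ?_, ?_⟩
  · intro K hK hyK U hU
    let S : Set (ℝ × ℝ) := Metric.sphere 0 1 ∩ {w | hpt w.1 w.2 ∈ K}
    have hSne : ∀ w ∈ Metric.sphere (0 : ℝ × ℝ) 1, w.1 ≠ 0 ∨ w.2 ≠ 0 := by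
      rintro w hw
      by_contra! h
      have : w = 0 := Prod.ext h.1 h.2
      simp [this] at hw
    have hcont : ContinuousOn (fun w : ℝ × ℝ => hpt w.1 w.2) (Metric.sphere 0 1) := fun w hw =>
      (tendsto_hpt (continuous_fst.tendsto w) (continuous_snd.tendsto w) (hSne w hw)).mono_left
        nhdsWithin_le_nhds
    have hS : IsCompact S := (isCompact_sphere (0 : ℝ × ℝ) 1).of_isClosed_subset
      (hcont.preimage_isClosed_of_isClosed Metric.isClosed_sphere hK.isClosed)
      Set.inter_subset_left
    have hev : ∀ᶠ B in 𝓝 A, ∀ w ∈ S, hpt (quadAct B w).1 (quadAct B w).2 ∈ U := by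
      refine hS.eventually_forall_of_forall_eventually (x₀ := A)
        (P := fun B w => hpt (quadAct B w).1 (quadAct B w).2 ∈ U) fun w hw => ?_
      have hne : (quadAct A w).1 ≠ 0 ∨ (quadAct A w).2 ≠ 0 := by
        by_contra! h
        apply hyK
        have := hyA w h.1 h.2
        rw [← (hpt_eq_hpt_iff (hSne w hw.1) hy).mpr this]
        exact hw.2
      have hx' : hpt (quadAct A w).1 (quadAct A w).2 = hpt x1 x2 := by
        rw [hpt_eq_hpt_iff hne hx]
        simp only [quadAct]
        linear_combination w.1 * hxA.1 + w.2 * hxA.2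
      have c1 : Continuous (fun z : (Fin 4 → ℝ) × ℝ × ℝ => (quadAct z.1 z.2).1) := by
        unfold quadAct; fun_prop
      have c2 : Continuous (fun z : (Fin 4 → ℝ) × ℝ × ℝ => (quadAct z.1 z.2).2) := by
        unfold quadAct; fun_prop
      have := tendsto_hpt (c1.tendsto (A, w)) (c2.tendsto (A, w)) hne
      rw [hx'] at this
      exact this hU
    filter_upwards [hA.eventually hev, hpos] with n hn hposn z hz
    obtain ⟨u, v, huv, rfl⟩ := exists_eq_hpt z
    have hw0 : ((u, v) : ℝ × ℝ) ≠ 0 := by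
      intro h; simp only [Prod.mk_eq_zero] at h; tauto
    have hnorm : 0 < ‖((u, v) : ℝ × ℝ)‖ := norm_pos_iff.mpr hw0
    set c := ‖((u, v) : ℝ × ℝ)‖⁻¹ with hcdef
    have hc : c ≠ 0 := (inv_pos.mpr hnorm).ne'
    have hcw : hpt (c * u) (c * v) = hpt u v := by
      rw [hpt_eq_hpt_iff _ huv]
      · ring
      · exact huv.imp (mul_ne_zero hc) (mul_ne_zero hc)
    have hmem : ((c * u, c * v) : ℝ × ℝ) ∈ S := by
      refine ⟨?_, ?_⟩
      · have : ((c * u, c * v) : ℝ × ℝ) = c • (u, v) := rfl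
        rw [this, mem_sphere_zero_iff_norm, norm_smul, hcdef, norm_inv, norm_norm,
          inv_mul_cancel₀ hnorm.ne']
      · change hpt (c * u) (c * v) ∈ K
        rw [hcw]; exact hz
    have := hn _ hmem
    rw [← hcw]
    have e := smul_hpt_eq_quadAct (γ (φ n)) (w := (c * u, c * v)) (hSne _ hmem.1)
      (inv_ne_zero hposn.ne')
    exact e ▸ this
  · -- on the upper half-plane the normalized matrices converge to the constant map with value `x`,
    -- since a nonzero real linear form `c z + d` has no zero there
    intro z
    have key : ∀ᶠ n in atTop, ((γ (φ n) • z : ℍ) : ℂ) =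
        ((m (φ n) 0 : ℂ) * z + m (φ n) 1) / ((m (φ n) 2 : ℂ) * z + m (φ n) 3) := by
      filter_upwards [hpos] with n hn
      have e1 : (γ (φ n) • z : ℍ) =
          slMat (entries (γ (φ n)) 0) (entries (γ (φ n)) 1) (entries (γ (φ n)) 2)
            (entries (γ (φ n)) 3) (entries_det _) • z := by
        conv_lhs => rw [eq_psl_entries (γ (φ n))]
        rfl
      have hne : ((‖realEntries (γ (φ n))‖⁻¹ : ℝ) : ℂ) ≠ 0 := by
        exact_mod_cast inv_ne_zero hn.ne'
      rw [e1, UpperHalfPlane.coe_specialLinearGroup_apply]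
      simp only [slMat_val, m, Pi.smul_apply, smul_eq_mul, realEntries, algebraMap_int_eq,
        Int.coe_castRingHom, Matrix.of_apply, Matrix.cons_val', Matrix.cons_val_zero,
        Matrix.cons_val_one, Matrix.cons_val_fin_one]
      rw [Complex.ofReal_inv] at hne
      push_cast
      rw [← mul_div_mul_left _ _ hne]
      congr 1 <;> ring
    have hAc : ∀ i, Tendsto (fun n => ((m (φ n) i : ℝ) : ℂ)) atTop (𝓝 (A i : ℂ)) := fun i =>
      (Complex.continuous_ofReal.tendsto _).comp (hAi i)
    have hnum : Tendsto (fun n => (m (φ n) 0 : ℂ) * z + m (φ n) 1) atTop (𝓝 (A 0 * z + A 1)) :=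
      ((hAc 0).mul_const _).add (hAc 1)
    have hden : Tendsto (fun n => (m (φ n) 2 : ℂ) * z + m (φ n) 3) atTop (𝓝 (A 2 * z + A 3)) :=
      ((hAc 2).mul_const _).add (hAc 3)
    have hlin : ∀ c d : ℝ, (c : ℂ) * z + d = 0 → c = 0 ∧ d = 0 := by
      intro c d h
      have him := congrArg Complex.im h
      simp only [Complex.add_im, Complex.mul_im, Complex.ofReal_re, Complex.ofReal_im, zero_mul,
        add_zero, Complex.zero_im] at him
      have hc : c = 0 := (mul_eq_zero.mp him).resolve_right z.im_pos.ne'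
      refine ⟨hc, ?_⟩
      rw [hc] at h
      simpa using h
    by_cases h23 : A 2 = 0 ∧ A 3 = 0
    · have hx2 : x2 = 0 := by
        by_contra hx2
        apply hAne
        have h0 : A 0 = 0 := by
          have := hxA.1; rw [h23.1, mul_zero] at this
          exact (mul_eq_zero.mp this).resolve_right hx2
        have h1 : A 1 = 0 := by
          have := hxA.2; rw [h23.2, mul_zero] at this
          exact (mul_eq_zero.mp this).resolve_right hx2
        ext i; fin_cases i <;> simp [h23.1, h23.2, h0, h1]
      rw [hx2, hpt_zero, OnePoint.map_infty]
      have hnum0 : (A 0 : ℂ) * z + A 1 ≠ 0 := by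
        intro h
        have := hlin _ _ h
        apply hAne; ext i; fin_cases i <;> simp [h23.1, h23.2, this.1, this.2]
      have hdenne : ∀ n, (m (φ n) 2 : ℂ) * z + m (φ n) 3 = 0 → ‖realEntries (γ (φ n))‖ = 0 := by
        intro n h
        by_contra hne
        have h' := hlin _ _ h
        simp only [m, Pi.smul_apply, smul_eq_mul, mul_eq_zero, inv_eq_zero, hne, false_or,
          realEntries, Int.cast_eq_zero] at h'
        have := entries_det (γ (φ n))
        rw [h'.1, h'.2] at this
        simp at this
      have hinv : Tendsto (fun n => (((m (φ n) 0 : ℂ) * z + m (φ n) 1) /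
          ((m (φ n) 2 : ℂ) * z + m (φ n) 3))⁻¹) atTop (𝓝[≠] 0) := by
        refine tendsto_nhdsWithin_iff.mpr ⟨?_, ?_⟩
        · have := hden.div hnum hnum0
          simp only [h23.1, h23.2, Complex.ofReal_zero, zero_mul, add_zero, zero_div] at this
          refine this.congr fun n => ?_
          simp
        · filter_upwards [hpos, hnum.eventually_ne hnum0] with n hn hn'
          refine inv_ne_zero (div_ne_zero hn' fun h => hn.ne' (hdenne n h))
      have hco : Tendsto (fun n => ((m (φ n) 0 : ℂ) * z + m (φ n) 1) /
          ((m (φ n) 2 : ℂ) * z + m (φ n) 3)) atTop (coclosedCompact ℂ) := by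
        rw [coclosedCompact_eq_cocompact, ← Metric.cobounded_eq_cocompact]
        have := tendsto_inv₀_nhdsNE_zero.comp hinv
        refine this.congr fun n => ?_
        simp
      refine (OnePoint.tendsto_coe_infty.comp hco).congr' ?_
      filter_upwards [key] with n hn
      rw [hn]; rfl
    · have hden0 : (A 2 : ℂ) * z + A 3 ≠ 0 := fun h => h23 (hlin _ _ h)
      have hx2 : x2 ≠ 0 := by
        rintro rfl
        have hx1 : x1 ≠ 0 := by simpa using hx
        simp only [mul_zero, zero_eq_mul, hx1, false_or] at hxA
        exact h23 hxA
      have hval : ((A 0 : ℂ) * z + A 1) / (A 2 * z + A 3) = ((x1 / x2 : ℝ) : ℂ) := by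
        have hx2c : (x2 : ℂ) ≠ 0 := by exact_mod_cast hx2
        have e0 : (A 0 : ℂ) * x2 = x1 * A 2 := by exact_mod_cast hxA.1
        have e1 : (A 1 : ℂ) * x2 = x1 * A 3 := by exact_mod_cast hxA.2
        push_cast
        rw [div_eq_div_iff hden0 hx2c]
        linear_combination (z : ℂ) * e0 + e1
      rw [hpt_of_ne hx2, OnePoint.map_some, ← hval]
      refine ((OnePoint.continuous_coe.tendsto _).comp (hnum.div hden hden0)).congr' ?_
      filter_upwards [key] with n hn
      rw [hn]; rfl

/-- A sequence converging to an ideal point in the closed disc converges to it in the convergence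
compactification. -/
lemma TendsToIdeal.tendsToBoundary {γ : ℕ → PSL2Z} {x : OnePoint ℝ} (h : TendsToIdeal γ x) :
    TendsToBoundary γ x := by
  obtain ⟨z, hz⟩ := h
  have hcof : Tendsto γ atTop cofinite := by
    rw [Tendsto, le_cofinite_iff_eventually_ne]
    intro g
    have hne : ((g • z : ℍ) : ℂ) ≠ OnePoint.map (fun a : ℝ => (a : ℂ)) x := by
      induction x using OnePoint.rec with
      | infty => exact OnePoint.coe_ne_infty _
      | coe r =>
        rw [OnePoint.map_some]
        intro h
        have h' := OnePoint.coe_injective h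
        have := (g • z).im_pos
        rw [← UpperHalfPlane.coe_im, h', Complex.ofReal_im] at this
        exact lt_irrefl _ this
    rw [eventually_map]
    filter_upwards [hz.eventually_ne hne.symm] with n hn hgn
    exact hn (by rw [hgn])
  intro φ hφ
  obtain ⟨ψ, hψ, x', y, hxy, hz'⟩ := exists_subseq_tendsToAway (hcof.comp hφ.tendsto_atTop)
  refine ⟨ψ, hψ, y, ?_⟩
  have heq := tendsto_nhds_unique (hz' z)
    (hz.comp (hφ.tendsto_atTop.comp hψ.tendsto_atTop))
  have hinj : Function.Injective (OnePoint.map (fun a : ℝ => (a : ℂ))) :=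
    Option.map_injective Complex.ofReal_injective
  rw [← hinj heq]
  exact hxy

lemma exists_ne_and_ne : ∀ a b : OnePoint ℝ, ∃ c, c ≠ a ∧ c ≠ b := by
  intro a b
  obtain ⟨c, hc⟩ := ((Set.toFinite {a, b}).infinite_compl (α := OnePoint ℝ)).nonempty
  simp only [Set.mem_compl_iff, Set.mem_insert_iff, Set.mem_singleton_iff, not_or] at hc
  exact ⟨c, hc⟩

/-- The repelling point of a convergence sequence is the attracting point of the inverses. -/
lemma TendsToAway.eq_of_inv {Γ : Type*} [Group Γ] [MulAction Γ (OnePoint ℝ)] {γ : ℕ → Γ}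
    {x y x' y' : OnePoint ℝ} (h : TendsToAway γ x y') (h' : TendsToAway (fun n => (γ n)⁻¹) y x') :
    y' = y := by
  by_contra hne
  obtain ⟨z, hzx, hzx'⟩ := exists_ne_and_ne x x'
  obtain ⟨C, hCy, hC, hCsub⟩ := exists_mem_nhds_isClosed_subset
    (isOpen_compl_singleton.mem_nhds (show y ∈ ({y'}ᶜ : Set _) from fun e => hne e.symm))
  have h1 := h' {z} isCompact_singleton (by simpa using hzx'.symm) C hCy
  have h2 := h C hC.isCompact (fun hy => hCsub hy rfl) {z}ᶜ
    (isOpen_compl_singleton.mem_nhds hzx.symm)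
  obtain ⟨n, hn1, hn2⟩ := (h1.and h2).exists
  apply hn2 _ (hn1 z rfl)
  simp

/-! ### The Bowditch boundary of subgroups of index at most two -/

instance : TopologicalSpace.MetrizableSpace (OnePoint ℝ) :=
  (onePointEquivSphereOfFinrankEq (ι := Fin 2) (V := ℝ) (by simp)).isEmbedding.metrizableSpace

instance : PerfectSpace (OnePoint ℝ) :=
  perfectSpace_iff_forall_not_isolated.mpr fun _ => inferInstance

/-- A nontrivial element fixing an irrational point has infinite order and exactly two fixed
points: the irrational point and its Galois conjugate. -/
lemma loxodromic_of_smul_irrational {g : PSL2Z} (hg1 : g ≠ 1) {r : ℝ} (hr : Irrational r)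
    (hg : g • (r : OnePoint ℝ) = r) :
    {x : OnePoint ℝ | g • x = x}.ncard = 2 ∧ ∀ n : ℕ, 0 < n → g ^ n ≠ 1 := by
  obtain ⟨a, b, c, d, h, rfl⟩ := exists_eq_psl g
  have hne := psl_coords_ne h (u := r) (v := 1) (by simp)
  rw [mul_one, mul_one] at hne
  rw [psl_smul_coe, ← hpt_one r, hpt_eq_hpt_iff hne (by simp)] at hg
  have hirr : ∀ u v : ℤ, (u : ℝ) * r = v → u = 0 := by
    intro u v huv
    by_contra hu
    have hu' : (u : ℝ) ≠ 0 := by exact_mod_cast hu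
    exact hr ⟨(v : ℚ) / u, by push_cast; rw [← huv]; field_simp⟩
  have hc : c ≠ 0 := by
    rintro rfl
    have had : a * d = 1 := by linarith
    have hda : d = a := by
      rcases Int.eq_one_or_neg_one_of_mul_eq_one' had with ⟨rfl, rfl⟩ | ⟨rfl, rfl⟩ <;> rfl
    subst hda
    have hb : b = 0 := by
      have : (b : ℝ) = 0 := by push_cast at hg; linarith
      exact_mod_cast this
    subst hb
    apply hg1
    rcases Int.eq_one_or_neg_one_of_mul_eq_one had with rfl | rfl
    · exact psl_one
    · rw [psl_neg, ← psl_one]; apply psl_congr <;> norm_num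
  have hcR : (c : ℝ) ≠ 0 := by exact_mod_cast hc
  have hquad : (c : ℝ) * r ^ 2 + (d - a) * r - b = 0 := by linear_combination -hg
  have hμ : ∀ e : ℤ, (c : ℝ) * r + d ≠ e := by
    intro e he
    exact hc (hirr c (e - d) (by push_cast; linarith))
  constructor
  · set r' : ℝ := (a - d) / c - r with hr'
    have hrr' : r ≠ r' := by
      intro he
      have : ((2 * c : ℤ) : ℝ) * r = ((a - d : ℤ) : ℝ) := by
        push_cast
        have : r + r = (a - d) / c := by rw [hr'] at he; linarith
        field_simp at this
        linarith
      have := hirr _ _ this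
      omega
    have hset : {x : OnePoint ℝ | psl a b c d h • x = x} =
        {(r : OnePoint ℝ), (r' : OnePoint ℝ)} := by
      ext x
      simp only [Set.mem_ofPred_eq, Set.mem_insert_iff, Set.mem_singleton_iff]
      induction x using OnePoint.rec with
      | infty =>
        rw [psl_smul_infty, hpt_of_ne hcR]
        simp
      | coe z =>
        have hne := psl_coords_ne h (u := z) (v := 1) (by simp)
        rw [mul_one, mul_one] at hne
        rw [psl_smul_coe, ← hpt_one z, hpt_eq_hpt_iff hne (by simp), hpt_one, OnePoint.coe_eq_coe,
          OnePoint.coe_eq_coe]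
        have hfac : (a * z + b) * 1 - z * (c * z + d) = -c * ((z - r) * (z - r')) := by
          have hs : c * (r + r') = a - d := by rw [hr']; field_simp; ring
          have hp : c * (r * r') = -b := by
            have : c * (r * r') = r * (c * (r + r')) - c * r ^ 2 := by ring
            rw [this, hs]; linarith
          linear_combination -z * hs + hp
        rw [← sub_eq_zero, hfac, mul_eq_zero, neg_eq_zero, or_iff_right hcR, mul_eq_zero,
          sub_eq_zero, sub_eq_zero]
    rw [hset, Set.ncard_pair (fun e => hrr' (OnePoint.coe_injective e))]
  · intro n hn hpow
    -- the matrix multiplies the vector `(r, 1)` by the irrational number `c r + d`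
    have hact : ∀ n : ℕ, ∃ (a' b' c' d' : ℤ) (h' : a' * d' - b' * c' = 1),
        psl a b c d h ^ n = psl a' b' c' d' h' ∧ c' * r + d' = (c * r + d) ^ n := by
      intro n
      induction n with
      | zero => exact ⟨1, 0, 0, 1, by norm_num, by rw [pow_zero, psl_one], by simp⟩
      | succ n ih =>
        obtain ⟨a', b', c', d', h', e1, e2⟩ := ih
        refine ⟨_, _, _, _, _, by rw [pow_succ, e1, psl_mul], ?_⟩
        rw [pow_succ, ← e2]
        push_cast
        linear_combination c' * hg
    obtain ⟨a', b', c', d', h', e1, e2⟩ := hact n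
    rw [e1, ← psl_one] at hpow
    have habs : |c * r + d| ^ n = 1 := by
      rw [← abs_pow, ← e2]
      rcases psl_eq_psl hpow with ⟨-, -, rfl, rfl⟩ | ⟨-, -, rfl, rfl⟩ <;> simp
    have h1 : |c * r + d| = 1 := (pow_eq_one_iff_of_nonneg (abs_nonneg _) hn.ne').mp habs
    rcases (abs_eq one_pos.le).mp h1 with h1 | h1
    · exact hμ 1 (by simpa using h1)
    · exact hμ (-1) (by simpa using h1)

/-- A nontrivial integral translation has no fixed point besides `∞`. -/
lemma psT_zpow_fixed {n : ℤ} (hn : n ≠ 0) {x : OnePoint ℝ} (h : psT ^ n • x = x) :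
    x = OnePoint.infty := by
  induction x using OnePoint.rec with
  | infty => rfl
  | coe r =>
    rw [psT_zpow_smul_coe, OnePoint.coe_eq_coe] at h
    exact absurd (by exact_mod_cast (by linarith : (n : ℝ) = 0)) hn

lemma psT_zpow_injective : Function.Injective (fun n : ℤ => psT ^ n) := by
  intro m n h
  have := congrArg (fun g : PSL2Z => g • ((0 : ℝ) : OnePoint ℝ)) h
  simp only [psT_zpow_smul_coe, OnePoint.coe_eq_coe, zero_add] at this
  exact_mod_cast this

section IndexTwo

variable {Γ : Type*} [Group Γ] (φ : Γ →* PSL2Z)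

/-- A subgroup for which `1` and the generator of the cusp group meet all cosets contains all
squares. -/
lemma sq_mem_range (hT : ∀ g : PSL2Z, g ∈ φ.range ∨ psT * g ∈ φ.range) (g : PSL2Z) :
    g ^ 2 ∈ φ.range := by
  rcases hT g with h | h
  · exact pow_mem h 2
  · rcases hT (g ^ 2) with h' | h'
    · exact h'
    · have : g ∈ φ.range := by
        have h2 := φ.range.mul_mem (φ.range.inv_mem h) h'
        rwa [show (psT * g)⁻¹ * (psT * g ^ 2) = g by group] at h2
      exact pow_mem this 2

lemma exists_map_eq_conj_psT_zpow (hT : ∀ g : PSL2Z, g ∈ φ.range ∨ psT * g ∈ φ.range)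
    (k : PSL2Z) (n : ℤ) : ∃ g : Γ, φ g = k * psT ^ (2 * n) * k⁻¹ := by
  obtain ⟨g, hg⟩ := sq_mem_range φ hT (k * psT ^ n * k⁻¹)
  refine ⟨g, hg.trans ?_⟩
  rw [conj_pow, ← zpow_natCast, ← zpow_mul, mul_comm n]
  rfl

variable [MulAction Γ (OnePoint ℝ)] (hact : ∀ (g : Γ) (x : OnePoint ℝ), g • x = φ g • x)

include hact in
lemma isConvergenceAction_of_hom (hφ : Function.Injective φ) :
    IsConvergenceAction Γ (OnePoint ℝ) where
  continuous_smul g := by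
    simp only [hact]
    exact continuous_psl_smul (φ g)
  convergence γ hγ := by
    have hcof : Tendsto (fun n => φ (γ n)) atTop cofinite := by
      rw [← Nat.cofinite_eq_atTop]
      exact (hφ.comp hγ).tendsto_cofinite
    obtain ⟨ψ, hψ, x, y, hxy, -⟩ := exists_subseq_tendsToAway hcof
    refine ⟨ψ, hψ, x, y, fun K hK hy U hU => ?_⟩
    simpa only [hact] using hxy K hK hy U hU

include hact in
lemma map_mem_conj_of_mem_stabilizer {k : PSL2Z} {g : Γ}
    (hg : g ∈ MulAction.stabilizer Γ (k • (OnePoint.infty : OnePoint ℝ))) :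
    ∃ n : ℤ, φ g = k * psT ^ n * k⁻¹ := by
  rw [MulAction.mem_stabilizer_iff, hact] at hg
  have : (k⁻¹ * φ g * k) • (OnePoint.infty : OnePoint ℝ) = OnePoint.infty := by
    rw [mul_smul, mul_smul, hg, inv_smul_smul]
  obtain ⟨n, hn⟩ := eq_psT_zpow_of_smul_infty this
  exact ⟨n, by rw [← hn]; group⟩

include hact in
/-- The stabilizers of rational points are parabolic. -/
lemma isParabolicSubgroup_stabilizer (hφ : Function.Injective φ)
    (hT : ∀ g : PSL2Z, g ∈ φ.range ∨ psT * g ∈ φ.range) (k : PSL2Z) :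
    IsParabolicSubgroup (OnePoint ℝ)
      (MulAction.stabilizer Γ (k • (OnePoint.infty : OnePoint ℝ))) := by
  refine ⟨?_, ⟨k • OnePoint.infty, fun h hh => hh⟩, fun h hh => ?_⟩
  · choose f hf using exists_map_eq_conj_psT_zpow φ hT k
    refine Set.infinite_of_injective_forall_mem (f := f) (fun m n hmn => ?_) fun n => ?_
    · have := congrArg φ hmn
      rw [hf, hf, mul_left_inj, mul_right_inj] at this
      have := psT_zpow_injective this
      omega
    · change f n • k • (OnePoint.infty : OnePoint ℝ) = _
      rw [hact, hf, mul_smul, inv_smul_smul, mul_smul, psT_zpow_smul_infty]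
  · rintro ⟨hord, hcard⟩
    obtain ⟨n, hn⟩ := map_mem_conj_of_mem_stabilizer φ hact hh
    by_cases hn0 : n = 0
    · have : h = 1 := hφ (by rw [hn, hn0]; simp)
      rw [this, orderOf_one] at hord
      exact one_ne_zero hord
    · have hsub : {x : OnePoint ℝ | h • x = x} ⊆ {k • (OnePoint.infty : OnePoint ℝ)} := by
        intro x hx
        rw [Set.mem_ofPred_eq, hact, hn, mul_smul, mul_smul, ← eq_inv_smul_iff] at hx
        have := psT_zpow_fixed hn0 hx
        rw [Set.mem_singleton_iff, ← this, smul_inv_smul]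
      have := Set.ncard_le_ncard hsub
      rw [hcard, Set.ncard_singleton] at this
      omega

include hact in
/-- The maximal parabolic subgroups are the stabilizers of the rational points. -/
lemma isMaximalParabolic_iff (hφ : Function.Injective φ)
    (hT : ∀ g : PSL2Z, g ∈ φ.range ∨ psT * g ∈ φ.range) (H : Subgroup Γ) :
    IsMaximalParabolic (OnePoint ℝ) H ↔
      ∃ k : PSL2Z, H = MulAction.stabilizer Γ (k • (OnePoint.infty : OnePoint ℝ)) := by
  constructor
  · rintro ⟨⟨hinf, ⟨x, hx⟩, hlox⟩, hmax⟩
    rcases rational_or_irrational x with ⟨k, rfl⟩ | ⟨r, hr, rfl⟩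
    · exact ⟨k, (hmax _ (isParabolicSubgroup_stabilizer φ hact hφ hT k) hx).symm⟩
    · exfalso
      obtain ⟨h, hh, hne⟩ := hinf.exists_notMem_finset {1}
      have hne' : φ h ≠ 1 := fun e => hne (by
        rw [Finset.mem_singleton]; exact hφ (e.trans φ.map_one.symm))
      have hfix := hx h hh
      rw [hact] at hfix
      obtain ⟨h1, h2⟩ := loxodromic_of_smul_irrational hne' hr hfix
      refine hlox h hh ⟨orderOf_eq_zero_iff'.mpr fun n hn e => h2 n hn ?_, ?_⟩
      · rw [← map_pow, e, map_one]
      · simpa only [hact] using h1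
  · rintro ⟨k, rfl⟩
    refine ⟨isParabolicSubgroup_stabilizer φ hact hφ hT k, ?_⟩
    rintro K ⟨-, ⟨y, hy⟩, -⟩ hle
    refine le_antisymm (fun g hg => ?_) hle
    obtain ⟨f, hf⟩ := exists_map_eq_conj_psT_zpow φ hT k 1
    have hfs : f ∈ MulAction.stabilizer Γ (k • (OnePoint.infty : OnePoint ℝ)) := by
      rw [MulAction.mem_stabilizer_iff, hact, hf, mul_smul, inv_smul_smul, mul_smul,
        psT_zpow_smul_infty]
    have hfy := hy f (hle hfs)
    rw [hact, hf, mul_smul, mul_smul, ← eq_inv_smul_iff] at hfy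
    have hyk : y = k • (OnePoint.infty : OnePoint ℝ) := by
      rw [← psT_zpow_fixed (by norm_num) hfy, smul_inv_smul]
    rw [MulAction.mem_stabilizer_iff, ← hyk]
    exact hy g hg

include hact in
/-- Rational points are bounded parabolic. -/
lemma isBoundedParabolicPoint_smul_infty (hφ : Function.Injective φ)
    (hT : ∀ g : PSL2Z, g ∈ φ.range ∨ psT * g ∈ φ.range) (k : PSL2Z) :
    IsBoundedParabolicPoint Γ (k • (OnePoint.infty : OnePoint ℝ)) := by
  refine ⟨isParabolicSubgroup_stabilizer φ hact hφ hT k,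
    (fun x : OnePoint ℝ => k • x) '' ((↑) '' Set.Icc (0 : ℝ) 2),
    (isCompact_Icc.image OnePoint.continuous_coe).image (continuous_psl_smul k), ?_, ?_⟩
  · rintro ⟨_, ⟨r, -, rfl⟩, h⟩
    exact OnePoint.coe_ne_infty r (smul_left_cancel k h)
  · intro z hz
    obtain ⟨r, hr⟩ := OnePoint.ne_infty_iff_exists.mp
      (fun e => hz (by rw [← e, smul_inv_smul]) : k⁻¹ • z ≠ OnePoint.infty)
    have hz' : z = k • (r : OnePoint ℝ) := by rw [hr, smul_inv_smul]
    obtain ⟨f, hf⟩ := exists_map_eq_conj_psT_zpow φ hT k (-⌊r / 2⌋)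
    refine ⟨f, ?_, ?_⟩
    · rw [MulAction.mem_stabilizer_iff, hact, hf, mul_smul, inv_smul_smul, mul_smul,
        psT_zpow_smul_infty]
    · refine ⟨_, ⟨r + ((2 * -⌊r / 2⌋ : ℤ) : ℝ), ⟨?_, ?_⟩, rfl⟩, ?_⟩
      · push_cast; linarith [Int.floor_le (r / 2)]
      · push_cast; linarith [Int.lt_floor_add_one (r / 2)]
      · change k • _ = f • z
        rw [hact, hf, hz', mul_smul, inv_smul_smul, mul_smul, psT_zpow_smul_coe]

/-- Dirichlet's approximation theorem with arbitrarily large denominators. -/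
lemma exists_rat_den_gt {x : ℝ} (hx : Irrational x) (N : ℕ) :
    ∃ t : ℚ, N < t.den ∧ |x - t| ≤ 1 / (t.den : ℝ) ^ 2 := by
  have h1 := hx.eventually_forall_le_dist_cast_rat_of_den_le N
  have h2 : Tendsto (fun n : ℕ => 1 / ((n : ℝ) + 1)) atTop (𝓝 0) :=
    tendsto_one_div_add_atTop_nhds_zero_nat
  obtain ⟨n, hn, hn0⟩ := ((h2.eventually h1).and (eventually_gt_atTop 0)).exists
  obtain ⟨t, ht1, ht2⟩ := Real.exists_rat_abs_sub_le_and_den_le x hn0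
  have hd : (1 : ℝ) ≤ t.den := by exact_mod_cast t.den_pos
  have hn' : (0 : ℝ) < n + 1 := by positivity
  refine ⟨t, ?_, ht1.trans ?_⟩
  · by_contra! hle
    -- then `x` would be at distance exactly `1 / (n + 1)` from `t`, making it rational
    have h3 := hn t hle
    rw [Real.dist_eq] at h3
    have h4 : |x - t| = 1 / ((n : ℝ) + 1) := by
      refine le_antisymm (ht1.trans ?_) h3
      apply one_div_le_one_div_of_le hn'
      nlinarith
    have : |x - t| = ((1 / ((n : ℚ) + 1) : ℚ) : ℝ) := by rw [h4]; push_cast; rfl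
    rcases abs_eq_abs.mp (this.trans (abs_of_nonneg (by positivity)).symm) with h5 | h5
    · exact hx ⟨t + 1 / ((n : ℚ) + 1), by push_cast at h5 ⊢; linarith⟩
    · exact hx ⟨t - 1 / ((n : ℚ) + 1), by push_cast at h5 ⊢; linarith⟩
  · apply one_div_le_one_div_of_le (by positivity)
    have : (t.den : ℝ) ≤ n := by exact_mod_cast ht2
    nlinarith

include hact in
/-- Irrational points are conical: rational approximations `p / q` with `|x - p / q| ≤ 1 / q ^ 2`
provide matrices with lower row `(q, -p)` that separate `x` from all other points. -/
lemma isConicalPoint_of_irrational (hT : ∀ g : PSL2Z, g ∈ φ.range ∨ psT * g ∈ φ.range)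
    {x : ℝ} (hx : Irrational x) : IsConicalPoint Γ (x : OnePoint ℝ) := by
  have step : ∀ N : ℕ, ∃ (g : Γ) (u v p q : ℤ) (h : u * (-p) - v * q = 1),
      φ g = psl u v q (-p) h ∧ (N : ℤ) < q ∧ |(q : ℝ) * (q * x - p)| ≤ 1 ∧ 0 ≤ u ∧ u ≤ 2 * q := by
    intro N
    obtain ⟨t, ht1, ht2⟩ := exists_rat_den_gt hx N
    have hq : (0 : ℤ) < t.den := by exact_mod_cast t.den_pos
    have hcop : IsCoprime t.num (t.den : ℤ) :=
      Int.isCoprime_iff_gcd_eq_one.mpr (by simpa [Int.gcd] using t.reduced)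
    obtain ⟨u0, v0, huv⟩ := hcop
    have hbound : |((t.den : ℤ) : ℝ) * ((t.den : ℤ) * x - t.num)| ≤ 1 := by
      have hd : (0 : ℝ) < t.den := by exact_mod_cast t.den_pos
      have e : ((t.den : ℤ) : ℝ) * ((t.den : ℤ) * x - t.num) = (t.den : ℝ) ^ 2 * (x - t) := by
        have : (t : ℝ) * t.den = t.num := by exact_mod_cast Rat.mul_den_eq_num t
        push_cast; rw [← this]; ring
      rw [e, abs_mul, abs_of_nonneg (by positivity), mul_comm]
      rwa [le_div_iff₀ (by positivity)] at ht2
    obtain ⟨q, hqd⟩ : ∃ q : ℤ, q = t.den := ⟨_, rfl⟩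
    obtain ⟨p, hp⟩ : ∃ p : ℤ, p = t.num := ⟨_, rfl⟩
    rw [← hqd] at hq hbound huv
    rw [← hp] at hbound huv
    replace ht1 : (N : ℤ) < q := by rw [hqd]; exact_mod_cast ht1
    -- the upper left entry is reduced modulo `q`, so that the ratio `u / q` stays bounded
    have hdet : ((-u0) % q) * (-p) - (-(v0 - p * ((-u0) / q))) * q = 1 := by
      have := Int.emod_add_mul_ediv (-u0) q
      linear_combination huv - p * this
    have hu1 := Int.emod_nonneg (-u0) hq.ne'
    have hu2 := Int.emod_lt_of_pos (-u0) hq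
    rcases hT (psl _ _ q (-p) hdet) with ⟨g, hg⟩ | ⟨g, hg⟩
    · exact ⟨g, _, _, p, q, hdet, hg, ht1, hbound, hu1, by linarith⟩
    · rw [psT, psl_mul] at hg
      refine ⟨g, (-u0) % q + q, _, p, q, ?_, hg.trans (psl_congr ?_ rfl ?_ ?_),
        ht1, hbound, by linarith, by linarith⟩
      · linear_combination hdet
      · ring
      · ring
      · ring
  choose g u v p q hdet hg hqN hδ hu0 hu2 using step
  have hqpos : ∀ n, (0 : ℝ) < q n := fun n => by
    have : (0 : ℤ) < q n := lt_of_le_of_lt (by positivity) (hqN n)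
    exact_mod_cast this
  let δ : ℕ → ℝ := fun n => (q n : ℝ) * (q n * x - p n)
  let β : ℕ → ℝ := fun n => (u n : ℝ) / q n
  have hmem : ∀ n, (β n, δ n) ∈ Set.Icc (0 : ℝ) 2 ×ˢ Set.Icc (-1 : ℝ) 1 := by
    intro n
    refine ⟨⟨div_nonneg (by exact_mod_cast hu0 n) (hqpos n).le, ?_⟩, abs_le.mp (hδ n)⟩
    rw [div_le_iff₀ (hqpos n)]; exact_mod_cast hu2 n
  obtain ⟨⟨b, d⟩, -, ψ, hψ, hlim⟩ := (isCompact_Icc.prod isCompact_Icc).tendsto_subseq hmem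
  have hb : Tendsto (fun n => β (ψ n)) atTop (𝓝 b) := (continuous_fst.tendsto _).comp hlim
  have hd : Tendsto (fun n => δ (ψ n)) atTop (𝓝 d) := (continuous_snd.tendsto _).comp hlim
  have hqtop : Tendsto (fun n => (q (ψ n) : ℝ)) atTop atTop := by
    have h1 : Tendsto (fun n : ℕ => ((ψ n : ℕ) : ℝ)) atTop atTop :=
      tendsto_natCast_atTop_atTop.comp hψ.tendsto_atTop
    refine tendsto_atTop_mono (fun n => ?_) h1
    exact_mod_cast (hqN (ψ n)).le
  have hne1 : b * d - 1 ≠ 0 ∨ d ≠ 0 := by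
    by_contra! h
    rw [h.2] at h; norm_num at h
  -- in coordinates scaled by `q`, the matrix acts by `z ↦ u / q - 1 / (q (q z - p))`
  have hform : ∀ n (z : ℝ), g n • (z : OnePoint ℝ) =
      hpt (β n * ((q n : ℝ) * (q n * z - p n)) - 1) ((q n : ℝ) * (q n * z - p n)) := by
    intro n z
    have hdetR : ((u n : ℝ) * (-p n) - v n * q n : ℝ) = 1 := by exact_mod_cast hdet n
    have hq := (hqpos n).ne'
    have hne := psl_coords_ne (hdet n) (u := z) (v := 1) (by simp)
    rw [mul_one, mul_one] at hne
    have e1 : β n * ((q n : ℝ) * (q n * z - p n)) - 1 = q n * (u n * z + v n) := by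
      simp only [β]; field_simp; linear_combination hdetR
    rw [hact, hg, psl_smul_coe, e1, hpt_eq_hpt_iff hne]
    · push_cast; ring
    · refine hne.imp (mul_ne_zero hq) fun h => mul_ne_zero hq ?_
      push_cast at h
      rwa [← sub_eq_add_neg] at h
  refine ⟨fun n => g (ψ n), hpt (b * d - 1) d, (b : OnePoint ℝ), ?_, ?_, ?_⟩
  · rw [← hpt_one b, Ne, hpt_eq_hpt_iff hne1 (by simp)]
    intro h; linarith
  · simp only [hform]
    exact tendsto_hpt ((hb.mul hd).sub_const 1) hd hne1
  · intro z hz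
    induction z using OnePoint.rec with
    | infty =>
      refine ((OnePoint.continuous_coe.tendsto b).comp hb).congr fun n => ?_
      rw [hact, hg, psl_smul_infty, hpt_of_ne (hqpos _).ne']; rfl
    | coe z =>
      have hzx : z ≠ x := fun e => hz (by rw [e])
      let D : ℕ → ℝ := fun n => (q (ψ n) : ℝ) * (q (ψ n) * z - p (ψ n))
      have hDabs : Tendsto (fun n => |D n|) atTop atTop := by
        have h1 : Tendsto (fun n => (q (ψ n) : ℝ) ^ 2 * |z - x| - 1) atTop atTop := by
          refine tendsto_atTop_add_const_right _ _ (Tendsto.atTop_mul_const ?_ ?_)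
          · exact abs_pos.mpr (sub_ne_zero.mpr hzx)
          · exact (tendsto_pow_atTop two_ne_zero).comp hqtop
        refine tendsto_atTop_mono (fun n => ?_) h1
        have e : D n = (q (ψ n) : ℝ) ^ 2 * (z - x) + δ (ψ n) := by simp only [D, δ]; ring
        have h2 : |(q (ψ n) : ℝ) ^ 2 * (z - x)| = (q (ψ n) : ℝ) ^ 2 * |z - x| := by
          rw [abs_mul, abs_of_nonneg (by positivity)]
        have h3 : |(q (ψ n) : ℝ) ^ 2 * (z - x)| ≤ |D n| + |δ (ψ n)| := by
          have : (q (ψ n) : ℝ) ^ 2 * (z - x) = D n - δ (ψ n) := by rw [e]; ring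
          rw [this]; exact abs_sub _ _
        have := hδ (ψ n)
        linarith
      have hDinv : Tendsto (fun n => (D n)⁻¹) atTop (𝓝 0) := by
        rw [tendsto_zero_iff_abs_tendsto_zero]
        refine (tendsto_inv_atTop_zero.comp hDabs).congr fun n => ?_
        simp [abs_inv]
      have hlim := tendsto_hpt (hb.sub hDinv) (tendsto_const_nhds (x := (1 : ℝ)))
        (Or.inr one_ne_zero)
      rw [sub_zero, hpt_one] at hlim
      refine hlim.congr' ?_
      filter_upwards [hDabs.eventually_gt_atTop 0] with n hn
      have hDn : D n ≠ 0 := abs_pos.mp hn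
      rw [hform]
      change _ = hpt (β (ψ n) * D n - 1) (D n)
      rw [hpt_eq_hpt_iff (by simp) (Or.inr hDn)]
      field_simp

include hact in
/-- A finitely generated group embedded in the modular group such that `1` and the generator of the
cusp group meet all cosets of its image has Bowditch boundary `ℝ ∪ {∞}`: rational points are bounded
parabolic and irrational points are conical. -/
theorem isBowditchBoundary_of_hom [Group.FG Γ] (hφ : Function.Injective φ)
    (hT : ∀ g : PSL2Z, g ∈ φ.range ∨ psT * g ∈ φ.range) (Ps : Set (Subgroup Γ))
    (hPs : IsParabolicRepresentatives (OnePoint ℝ) Ps) : IsBowditchBoundary (OnePoint ℝ) Ps := by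
  have hmax := isMaximalParabolic_iff φ hact hφ hT
  -- two rational points are related by the group, so all maximal parabolic subgroups are conjugate
  have hinfty : ∀ k : PSL2Z, ∃ g : Γ,
      g • k • (OnePoint.infty : OnePoint ℝ) = OnePoint.infty := by
    intro k
    rcases hT k⁻¹ with ⟨g, hg⟩ | ⟨g, hg⟩
    · exact ⟨g, by rw [hact, hg, inv_smul_smul]⟩
    · refine ⟨g, ?_⟩
      rw [hact, hg, mul_smul, inv_smul_smul]
      simpa using psT_zpow_smul_infty 1
  have htrans : ∀ k k' : PSL2Z, ∃ g : Γ,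
      g • k • (OnePoint.infty : OnePoint ℝ) = k' • OnePoint.infty := by
    intro k k'
    obtain ⟨g, hg⟩ := hinfty k
    obtain ⟨g', hg'⟩ := hinfty k'
    exact ⟨g'⁻¹ * g, by rw [mul_smul, hg, inv_smul_eq_iff, hg']⟩
  have hconj : ∀ P H : Subgroup Γ, IsMaximalParabolic (OnePoint ℝ) P →
      IsMaximalParabolic (OnePoint ℝ) H → IsConjSubgroup P H := by
    intro P H hP hH
    obtain ⟨k, rfl⟩ := (hmax P).mp hP
    obtain ⟨k', rfl⟩ := (hmax H).mp hH
    obtain ⟨g, hg⟩ := htrans k k'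
    exact ⟨g, by rw [← hg, MulAction.stabilizer_smul_eq_stabilizer_map_conj]⟩
  refine
    { fg := inferInstance
      finite := ?_
      fg_peripheral := fun P hP => ?_
      nonempty := inferInstance
      compact := inferInstance
      metrizable := inferInstance
      perfect := inferInstance
      convergence := isConvergenceAction_of_hom φ hact hφ
      geometricallyFinite := fun x => ?_
      maximalParabolic := fun H => ⟨fun hH => (hPs.2 H hH).exists, ?_⟩ }
  · have : Ps.Subsingleton := fun P hP P' hP' =>
      (hPs.2 P (hPs.1 P hP)).unique ⟨hP, hconj P P (hPs.1 P hP) (hPs.1 P hP)⟩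
        ⟨hP', hconj P' P (hPs.1 P' hP') (hPs.1 P hP)⟩
    exact this.finite
  · obtain ⟨k, rfl⟩ := (hmax P).mp (hPs.1 P hP)
    let f : MulAction.stabilizer Γ (k • (OnePoint.infty : OnePoint ℝ)) →*
        Subgroup.zpowers (k * psT * k⁻¹) :=
      (φ.comp (Subgroup.subtype _)).codRestrict _ fun g => by
        obtain ⟨n, hn⟩ := map_mem_conj_of_mem_stabilizer φ hact g.2
        exact ⟨n, by
          change (k * psT * k⁻¹) ^ n = φ g
          rw [hn, conj_zpow]⟩
    have hf : Function.Injective f := fun g g' h =>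
      Subtype.ext (hφ (congrArg Subtype.val h))
    have : IsCyclic (MulAction.stabilizer Γ (k • (OnePoint.infty : OnePoint ℝ))) :=
      isCyclic_of_injective f hf
    obtain ⟨g, hg⟩ := this.exists_generator
    rw [← Group.fg_iff_subgroup_fg]
    exact Group.fg_iff.mpr ⟨{g}, by
      rw [← Subgroup.zpowers_eq_closure, eq_top_iff]; exact fun x _ => hg x, Set.finite_singleton g⟩
  · rcases rational_or_irrational x with ⟨k, rfl⟩ | ⟨r, hr, rfl⟩
    · exact Or.inr (isBoundedParabolicPoint_smul_infty φ hact hφ hT k)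
    · exact Or.inl (isConicalPoint_of_irrational φ hact hT hr)
  · rintro ⟨P, hP, g, rfl⟩
    obtain ⟨k, rfl⟩ := (hmax P).mp (hPs.1 P hP)
    rw [← MulAction.stabilizer_smul_eq_stabilizer_map_conj, hmax]
    exact ⟨φ g * k, by rw [hact, mul_smul]⟩

end IndexTwo

/-! ### Limits along shrinking arcs -/

/-- Every neighbourhood of a point of the circle contains a translate of the arc `[0, ∞]`. -/
lemma exists_smul_nonnegArc_subset {x : OnePoint ℝ} {U : Set (OnePoint ℝ)} (hU : U ∈ 𝓝 x) :
    ∃ g : PSL2Z, ∀ z ∈ nonnegArc, g • z ∈ U := by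
  have hrat : ∀ (k : PSL2Z) (U : Set (OnePoint ℝ)), U ∈ 𝓝 (k • (OnePoint.infty : OnePoint ℝ)) →
      ∃ g : PSL2Z, ∀ z ∈ nonnegArc, g • z ∈ U := by
    intro k U hU
    obtain ⟨M, -, hM⟩ := exists_abs_le_of_mem_nhds_infty
      ((continuous_psl_smul k).continuousAt.preimage_mem_nhds hU)
    obtain ⟨n, hn⟩ := exists_nat_ge M
    refine ⟨k * psT ^ n, fun z hz => ?_⟩
    rw [mul_smul]
    rcases hz with rfl | ⟨r, hr, rfl⟩
    · rw [← zpow_natCast, psT_zpow_smul_infty]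
      exact mem_of_mem_nhds hU
    · rw [psT_pow_smul_coe]
      have hr : (0 : ℝ) ≤ r := hr
      exact hM _ (by rw [abs_of_nonneg (by positivity)]; linarith)
  rcases rational_or_irrational x with ⟨k, rfl⟩ | ⟨r, -, rfl⟩
  · exact hrat k U hU
  · have hV : IsOpen {a : ℝ | (a : OnePoint ℝ) ∈ interior U} :=
      isOpen_interior.preimage OnePoint.continuous_coe
    obtain ⟨q, hq⟩ := Rat.denseRange_cast.exists_mem_open hV ⟨r, mem_interior_iff_mem_nhds.mpr hU⟩
    obtain ⟨k, hk⟩ := exists_smul_infty_eq_ratCast q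
    exact hrat k U (by rw [hk]; exact mem_interior_iff_mem_nhds.mp hq)

section ArcLimit

variable {F : Type*} {G : Type*} [Group G] [MulAction G F]
  (ρ : PSL2Z →* G) (X : Set F)

variable {ρ X} in
lemma smul_mem_of_smul_nonnegArc (hT : ∀ θ ∈ X, ρ psT • θ ∈ X) (hL : ∀ θ ∈ X, ρ psL • θ ∈ X)
    {g : PSL2Z} (hg : ∀ z ∈ nonnegArc, g • z ∈ nonnegArc) : ∀ ψ ∈ X, ρ g • ψ ∈ X := by
  refine nonnegArc_induction (p := fun g => ∀ ψ ∈ X, ρ g • ψ ∈ X) ?_ ?_ ?_ g hg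
  · intro ψ hψ
    rwa [map_one, one_smul]
  · intro g hg ψ hψ
    rw [map_mul, mul_smul]
    exact hT _ (hg ψ hψ)
  · intro g hg ψ hψ
    rw [map_mul, mul_smul]
    exact hL _ (hg ψ hψ)

variable {ρ X} in
lemma inv_smul_mem_of_smul_nonnegArc (hT : ∀ θ ∈ X, ρ psT • θ ∈ X) (hL : ∀ θ ∈ X, ρ psL • θ ∈ X)
    {k g : PSL2Z} (hg : ∀ z ∈ nonnegArc, k⁻¹ • g • z ∈ nonnegArc) :
    ∀ ψ ∈ X, (ρ k)⁻¹ • ρ g • ψ ∈ X := by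
  intro ψ hψ
  have := smul_mem_of_smul_nonnegArc hT hL (g := k⁻¹ * g)
    (fun z hz => by rw [mul_smul]; exact hg z hz) ψ hψ
  rwa [map_mul, map_inv, mul_smul] at this

variable [TopologicalSpace F]

/-- `ρ(g) X` converges to `θ` as the arc `g [0, ∞]` converges to `x`. -/
def IsArcLimit (x : OnePoint ℝ) (θ : F) : Prop :=
  ∀ V ∈ 𝓝 θ, ∃ U ∈ 𝓝 x, ∀ g : PSL2Z, (∀ z ∈ nonnegArc, g • z ∈ U) → ∀ ψ ∈ X, ρ g • ψ ∈ V

variable {ρ X}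

lemma IsArcLimit.unique [T2Space F] (hX : X.Nonempty) {x : OnePoint ℝ} {θ θ' : F}
    (h : IsArcLimit ρ X x θ) (h' : IsArcLimit ρ X x θ') : θ = θ' := by
  by_contra hne
  obtain ⟨V, V', hV, hV', hd⟩ := t2_separation_nhds hne
  obtain ⟨U, hU, hUV⟩ := h V hV
  obtain ⟨U', hU', hUV'⟩ := h' V' hV'
  obtain ⟨g, hg⟩ := exists_smul_nonnegArc_subset (inter_mem hU hU')
  obtain ⟨ψ, hψ⟩ := hX
  exact hd.notMem_of_mem_left (hUV g (fun z hz => (hg z hz).1) ψ hψ)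
    (hUV' g (fun z hz => (hg z hz).2) ψ hψ)

lemma IsArcLimit.smul [ContinuousConstSMul G F] {x : OnePoint ℝ} {θ : F}
    (h : IsArcLimit ρ X x θ) (k : PSL2Z) : IsArcLimit ρ X (k • x) (ρ k • θ) := by
  intro V hV
  obtain ⟨U, hU, hUV⟩ := h _ ((continuous_const_smul (ρ k)).continuousAt.preimage_mem_nhds hV)
  refine ⟨{z | k⁻¹ • z ∈ U}, (continuous_psl_smul k⁻¹).continuousAt.preimage_mem_nhds
    (by rwa [inv_smul_smul]), fun g hg ψ hψ => ?_⟩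
  have := hUV (k⁻¹ * g) (fun z hz => by rw [mul_smul]; exact hg z hz) ψ hψ
  rwa [Set.mem_preimage, map_mul, ← mul_smul, ← mul_assoc, ← map_mul, mul_inv_cancel, map_one,
    one_mul] at this

/-- Closed sets that capture `ρ(g) X` for all sufficiently small arcs near `x` and have at most one
common point force the existence of an arc limit. -/
lemma exists_isArcLimit [CompactSpace F] (hX : X.Nonempty) {x : OnePoint ℝ}
    (Y : ℕ → Set F) (hYc : ∀ k, IsClosed (Y k)) (hY : ∀ k, ∃ U ∈ 𝓝 x, ∀ g : PSL2Z,
      (∀ z ∈ nonnegArc, g • z ∈ U) → ∀ ψ ∈ X, ρ g • ψ ∈ Y k)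
    (hsub : (⋂ k, Y k).Subsingleton) : ∃ θ, IsArcLimit ρ X x θ := by
  choose U hU hUY using hY
  have hfin : ∀ u : Finset ℕ, (⋂ k ∈ u, U k) ∈ 𝓝 x := fun u =>
    (Filter.biInter_finset_mem u).mpr fun k _ => hU k
  have hne : (Set.univ ∩ ⋂ k, Y k).Nonempty := by
    refine isCompact_univ.inter_iInter_nonempty Y hYc fun u => ?_
    obtain ⟨g, hg⟩ := exists_smul_nonnegArc_subset (hfin u)
    obtain ⟨ψ, hψ⟩ := hX
    exact ⟨ρ g • ψ, trivial, Set.mem_iInter₂.mpr fun k hk =>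
      hUY k g (fun z hz => Set.mem_iInter₂.mp (hg z hz) k hk) ψ hψ⟩
  obtain ⟨θ, -, hθ⟩ := hne
  refine ⟨θ, fun V hV => ?_⟩
  obtain ⟨u, hu⟩ := isOpen_interior.isClosed_compl.isCompact.elim_finite_subfamily_closed Y hYc
    (s := (interior V)ᶜ) (by
      ext ψ
      simp only [Set.mem_inter_iff, Set.mem_empty_iff_false, iff_false, not_and]
      intro h1 h2
      rw [hsub h2 hθ] at h1
      exact h1 (mem_interior_iff_mem_nhds.mpr hV))
  refine ⟨_, hfin u, fun g hg ψ hψ => ?_⟩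
  by_contra hV'
  have : ρ g • ψ ∈ (interior V)ᶜ ∩ ⋂ k ∈ u, Y k :=
    ⟨fun h => hV' (interior_subset h), Set.mem_iInter₂.mpr fun k hk =>
      hUY k g (fun z hz => Set.mem_iInter₂.mp (hg z hz) k hk) ψ hψ⟩
  rw [hu] at this
  exact this

lemma nonnegArc_mem_nhds {r : ℝ} (hr : 0 < r) : nonnegArc ∈ 𝓝 (r : OnePoint ℝ) := by
  have : (fun a : ℝ => (a : OnePoint ℝ)) '' Set.Ioi 0 ∈ 𝓝 (r : OnePoint ℝ) :=
    (OnePoint.isOpenEmbedding_coe.isOpenMap _ isOpen_Ioi).mem_nhds ⟨r, hr, rfl⟩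
  refine mem_of_superset this ?_
  rintro _ ⟨a, ha, rfl⟩
  exact coe_mem_nonnegArc.mpr (le_of_lt ha)

/-- A closed set `X` mapped into itself by the two parabolic generators, and whose translates along
Farey expansions and towards the cusp shrink to points, has arc limits at all boundary points. -/
theorem exists_boundaryMap [CompactSpace F] [ContinuousConstSMul G F] (hX : X.Nonempty)
    (hXc : IsClosed X) (hT : ∀ θ ∈ X, ρ psT • θ ∈ X) (hL : ∀ θ ∈ X, ρ psL • θ ∈ X)
    (hsw : ∀ ε : ℕ → Bool, (∀ N, ∃ n, N ≤ n ∧ ε n ≠ ε (n + 1)) → ∀ θ θ' : F,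
      (∀ n, (ρ (wordProd ε n))⁻¹ • θ ∈ X) → (∀ n, (ρ (wordProd ε n))⁻¹ • θ' ∈ X) → θ = θ')
    (θ₀ : F) (hTθ : ∀ θ, (∀ n : ℕ, (ρ (psT ^ n))⁻¹ • θ ∈ X) → θ = θ₀)
    (hLθ : ∀ θ, (∀ n : ℕ, (ρ (genD * psL ^ n))⁻¹ • θ ∈ X) → θ = θ₀) :
    ∃ ξ : OnePoint ℝ → F, ∀ x, IsArcLimit ρ X x (ξ x) := by
  suffices h : ∀ x, ∃ θ, IsArcLimit ρ X x θ from
    ⟨fun x => (h x).choose, fun x => (h x).choose_spec⟩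
  have hclosed : ∀ k : G, IsClosed {θ | k • θ ∈ X} := fun k =>
    hXc.preimage (continuous_const_smul k)
  intro x
  rcases rational_or_irrational x with ⟨k, rfl⟩ | ⟨r, hr, rfl⟩
  · suffices h : ∃ θ, IsArcLimit ρ X OnePoint.infty θ by
      obtain ⟨θ, hθ⟩ := h
      exact ⟨_, hθ.smul k⟩
    have hmono : ∀ m n : ℕ, m ≤ n → ∀ θ,
        ((ρ (psT ^ n))⁻¹ • θ ∈ X → (ρ (psT ^ m))⁻¹ • θ ∈ X) ∧
        ((ρ (genD * psL ^ n))⁻¹ • θ ∈ X → (ρ (genD * psL ^ m))⁻¹ • θ ∈ X) := by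
      intro m n hmn θ
      induction n, hmn using Nat.le_induction with
      | base => exact ⟨id, id⟩
      | succ n _ ih =>
        refine ⟨fun h => ih.1 ?_, fun h => ih.2 ?_⟩
        · have := hT _ h
          rwa [pow_succ, ← map_inv, ← mul_smul, ← map_mul, mul_inv_rev, mul_inv_cancel_left,
            map_inv] at this
        · have := hL _ h
          rwa [pow_succ, ← map_inv, ← mul_smul, ← map_mul, mul_inv_rev, mul_inv_rev,
            mul_assoc, mul_inv_cancel_left, ← mul_inv_rev, map_inv] at this
    -- small arcs near `∞` lie in `psT ^ n [0, ∞] = [n, ∞]` or in `genD psL ^ n [0, ∞] = [-∞, -n]`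
    refine exists_isArcLimit hX
      (fun n => {θ | (ρ (psT ^ n))⁻¹ • θ ∈ X} ∪ {θ | (ρ (genD * psL ^ n))⁻¹ • θ ∈ X})
      (fun n => (hclosed _).union (hclosed _)) ?_ ?_
    · intro n
      refine ⟨{z | z ≠ ((0 : ℝ) : OnePoint ℝ) ∧ (z ∈ nonnegArc → (psT ^ n)⁻¹ • z ∈ nonnegArc) ∧
        (z ∈ nonposArc → psT ^ n • z ∈ nonposArc)}, ?_, fun g hg => ?_⟩
      · refine mem_nhds_infty_of_abs n ⟨OnePoint.infty_ne_coe 0, fun _ => ?_, fun _ => ?_⟩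
          fun s hs => ⟨fun e => ?_, fun h => ?_, fun h => ?_⟩
        · rw [← zpow_natCast, ← zpow_neg, psT_zpow_smul_infty]
          exact infty_mem_nonnegArc
        · rw [← zpow_natCast, psT_zpow_smul_infty]
          exact Or.inl rfl
        · rw [OnePoint.coe_injective e, abs_zero] at hs
          exact absurd hs (by simp)
        · rw [abs_of_nonneg (coe_mem_nonnegArc.mp h)] at hs
          rw [← zpow_natCast, ← zpow_neg, psT_zpow_smul_coe, coe_mem_nonnegArc]
          push_cast; linarith
        · rw [abs_of_nonpos (coe_mem_nonposArc.mp h)] at hs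
          rw [psT_pow_smul_coe, coe_mem_nonposArc]
          linarith
      · rcases smul_nonnegArc_subset_or (g := g) (fun z hz => (hg z hz).1) with h | h
        · exact fun ψ hψ => Or.inl (inv_smul_mem_of_smul_nonnegArc hT hL
            (fun z hz => (hg z hz).2.1 (h z hz)) ψ hψ)
        · refine fun ψ hψ => Or.inr (inv_smul_mem_of_smul_nonnegArc hT hL ?_ ψ hψ)
          intro z hz
          rw [← psT_inv_pow_mul_genD, mul_inv_rev, inv_inv, genD_inv, mul_smul,
            genD_smul_mem_nonnegArc]
          exact (hg z hz).2.2 (h z hz)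
    · intro θ hθ θ' hθ'
      have key : ∀ θ ∈ ⋂ n : ℕ, ({θ | (ρ (psT ^ n))⁻¹ • θ ∈ X} ∪
          {θ | (ρ (genD * psL ^ n))⁻¹ • θ ∈ X} : Set F), θ = θ₀ := by
        intro θ hθ
        rw [Set.mem_iInter] at hθ
        by_cases h : ∀ n : ℕ, (ρ (psT ^ n))⁻¹ • θ ∈ X
        · exact hTθ θ h
        · push Not at h
          obtain ⟨m, hm⟩ := h
          refine hLθ θ fun n => ?_
          rcases hθ (max m n) with h | h
          · exact absurd ((hmono m _ (le_max_left _ _) θ).1 h) hm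
          · exact (hmono n _ (le_max_right _ _) θ).2 h
      rw [key θ hθ, key θ' hθ']
  · -- translate `r` to a positive number, so that it has a Farey expansion
    obtain ⟨m, hm⟩ := exists_nat_gt (-r)
    have hr' : Irrational (r + m) := hr.add_natCast m
    suffices h : ∃ θ, IsArcLimit ρ X ((r + m : ℝ) : OnePoint ℝ) θ by
      obtain ⟨θ, hθ⟩ := h
      refine ⟨ρ (psT ^ m)⁻¹ • θ, ?_⟩
      have := hθ.smul (psT ^ m)⁻¹
      rwa [← psT_pow_smul_coe, inv_smul_smul] at this
    obtain ⟨ε, hε, hεr⟩ := exists_farey_expansion (by linarith) hr'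
    refine exists_isArcLimit hX (fun n => {θ | (ρ (wordProd ε n))⁻¹ • θ ∈ X})
      (fun n => hclosed _) (fun n => ?_)
      (fun θ hθ θ' hθ' => hsw ε hε θ θ' (Set.mem_iInter.mp hθ) (Set.mem_iInter.mp hθ'))
    obtain ⟨s, hs, -, hsr⟩ := hεr n
    refine ⟨{z | (wordProd ε n)⁻¹ • z ∈ nonnegArc}, ?_, fun g hg =>
      inv_smul_mem_of_smul_nonnegArc hT hL hg⟩
    apply (continuous_psl_smul (wordProd ε n)⁻¹).continuousAt.preimage_mem_nhds
    rw [← hsr, inv_smul_smul]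
    exact nonnegArc_mem_nhds hs

variable {ξ : OnePoint ℝ → F} (hξ : ∀ x, IsArcLimit ρ X x (ξ x))

include hξ in
lemma equivariant_of_isArcLimit [T2Space F] [ContinuousConstSMul G F] (hX : X.Nonempty)
    (g : PSL2Z) (x : OnePoint ℝ) : ξ (g • x) = ρ g • ξ x :=
  (hξ _).unique hX ((hξ x).smul g)

include hξ in
lemma continuous_of_isArcLimit [T2Space F] [CompactSpace F] (hX : X.Nonempty) : Continuous ξ := by
  rw [continuous_iff_continuousAt]
  intro x V hV
  obtain ⟨V', hV', hV'c, hVV'⟩ := exists_mem_nhds_isClosed_subset hV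
  obtain ⟨U, hU, hUV⟩ := hξ x V' hV'
  rw [mem_map]
  refine mem_of_superset (interior_mem_nhds.mpr hU) fun y hy => hVV' ?_
  rw [← hV'c.closure_eq, mem_closure_iff_nhds]
  intro W hW
  obtain ⟨U', hU', hUW⟩ := hξ y W hW
  obtain ⟨g, hg⟩ := exists_smul_nonnegArc_subset
    (inter_mem hU' (mem_interior_iff_mem_nhds.mp hy))
  obtain ⟨ψ, hψ⟩ := hX
  exact ⟨ρ g • ψ, hUW g (fun z hz => (hg z hz).1) ψ hψ, hUV g (fun z hz => (hg z hz).2) ψ hψ⟩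

include hξ in
lemma mem_of_isArcLimit (hX : X.Nonempty) (hXc : IsClosed X) (hT : ∀ θ ∈ X, ρ psT • θ ∈ X)
    (hL : ∀ θ ∈ X, ρ psL • θ ∈ X) {x : OnePoint ℝ} (hx : x ∈ nonnegArc) : ξ x ∈ X := by
  rw [← hXc.closure_eq, mem_closure_iff_nhds]
  intro V hV
  obtain ⟨U, hU, hUV⟩ := hξ x V hV
  obtain ⟨s, hs, hsU⟩ : ∃ s : ℝ, 0 < s ∧ U ∈ 𝓝 (s : OnePoint ℝ) := by
    rcases hx with rfl | ⟨r, hr, rfl⟩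
    · obtain ⟨M, hM0, hM⟩ := exists_abs_le_of_mem_nhds_infty (interior_mem_nhds.mpr hU)
      exact ⟨M, hM0, mem_interior_iff_mem_nhds.mp (hM M (le_abs_self M))⟩
    · have hr : (0 : ℝ) ≤ r := hr
      have h1 := (OnePoint.continuous_coe (X := ℝ)).continuousAt.preimage_mem_nhds
        (interior_mem_nhds.mpr hU)
      obtain ⟨δ, hδ, hball⟩ := Metric.mem_nhds_iff.mp h1
      refine ⟨r + δ / 2, by positivity, mem_interior_iff_mem_nhds.mp (hball ?_)⟩
      rw [Metric.mem_ball, Real.dist_eq, add_sub_cancel_left, abs_of_pos (by positivity)]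
      linarith
  obtain ⟨g, hg⟩ := exists_smul_nonnegArc_subset (inter_mem hsU (nonnegArc_mem_nhds hs))
  obtain ⟨ψ, hψ⟩ := hX
  exact ⟨ρ g • ψ, hUV g (fun z hz => (hg z hz).1) ψ hψ,
    smul_mem_of_smul_nonnegArc hT hL (fun z hz => (hg z hz).2) ψ hψ⟩

include hξ in
/-- Arcs avoiding the repelling point converge to the attracting point. -/
lemma tendsto_smul_of_isArcLimit {γ : ℕ → PSL2Z} {x y : OnePoint ℝ} (h : TendsToAway γ x y)
    {δ : PSL2Z} (hδ : ∀ z ∈ nonnegArc, δ • z ≠ y) {ψ : F} (hψ : ψ ∈ X) :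
    Tendsto (fun n => ρ (γ n) • ρ δ • ψ) atTop (𝓝 (ξ x)) := by
  intro V hV
  obtain ⟨U, hU, hUV⟩ := hξ x V hV
  have := h ((fun z => δ • z) '' nonnegArc)
    (isClosed_nonnegArc.isCompact.image (continuous_psl_smul δ))
    (by rintro ⟨z, hz, e⟩; exact hδ z hz e) U hU
  rw [mem_map]
  filter_upwards [this] with n hn
  have := hUV (γ n * δ) (fun z hz => by rw [mul_smul]; exact hn _ ⟨z, hz, rfl⟩) ψ hψ
  rwa [map_mul, mul_smul] at this

end ArcLimit

/-! ### Nested polyhedral cones -/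

/-- A decreasing sequence of polyhedral cones `{v | 0 ≤ R k v}` shrinks to at most one ray if,
infinitely often, each facet functional of the `k`-th cone is comparable on the `(k+2)`-nd cone,
with uniform constants, to one and the same functional. -/
lemma eq_smul_of_nested_cones {m n : Type*} [Fintype m] [Fintype n] (R : ℕ → Matrix m n ℝ)
    {μ M : ℝ} (hμ : 0 < μ) (h0 : ∀ v, (R 0).mulVec v = 0 → v = 0)
    (hstep : ∀ k v, 0 ≤ (R (k + 1)).mulVec v → 0 ≤ (R k).mulVec v)
    (hsw : ∀ N, ∃ k, N ≤ k ∧ ∀ v, 0 ≤ (R (k + 2)).mulVec v → ∀ i,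
      μ * ∑ j, (R (k + 2)).mulVec v j ≤ (R k).mulVec v i ∧
      (R k).mulVec v i ≤ M * ∑ j, (R (k + 2)).mulVec v j)
    {u u' : n → ℝ} (hu' : u' ≠ 0) (hRu : ∀ k, 0 ≤ (R k).mulVec u)
    (hRu' : ∀ k, 0 ≤ (R k).mulVec u') : ∃ β : ℝ, u = β • u' := by
  have hanti : ∀ j k, j ≤ k → ∀ v, 0 ≤ (R k).mulVec v → 0 ≤ (R j).mulVec v := by
    intro j k hjk
    induction k, hjk using Nat.le_induction with
    | base => exact fun v hv => hv
    | succ k _ ih => exact fun v hv => ih v (hstep k v hv)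
  have hpos0 : ∀ v, v ≠ 0 → 0 ≤ (R 0).mulVec v → ∃ i, 0 < (R 0).mulVec v i := by
    intro v hv hv0
    by_contra! h
    exact hv (h0 v (funext fun i => le_antisymm (h i) (hv0 i)))
  have hM : ∀ v, v ≠ 0 → (∀ k, 0 ≤ (R k).mulVec v) → ∀ k, (∀ i,
      (R k).mulVec v i ≤ M * ∑ j, (R (k + 2)).mulVec v j) →
      0 < ∑ j, (R (k + 2)).mulVec v j ∧ 0 < M := by
    intro v hv hRv k hk
    have hS : 0 ≤ ∑ j, (R (k + 2)).mulVec v j := Finset.sum_nonneg fun j _ => hRv (k + 2) j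
    have hex : ∃ i, 0 < (R k).mulVec v i := by
      by_contra! h
      have hneg : 0 ≤ (R k).mulVec (-v) := by
        intro i
        rw [Matrix.mulVec_neg, Pi.neg_apply]
        simpa using h i
      have h1 := hanti 0 k (Nat.zero_le k) _ hneg
      obtain ⟨i, hi⟩ := hpos0 v hv (hRv 0)
      have := h1 i
      rw [Matrix.mulVec_neg, Pi.neg_apply, Pi.zero_apply] at this
      linarith
    obtain ⟨i, hi⟩ := hex
    have h2 := hi.trans_le (hk i)
    have hS' := hS.lt_of_ne (fun e => by rw [← e, mul_zero] at h2; exact h2.false)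
    exact ⟨hS', pos_of_mul_pos_left h2 hS⟩
  obtain ⟨i₀, hi₀⟩ := hpos0 u' hu' (hRu' 0)
  -- the largest multiple `β u'` that can be subtracted from `u` inside all cones leaves nothing
  let S : Set ℝ := {α | ∀ k, 0 ≤ (R k).mulVec (u - α • u')}
  have hexp : ∀ k (α : ℝ) (v w : n → ℝ) i, (R k).mulVec (v - α • w) i =
      (R k).mulVec v i - α * (R k).mulVec w i := by
    intro k α v w i
    rw [Matrix.mulVec_sub, Matrix.mulVec_smul]; rfl
  have hSne : S.Nonempty := ⟨0, fun k => by simpa using hRu k⟩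
  have hSbdd : BddAbove S := by
    refine ⟨(R 0).mulVec u i₀ / (R 0).mulVec u' i₀, fun α hα => ?_⟩
    rw [le_div_iff₀ hi₀]
    have := hα 0 i₀
    rw [hexp, Pi.zero_apply] at this
    linarith
  have hScl : IsClosed S := by
    simp only [S, Pi.le_def, hexp, Pi.zero_apply, Set.ofPred_forall]
    refine isClosed_iInter fun k => isClosed_iInter fun i => isClosed_le ?_ ?_ <;> fun_prop
  have hβ := hScl.csSup_mem hSne hSbdd
  set β := sSup S
  refine ⟨β, ?_⟩
  by_contra hne
  set w := u - β • u' with hw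
  have hw0 : w ≠ 0 := fun e => hne (sub_eq_zero.mp e)
  have hRw : ∀ k, 0 ≤ (R k).mulVec w := hβ
  obtain ⟨i₁, hi₁⟩ := hpos0 w hw0 (hRw 0)
  -- the ratio of `w` and `u'` is bounded below at level zero, hence uniformly at all levels
  have hcomp : ∀ N, ∃ k, N ≤ k ∧ 0 < (R 0).mulVec u' i₁ ∧
      0 ≤ (R k).mulVec (w - (μ ^ 2 * (R 0).mulVec w i₁ / (M ^ 2 * (R 0).mulVec u' i₁)) • u') := by
    intro N
    obtain ⟨k, hNk, hk⟩ := hsw N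
    obtain ⟨hSw, hM0⟩ := hM w hw0 hRw k fun i => (hk w (hRw _) i).2
    obtain ⟨hSu, -⟩ := hM u' hu' hRu' k fun i => (hk u' (hRu' _) i).2
    set s := ∑ j, (R (k + 2)).mulVec w j
    set s' := ∑ j, (R (k + 2)).mulVec u' j
    have h1 : 0 ≤ (R k).mulVec ((M * s) • u' - (μ * s') • w) := by
      intro i
      rw [hexp, Matrix.mulVec_smul, Pi.smul_apply, smul_eq_mul, Pi.zero_apply]
      have h2 := mul_le_mul_of_nonneg_left (hk u' (hRu' _) i).1 (mul_pos hM0 hSw).le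
      have h3 := mul_le_mul_of_nonneg_left (hk w (hRw _) i).2 (mul_pos hμ hSu).le
      nlinarith
    have h2 := hanti 0 k (Nat.zero_le k) _ h1 i₁
    rw [hexp, Matrix.mulVec_smul, Pi.smul_apply, smul_eq_mul, Pi.zero_apply] at h2
    have hb : 0 < (R 0).mulVec u' i₁ := by
      have : 0 < M * s * (R 0).mulVec u' i₁ := by
        have : 0 < μ * s' * (R 0).mulVec w i₁ := by positivity
        linarith
      exact pos_of_mul_pos_right this (mul_pos hM0 hSw).le
    refine ⟨k, hNk, hb, fun i => ?_⟩
    rw [hexp, Pi.zero_apply, sub_nonneg]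
    refine le_trans ?_ (hk w (hRw _) i).1
    refine (mul_le_mul_of_nonneg_left (hk u' (hRu' _) i).2 (by positivity)).trans ?_
    rw [div_mul_eq_mul_div, div_le_iff₀ (by positivity)]
    have h3 : μ * M * (μ * s' * (R 0).mulVec w i₁) ≤ μ * M * (M * s * (R 0).mulVec u' i₁) :=
      mul_le_mul_of_nonneg_left (by linarith) (by positivity)
    change μ ^ 2 * (R 0).mulVec w i₁ * (M * s') ≤ μ * s * (M ^ 2 * (R 0).mulVec u' i₁)
    linarith
  obtain ⟨k₀, -, hb, -⟩ := hcomp 0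
  have hM0 : M ≠ 0 := by
    obtain ⟨k, -, hk⟩ := hsw 0
    exact (hM w hw0 hRw k fun i => (hk w (hRw _) i).2).2.ne'
  have hc : 0 < μ ^ 2 * (R 0).mulVec w i₁ / (M ^ 2 * (R 0).mulVec u' i₁) := by
    have : 0 < M ^ 2 := by positivity
    positivity
  set c := μ ^ 2 * (R 0).mulVec w i₁ / (M ^ 2 * (R 0).mulVec u' i₁)
  have hmem : β + c ∈ S := by
    intro j
    obtain ⟨k, hjk, -, hk⟩ := hcomp j
    have := hanti j k hjk _ hk
    rwa [hw, sub_sub, ← add_smul] at this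
  linarith [le_csSup hSbdd hmem]

/-- The set of points of the projective space represented by vectors of the cone `0 ≤ R v`. -/
def coneSet {m : Type*} {d : ℕ} (R : Matrix m (Fin d) ℝ) : Set (Pt d) :=
  {x | ∃ (v : Fin d → ℝ) (hv : v ≠ 0), x = Projectivization.mk ℝ v hv ∧ 0 ≤ R.mulVec v}

lemma mk_mem_coneSet {m : Type*} {d : ℕ} {R : Matrix m (Fin d) ℝ} {v : Fin d → ℝ} (hv : v ≠ 0) :
    Projectivization.mk ℝ v hv ∈ coneSet R ↔ 0 ≤ R.mulVec v ∨ 0 ≤ R.mulVec (-v) := by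
  constructor
  · rintro ⟨w, hw, he, h⟩
    obtain ⟨a, rfl⟩ := (Projectivization.mk_eq_mk_iff' ℝ v w hv hw).mp he
    rcases le_total 0 a with ha | ha
    · left
      rw [Matrix.mulVec_smul]
      exact smul_nonneg ha h
    · right
      rw [show -(a • w) = (-a) • w by module, Matrix.mulVec_smul]
      exact smul_nonneg (neg_nonneg.mpr ha) h
  · rintro (h | h)
    · exact ⟨v, hv, rfl, h⟩
    · refine ⟨-v, neg_ne_zero.mpr hv, ?_, h⟩
      rw [Projectivization.mk_eq_mk_iff']
      exact ⟨-1, by simp⟩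

lemma isClosed_coneSet {m : Type*} {d : ℕ} (R : Matrix m (Fin d) ℝ) :
    IsClosed (coneSet R) := by
  rw [← (isQuotientMap_projMk d).isClosed_preimage]
  have : (fun v : {v : Fin d → ℝ // v ≠ 0} => Projectivization.mk ℝ v.1 v.2) ⁻¹' coneSet R =
      {v | 0 ≤ R.mulVec v.1} ∪ {v | 0 ≤ R.mulVec (-v.1)} := by
    ext v
    exact mk_mem_coneSet v.2
  rw [this]
  refine IsClosed.union ?_ ?_
  · exact isClosed_le continuous_const
      (Continuous.matrix_mulVec continuous_const continuous_subtype_val)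
  · exact isClosed_le continuous_const
      (Continuous.matrix_mulVec continuous_const continuous_subtype_val.neg)

/-! ### The standard box: matrices and cones -/

section Standard

variable (κ τ : ℝ)

/-- The projective transformation of order three attached to the standard box. -/
def stdMat : Matrix (Fin 3) (Fin 3) ℝ := !![0, 1 + κ ^ 2, -τ; τ ^ 2, 0, -(κ * τ); τ, κ * τ, 0]

/-- A multiple of the inverse of `stdMat`. -/
def stdAdj : Matrix (Fin 3) (Fin 3) ℝ :=
  !![κ ^ 2 * τ, -(κ * τ), -(κ * (1 + κ ^ 2)); -(κ * τ), τ, -τ ^ 2;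
    κ * τ ^ 2, 1 + κ ^ 2, -(τ * (1 + κ ^ 2))]

lemma stdMat_mul_stdAdj :
    stdMat κ τ * stdAdj κ τ = (-(κ * τ * (1 + κ ^ 2 + τ ^ 2))) • 1 := by
  ext i j
  fin_cases i <;> fin_cases j <;>
    simp [stdMat, stdAdj, Matrix.mul_apply, Fin.sum_univ_succ] <;> ring

lemma stdAdj_mul_stdMat :
    stdAdj κ τ * stdMat κ τ = (-(κ * τ * (1 + κ ^ 2 + τ ^ 2))) • 1 := by
  ext i j
  fin_cases i <;> fin_cases j <;>
    simp [stdMat, stdAdj, Matrix.mul_apply, Fin.sum_univ_succ] <;> ring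

lemma stdMat_mul_stdMat : stdMat κ τ * stdMat κ τ = τ • stdAdj κ τ := by
  ext i j
  fin_cases i <;> fin_cases j <;>
    simp [stdMat, stdAdj, Matrix.mul_apply, Fin.sum_univ_succ] <;> ring

/-- The facet functionals of the cone of points (`true`) and of the cone of lines (`false`) of the
standard box. The cone of points is bounded by the lines `R`, `S`, `P`, `Q` of the box, and the cone
of lines is bounded by its points `s`, `r`, `p`, `q`. -/
def boxCone : Bool → Matrix (Fin 4) (Fin 3) ℝ
  | true => !![1, 0, 0; 0, 1, 0; -(κ * τ), τ, 1 + κ ^ 2; κ, -1, τ]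
  | false => !![κ, -1, τ; -(κ * τ), τ, 1 + κ ^ 2; -1, 0, 0; 0, -1, 0]

/-- The matrix by which the inverse of a parabolic generator maps points to lines (`true`) or lines
to points (`false`). -/
def stepMat : Bool → Bool → Matrix (Fin 3) (Fin 3) ℝ
  | true, true => stdAdj κ τ
  | true, false => (stdMat κ τ).transpose
  | false, true => stdMat κ τ
  | false, false => (stdAdj κ τ).transpose

/-- Nonnegative coefficients expressing the facet functionals of a cone of the standard box, up to a
common positive factor, through those of the image of the other cone under a parabolic generator.
They certify that the image is contained in the cone. -/
def certMat : Bool → Bool → Matrix (Fin 4) (Fin 4) ℝ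
  | true, true =>
    !![(1 + κ ^ 2) * (2 * τ ^ 2 + 1 + κ ^ 2),
      τ * (1 + κ ^ 2),
      κ * (1 + κ ^ 2) * (1 + κ ^ 2 + τ ^ 2),
      (1 + 2 * κ ^ 2) * (1 + κ ^ 2) * (1 + κ ^ 2 + τ ^ 2);
      κ * τ ^ 2 * (1 + κ ^ 2),
      κ * τ * (2 * (1 + κ ^ 2) + τ ^ 2),
      τ ^ 2 * (2 + κ ^ 2) * (1 + κ ^ 2 + τ ^ 2),
      κ * τ ^ 2 * (1 + κ ^ 2 + τ ^ 2);
      0, 0, 2 * τ * (1 + κ ^ 2) * (1 + κ ^ 2 + τ ^ 2) ^ 2, 0;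
      0, 0, 0, 2 * κ * (1 + κ ^ 2) * (1 + κ ^ 2 + τ ^ 2) ^ 2]
  | false, true =>
    !![0, 2 * κ * (1 + κ ^ 2) * (1 + κ ^ 2 + τ ^ 2), 0, 0;
      2 * τ * (1 + κ ^ 2) * (1 + κ ^ 2 + τ ^ 2), 0, 0, 0;
      (1 + κ ^ 2) * (2 * τ ^ 2 + 1 + κ ^ 2) * (1 + κ ^ 2 + τ ^ 2),
      τ * (1 + κ ^ 2) * (1 + κ ^ 2 + τ ^ 2),
      κ * (1 + κ ^ 2) * (1 + κ ^ 2 + τ ^ 2) ^ 2,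
      (1 + 2 * κ ^ 2) * (1 + κ ^ 2) * (1 + κ ^ 2 + τ ^ 2) ^ 2;
      κ ^ 2 * τ * (1 + κ ^ 2) * (1 + κ ^ 2 + τ ^ 2),
      κ ^ 2 * (2 * (1 + κ ^ 2) + τ ^ 2) * (1 + κ ^ 2 + τ ^ 2),
      κ * τ * (2 + κ ^ 2) * (1 + κ ^ 2 + τ ^ 2) ^ 2,
      κ ^ 2 * τ * (1 + κ ^ 2 + τ ^ 2) ^ 2]
  | true, false =>
    !![κ * τ * (1 + κ ^ 2 + τ ^ 2) ^ 2,
      τ * (1 + 2 * κ ^ 2) * (1 + κ ^ 2 + τ ^ 2) ^ 2,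
      (2 * (1 + κ ^ 2) + τ ^ 2) * (1 + κ ^ 2 + τ ^ 2),
      τ * (1 + κ ^ 2) * (1 + κ ^ 2 + τ ^ 2);
      κ * (2 + κ ^ 2) * (1 + κ ^ 2) * (1 + κ ^ 2 + τ ^ 2) ^ 2,
      κ ^ 2 * (1 + κ ^ 2) * (1 + κ ^ 2 + τ ^ 2) ^ 2,
      κ ^ 2 * τ * (1 + κ ^ 2) * (1 + κ ^ 2 + τ ^ 2),
      κ ^ 2 * (2 * τ ^ 2 + 1 + κ ^ 2) * (1 + κ ^ 2) * (1 + κ ^ 2 + τ ^ 2);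
      0, 0, 0, 2 * κ * τ * (1 + κ ^ 2) * (1 + κ ^ 2 + τ ^ 2);
      0, 0, 2 * (1 + κ ^ 2) * (1 + κ ^ 2 + τ ^ 2), 0]
  | false, false =>
    !![2 * (1 + κ ^ 2) * (1 + κ ^ 2 + τ ^ 2) ^ 2, 0, 0, 0;
      0, 2 * κ * τ * (1 + κ ^ 2) * (1 + κ ^ 2 + τ ^ 2) ^ 2, 0, 0;
      κ * τ ^ 2 * (1 + κ ^ 2 + τ ^ 2),
      τ ^ 2 * (1 + 2 * κ ^ 2) * (1 + κ ^ 2 + τ ^ 2),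
      τ * (2 * (1 + κ ^ 2) + τ ^ 2),
      τ ^ 2 * (1 + κ ^ 2);
      (2 + κ ^ 2) * (1 + κ ^ 2) * (1 + κ ^ 2 + τ ^ 2),
      κ * (1 + κ ^ 2) * (1 + κ ^ 2 + τ ^ 2),
      κ * τ * (1 + κ ^ 2),
      κ * (2 * τ ^ 2 + 1 + κ ^ 2) * (1 + κ ^ 2)]

variable {κ τ}

lemma certMat_mul (e c : Bool) :
    certMat κ τ e c * (boxCone κ τ (!c) * stepMat κ τ e c) =
      (2 * κ * τ * (1 + κ ^ 2) * (1 + κ ^ 2 + τ ^ 2) ^ 2) • boxCone κ τ c := by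
  rw [← Matrix.mul_assoc]
  cases e <;> cases c
  · simp only [certMat, boxCone, stepMat, stdAdj, Bool.not_false]
    ext i j
    fin_cases i <;> fin_cases j <;> simp [Matrix.mul_apply, Fin.sum_univ_succ] <;> ring
  · simp only [certMat, boxCone, stepMat, stdMat, Bool.not_true]
    ext i j
    fin_cases i <;> fin_cases j <;> simp [Matrix.mul_apply, Fin.sum_univ_succ] <;> ring
  · simp only [certMat, boxCone, stepMat, stdMat, Bool.not_false]
    ext i j
    fin_cases i <;> fin_cases j <;> simp [Matrix.mul_apply, Fin.sum_univ_succ] <;> ring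
  · simp only [certMat, boxCone, stepMat, stdAdj, Bool.not_true]
    ext i j
    fin_cases i <;> fin_cases j <;> simp [Matrix.mul_apply, Fin.sum_univ_succ] <;> ring

lemma certMat_nonneg (hκ : 0 < κ) (hτ : 0 < τ) (e c : Bool) (i j : Fin 4) :
    0 ≤ certMat κ τ e c i j := by
  cases e <;> cases c <;> fin_cases i <;> fin_cases j <;> simp [certMat] <;> positivity

/-- The image of a cone under a product of two different parabolic generators lies in the interior
of the cone, since the coefficients are positive. -/
lemma certMat_mul_pos (hκ : 0 < κ) (hτ : 0 < τ) (e c : Bool) (i j : Fin 4) :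
    0 < (certMat κ τ e c * certMat κ τ (!e) (!c)) i j := by
  cases e <;> cases c <;> fin_cases i <;> fin_cases j <;>
    simp [certMat, Matrix.mul_apply, Fin.sum_univ_succ] <;> positivity

end Standard

/-! ### The standard representation and its invariant flag box -/

lemma pgl_mk_eq_of_smul {d : ℕ} {g h : GL (Fin d) ℝ} {c : ℝ} (hc : c ≠ 0)
    (e : g.val = c • h.val) :
    (Matrix.ProjGenLinGroup.mk g : PGL(d, ℝ)) = Matrix.ProjGenLinGroup.mk h := by
  symm
  rw [Matrix.ProjGenLinGroup.mk_eq_mk_iff]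
  refine ⟨Units.mk0 c hc, Units.ext ?_⟩
  rw [Units.val_mul, Matrix.GeneralLinearGroup.coe_scalar, e]
  simp [Matrix.scalar_apply, ← Matrix.smul_one_eq_diagonal]

instance : ContinuousConstSMul ProjSym (Pt 3 × Hyp 3) := ⟨fun g => ProjSym.continuous_act g⟩

/-- The point entry (`true`) or the line entry (`false`) of a pair (point, line). -/
def slotOf (c : Bool) (θ : Pt 3 × Hyp 3) : Pt 3 := cond c θ.1 θ.2

section Standard

variable {κ τ : ℝ}

/-- The matrix `stdMat` as an invertible matrix. -/
def stdGL (hκ : 0 < κ) (hτ : 0 < τ) : GL (Fin 3) ℝ where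
  val := stdMat κ τ
  inv := (-(κ * τ * (1 + κ ^ 2 + τ ^ 2)))⁻¹ • stdAdj κ τ
  val_inv := by
    rw [Matrix.mul_smul, stdMat_mul_stdAdj, smul_smul, inv_mul_cancel₀, one_smul]
    exact neg_ne_zero.mpr (by positivity)
  inv_val := by
    rw [Matrix.smul_mul, stdAdj_mul_stdMat, smul_smul, inv_mul_cancel₀, one_smul]
    exact neg_ne_zero.mpr (by positivity)

lemma stdGL_cube (hκ : 0 < κ) (hτ : 0 < τ) :
    (Matrix.ProjGenLinGroup.mk (stdGL hκ hτ) : PGL(3, ℝ)) ^ 3 = 1 := by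
  rw [← map_pow, ← map_one Matrix.ProjGenLinGroup.mk]
  refine pgl_mk_eq_of_smul (c := -(κ * τ ^ 2 * (1 + κ ^ 2 + τ ^ 2)))
    (neg_ne_zero.mpr (by positivity)) ?_
  rw [Units.val_pow_eq_pow_val, pow_succ, sq]
  change stdMat κ τ * stdMat κ τ * stdMat κ τ = _ • (1 : Matrix (Fin 3) (Fin 3) ℝ)
  rw [stdMat_mul_stdMat, Matrix.smul_mul, stdAdj_mul_stdMat, smul_smul]
  congr 1; ring

/-- `ρ` is the standard representation: the element of order three acts by `stdMat` and the element
of order two is the standard polarity. -/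
structure IsStdRep (hκ : 0 < κ) (hτ : 0 < τ) (ρ : PSL2Z →* ProjSym) : Prop where
  genA : ρ genA = ⟨Matrix.ProjGenLinGroup.mk (stdGL hκ hτ), 1⟩
  genD : ρ genD = ⟨1, -1⟩

theorem exists_isStdRep (hκ : 0 < κ) (hτ : 0 < τ) : ∃ ρ, IsStdRep hκ hτ ρ := by
  obtain ⟨ρ, h1, h2⟩ := exists_hom_of_relations
    (⟨Matrix.ProjGenLinGroup.mk (stdGL hκ hτ), 1⟩ : ProjSym) ⟨1, -1⟩ (by
      have : (⟨Matrix.ProjGenLinGroup.mk (stdGL hκ hτ), 1⟩ : ProjSym) =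
        SemidirectProduct.inl (Matrix.ProjGenLinGroup.mk (stdGL hκ hτ)) := rfl
      rw [this, ← map_pow, stdGL_cube, map_one]) (by
      rw [sq]; ext <;> simp)
  exact ⟨ρ, h1, h2⟩

lemma stepMat_mulVec_ne_zero (hκ : 0 < κ) (hτ : 0 < τ) (e c : Bool) {v : Fin 3 → ℝ}
    (hv : v ≠ 0) : (stepMat κ τ e c).mulVec v ≠ 0 := by
  have hK : -(κ * τ * (1 + κ ^ 2 + τ ^ 2)) ≠ 0 := neg_ne_zero.mpr (by positivity)
  have key : ∀ M M' : Matrix (Fin 3) (Fin 3) ℝ,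
      M' * M = (-(κ * τ * (1 + κ ^ 2 + τ ^ 2))) • 1 → M.mulVec v ≠ 0 := by
    intro M M' h h0
    have := congrArg (fun N => N.mulVec v) h
    simp only [← Matrix.mulVec_mulVec, h0, Matrix.mulVec_zero, Matrix.smul_mulVec,
      Matrix.one_mulVec] at this
    exact (smul_ne_zero hK hv) this.symm
  cases e <;> cases c
  · exact key _ (stdMat κ τ).transpose (by
      rw [stepMat, ← Matrix.transpose_mul, stdAdj_mul_stdMat, Matrix.transpose_smul,
        Matrix.transpose_one])
  · exact key _ _ (stdAdj_mul_stdMat κ τ)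
  · exact key _ (stdAdj κ τ).transpose (by
      rw [stepMat, ← Matrix.transpose_mul, stdMat_mul_stdAdj, Matrix.transpose_smul,
        Matrix.transpose_one])
  · exact key _ _ (stdMat_mul_stdAdj κ τ)

variable {hκ : 0 < κ} {hτ : 0 < τ} {ρ : PSL2Z →* ProjSym} (hρ : IsStdRep hκ hτ ρ)

include hρ in
lemma IsStdRep.genD_smul (θ : Pt 3 × Hyp 3) : ρ _root_.genD • θ = (θ.2, θ.1) := by
  rw [ProjSym.smul_def, ProjSym.act_of_right_neg (by rw [hρ.genD]), hρ.genD, one_smul, hypAct_one]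

include hρ in
lemma IsStdRep.genA_smul {v l : Fin 3 → ℝ} (hv : v ≠ 0) (hl : l ≠ 0) :
    ρ _root_.genA • ((Projectivization.mk ℝ v hv, Projectivization.mk ℝ l hl) : Pt 3 × Hyp 3) =
      (Projectivization.mk ℝ _ (stepMat_mulVec_ne_zero hκ hτ false true hv),
        Projectivization.mk ℝ _ (stepMat_mulVec_ne_zero hκ hτ false false hl)) := by
  rw [ProjSym.smul_def, ProjSym.act_of_right_one (by rw [hρ.genA]), hρ.genA]
  refine Prod.ext rfl ?_
  change Projectivization.mk ℝ
    (((-(κ * τ * (1 + κ ^ 2 + τ ^ 2)))⁻¹ • stdAdj κ τ).transpose.mulVec l) _ = _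
  refine (Projectivization.mk_eq_mk_iff' ℝ _ _ _ _).mpr
    ⟨(-(κ * τ * (1 + κ ^ 2 + τ ^ 2)))⁻¹, ?_⟩
  rw [Matrix.transpose_smul, Matrix.smul_mulVec]
  rfl

include hρ in
lemma IsStdRep.genA_inv_smul {v l : Fin 3 → ℝ} (hv : v ≠ 0) (hl : l ≠ 0) :
    (ρ _root_.genA)⁻¹ • ((Projectivization.mk ℝ v hv, Projectivization.mk ℝ l hl) : Pt 3 × Hyp 3) =
      (Projectivization.mk ℝ _ (stepMat_mulVec_ne_zero hκ hτ true true hv),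
        Projectivization.mk ℝ _ (stepMat_mulVec_ne_zero hκ hτ true false hl)) := by
  rw [inv_smul_eq_iff, hρ.genA_smul]
  have hK : -(κ * τ * (1 + κ ^ 2 + τ ^ 2)) ≠ 0 := neg_ne_zero.mpr (by positivity)
  refine Prod.ext ?_ ?_ <;> symm <;> rw [Projectivization.mk_eq_mk_iff'] <;>
    refine ⟨-(κ * τ * (1 + κ ^ 2 + τ ^ 2)), ?_⟩ <;> rw [Matrix.mulVec_mulVec]
  · rw [stepMat, stepMat, stdMat_mul_stdAdj, Matrix.smul_mulVec, Matrix.one_mulVec]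
  · rw [stepMat, stepMat, ← Matrix.transpose_mul, stdMat_mul_stdAdj, Matrix.transpose_smul,
      Matrix.transpose_one, Matrix.smul_mulVec, Matrix.one_mulVec]

include hρ in
/-- The inverse of a parabolic generator is a duality acting by the matrices `stepMat`. -/
lemma IsStdRep.slotOf_letter_inv_smul (e c : Bool) {θ : Pt 3 × Hyp 3} {v : Fin 3 → ℝ} (hv : v ≠ 0)
    (h : slotOf c θ = Projectivization.mk ℝ v hv) :
    slotOf (!c) ((ρ (letter e))⁻¹ • θ) =
      Projectivization.mk ℝ _ (stepMat_mulVec_ne_zero hκ hτ e c hv) := by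
  have hT : (ρ psT)⁻¹ = ρ _root_.genD * (ρ _root_.genA)⁻¹ := by
    rw [← genA_mul_genD, map_mul, mul_inv_rev, ← map_inv ρ _root_.genD, genD_inv]
  have hL : (ρ psL)⁻¹ = ρ _root_.genD * ρ _root_.genA := by
    rw [← map_inv, ← map_mul]
    congr 1
    rw [← genA_sq_mul_genD, mul_inv_rev, genD_inv]
    congr 1
    rw [inv_eq_iff_mul_eq_one, ← pow_succ, genA_cube]
  obtain ⟨x, y⟩ := θ
  induction x using Projectivization.ind with | h x hx => ?_
  induction y using Projectivization.ind with | h y hy => ?_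
  have hstep : (ρ (letter e))⁻¹ • ((Projectivization.mk ℝ x hx, Projectivization.mk ℝ y hy) :
      Pt 3 × Hyp 3) = (Projectivization.mk ℝ _ (stepMat_mulVec_ne_zero hκ hτ e false hy),
        Projectivization.mk ℝ _ (stepMat_mulVec_ne_zero hκ hτ e true hx)) := by
    cases e
    · change (ρ psL)⁻¹ • _ = _
      rw [hL, mul_smul, hρ.genA_smul, hρ.genD_smul]
    · change (ρ psT)⁻¹ • _ = _
      rw [hT, mul_smul, hρ.genA_inv_smul, hρ.genD_smul]
  rw [hstep]
  have key : ∀ w (hw : w ≠ 0), Projectivization.mk ℝ w hw = Projectivization.mk ℝ v hv →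
      Projectivization.mk ℝ _ (stepMat_mulVec_ne_zero hκ hτ e c hw) =
        Projectivization.mk ℝ _ (stepMat_mulVec_ne_zero hκ hτ e c hv) := by
    intro w hw hwv
    obtain ⟨a, ha⟩ := (Projectivization.mk_eq_mk_iff' ℝ _ _ _ _).mp hwv
    rw [Projectivization.mk_eq_mk_iff']
    exact ⟨a, by rw [← ha, Matrix.mulVec_smul]⟩
  cases c
  · exact key y hy h
  · exact key x hx h

variable (κ τ) in
/-- The pairs (point, line) whose entries lie in the cones of the standard box. -/
def flagBox : Set (Pt 3 × Hyp 3) := {θ | ∀ c, slotOf c θ ∈ coneSet (boxCone κ τ c)}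

lemma isClosed_flagBox : IsClosed (flagBox κ τ) := by
  have : flagBox κ τ = Prod.fst ⁻¹' coneSet (boxCone κ τ true) ∩
      Prod.snd ⁻¹' coneSet (boxCone κ τ false) := by
    ext θ
    exact ⟨fun h => ⟨h true, h false⟩, fun h c => by cases c; exacts [h.2, h.1]⟩
  rw [this]
  exact ((isClosed_coneSet _).preimage continuous_fst).inter
    ((isClosed_coneSet _).preimage continuous_snd)

lemma vec3_ne_zero_of_fst {a b : ℝ} : (![1, a, b] : Fin 3 → ℝ) ≠ 0 := fun h => by
  simpa using congrFun h 0

lemma e3_ne_zero : (![0, 0, 1] : Fin 3 → ℝ) ≠ 0 := fun h => by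
  simpa using congrFun h 2

variable (κ) in
/-- The fixed pair (point, line) of the parabolic generator of the standard box. -/
def cuspFlag : Pt 3 × Hyp 3 :=
  (Projectivization.mk ℝ ![1, κ, 0] vec3_ne_zero_of_fst, Projectivization.mk ℝ _ e3_ne_zero)

lemma boxCone_true_nonneg {v : Fin 3 → ℝ} : 0 ≤ (boxCone κ τ true).mulVec v ↔
    0 ≤ v 0 ∧ 0 ≤ v 1 ∧ 0 ≤ -(κ * τ) * v 0 + τ * v 1 + (1 + κ ^ 2) * v 2 ∧
      0 ≤ κ * v 0 - v 1 + τ * v 2 := by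
  simp [Pi.le_def, Fin.forall_fin_succ, boxCone, dotProduct, Fin.sum_univ_succ,
    add_assoc, sub_eq_add_neg]

lemma boxCone_false_nonneg {v : Fin 3 → ℝ} : 0 ≤ (boxCone κ τ false).mulVec v ↔
    0 ≤ κ * v 0 - v 1 + τ * v 2 ∧ 0 ≤ -(κ * τ) * v 0 + τ * v 1 + (1 + κ ^ 2) * v 2 ∧
      v 0 ≤ 0 ∧ v 1 ≤ 0 := by
  simp [Pi.le_def, Fin.forall_fin_succ, boxCone, dotProduct, Fin.sum_univ_succ,
    add_assoc, sub_eq_add_neg]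

/-- Both cones of the standard box lie in a half-space bounded by the last coordinate plane. -/
lemma last_nonneg_of_nonneg (hτ : 0 < τ) {v : Fin 3 → ℝ} (h1 : 0 ≤ κ * v 0 - v 1 + τ * v 2)
    (h2 : 0 ≤ -(κ * τ) * v 0 + τ * v 1 + (1 + κ ^ 2) * v 2) : 0 ≤ v 2 := by
  have h : 0 ≤ (1 + κ ^ 2 + τ ^ 2) * v 2 := by nlinarith
  exact nonneg_of_mul_nonneg_right h (by positivity)

lemma boxCone_injective (c : Bool) {v : Fin 3 → ℝ} (h : (boxCone κ τ c).mulVec v = 0) : v = 0 := by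
  have hK : 1 + κ ^ 2 ≠ 0 := by positivity
  have h0 := congrFun h 0
  have h1 := congrFun h 1
  have h2 := congrFun h 2
  have h3 := congrFun h 3
  cases c <;> simp [boxCone, Matrix.mulVec, dotProduct, Fin.sum_univ_succ] at h0 h1 h2 h3
  · have : v 2 = 0 := by simpa [h2, h3, hK] using h1
    ext i; fin_cases i <;> assumption
  · have : v 2 = 0 := by simpa [h0, h1, hK] using h2
    ext i; fin_cases i <;> assumption

lemma cuspFlag_mem_flagBox (hκ : 0 < κ) (hτ : 0 < τ) : cuspFlag κ ∈ flagBox κ τ := by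
  intro c
  cases c
  · refine (mk_mem_coneSet e3_ne_zero).mpr (Or.inl ?_)
    rw [boxCone_false_nonneg]
    simp [hτ.le]
    positivity
  · refine (mk_mem_coneSet vec3_ne_zero_of_fst).mpr (Or.inl ?_)
    rw [boxCone_true_nonneg]
    simp [hκ.le]
    linarith

lemma boxConstant_pos (hκ : 0 < κ) (hτ : 0 < τ) :
    0 < 2 * κ * τ * (1 + κ ^ 2) * (1 + κ ^ 2 + τ ^ 2) ^ 2 := by positivity

lemma boxCone_mulVec_eq (e c : Bool) (v : Fin 3 → ℝ) :
    (2 * κ * τ * (1 + κ ^ 2) * (1 + κ ^ 2 + τ ^ 2) ^ 2) • (boxCone κ τ c).mulVec v =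
      (certMat κ τ e c).mulVec ((boxCone κ τ (!c)).mulVec ((stepMat κ τ e c).mulVec v)) := by
  rw [Matrix.mulVec_mulVec, Matrix.mulVec_mulVec, Matrix.mul_assoc, certMat_mul,
    Matrix.smul_mulVec]

lemma boxCone_nonneg_of_step (hκ : 0 < κ) (hτ : 0 < τ) (e c : Bool) {v : Fin 3 → ℝ}
    (h : 0 ≤ (boxCone κ τ (!c)).mulVec ((stepMat κ τ e c).mulVec v)) :
    0 ≤ (boxCone κ τ c).mulVec v := by
  have h1 : 0 ≤ (2 * κ * τ * (1 + κ ^ 2) * (1 + κ ^ 2 + τ ^ 2) ^ 2) •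
      (boxCone κ τ c).mulVec v := by
    rw [boxCone_mulVec_eq e]
    intro i
    rw [Matrix.mulVec, dotProduct]
    exact Finset.sum_nonneg fun j _ => mul_nonneg (certMat_nonneg hκ hτ e c i j) (h j)
  intro i
  exact nonneg_of_mul_nonneg_right (h1 i) (boxConstant_pos hκ hτ)

include hρ in
/-- The parabolic generators map the flag box into itself. -/
lemma IsStdRep.letter_smul_mem (e : Bool) : ∀ θ ∈ flagBox κ τ, ρ (letter e) • θ ∈ flagBox κ τ := by
  intro θ hθ c
  obtain ⟨v, hv, hcv⟩ : ∃ v hv, slotOf c (ρ (letter e) • θ) = Projectivization.mk ℝ v hv :=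
    ⟨_, Projectivization.rep_nonzero _, (Projectivization.mk_rep _).symm⟩
  have h := hρ.slotOf_letter_inv_smul e c hv hcv
  rw [inv_smul_smul] at h
  have h' := hθ (!c)
  rw [h, mk_mem_coneSet] at h'
  rw [hcv, mk_mem_coneSet]
  refine h'.imp (boxCone_nonneg_of_step hκ hτ e c) fun h' =>
    boxCone_nonneg_of_step hκ hτ e c ?_
  rwa [Matrix.mulVec_neg]

/-- The slot reached from the slot `c` after `n` dualities. -/
def slotIter (c : Bool) : ℕ → Bool
  | 0 => c
  | n + 1 => !slotIter c n

variable (κ τ) in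
/-- The matrix of the inverse of a prefix of a word in the parabolic generators. -/
def prodMat (ε : ℕ → Bool) (c : Bool) : ℕ → Matrix (Fin 3) (Fin 3) ℝ
  | 0 => 1
  | n + 1 => stepMat κ τ (ε n) (slotIter c n) * prodMat ε c n

include hρ in
lemma IsStdRep.slotOf_wordProd_inv_smul (ε : ℕ → Bool) (c : Bool) {θ : Pt 3 × Hyp 3}
    {v : Fin 3 → ℝ} (hv : v ≠ 0) (h : slotOf c θ = Projectivization.mk ℝ v hv) (n : ℕ) :
    ∃ hn : (prodMat κ τ ε c n).mulVec v ≠ 0,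
      slotOf (slotIter c n) ((ρ (wordProd ε n))⁻¹ • θ) = Projectivization.mk ℝ _ hn := by
  induction n with
  | zero =>
    have e : (prodMat κ τ ε c 0).mulVec v = v := by rw [prodMat, Matrix.one_mulVec]
    refine ⟨by rwa [e], ?_⟩
    simp only [e, wordProd, map_one, inv_one, one_smul]
    exact h
  | succ n ih =>
    obtain ⟨hn, ih⟩ := ih
    have h1 := hρ.slotOf_letter_inv_smul (ε n) _ hn ih
    have e : (prodMat κ τ ε c (n + 1)).mulVec v =
        (stepMat κ τ (ε n) (slotIter c n)).mulVec ((prodMat κ τ ε c n).mulVec v) := by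
      rw [prodMat, Matrix.mulVec_mulVec]
    refine ⟨by rw [e]; exact stepMat_mulVec_ne_zero hκ hτ _ _ hn, ?_⟩
    simp only [e, wordProd, map_mul, mul_inv_rev, mul_smul]
    exact h1

lemma exists_certMat_bounds (hκ : 0 < κ) (hτ : 0 < τ) : ∃ μ M : ℝ, 0 < μ ∧ ∀ e c i j,
    μ ≤ (certMat κ τ e c * certMat κ τ (!e) (!c)) i j ∧
    (certMat κ τ e c * certMat κ τ (!e) (!c)) i j ≤ M := by
  let f : Bool × Bool × Fin 4 × Fin 4 → ℝ := fun x =>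
    (certMat κ τ x.1 x.2.1 * certMat κ τ (!x.1) (!x.2.1)) x.2.2.1 x.2.2.2
  obtain ⟨x, hx⟩ := Finite.exists_min f
  obtain ⟨y, hy⟩ := Finite.exists_max f
  exact ⟨f x, f y, certMat_mul_pos hκ hτ _ _ _ _, fun e c i j => ⟨hx (e, c, i, j), hy (e, c, i, j)⟩⟩

/-- After a switch of letters the cone is mapped strictly into the interior of the cone. -/
lemma boxCone_switch (hκ : 0 < κ) (hτ : 0 < τ) : ∃ μ M : ℝ, 0 < μ ∧ ∀ (e c : Bool)
    (v : Fin 3 → ℝ),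
    0 ≤ (boxCone κ τ c).mulVec ((stepMat κ τ (!e) (!c)).mulVec ((stepMat κ τ e c).mulVec v)) →
    ∀ i, μ * ∑ j, (boxCone κ τ c).mulVec
        ((stepMat κ τ (!e) (!c)).mulVec ((stepMat κ τ e c).mulVec v)) j ≤
          (boxCone κ τ c).mulVec v i ∧
      (boxCone κ τ c).mulVec v i ≤ M * ∑ j, (boxCone κ τ c).mulVec
        ((stepMat κ τ (!e) (!c)).mulVec ((stepMat κ τ e c).mulVec v)) j := by
  obtain ⟨μ, M, hμ, hb⟩ := exists_certMat_bounds hκ hτ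
  have hK := boxConstant_pos hκ hτ
  set K := 2 * κ * τ * (1 + κ ^ 2) * (1 + κ ^ 2 + τ ^ 2) ^ 2
  refine ⟨μ / K ^ 2, M / K ^ 2, by positivity, fun e c v h i => ?_⟩
  set w := (stepMat κ τ (!e) (!c)).mulVec ((stepMat κ τ e c).mulVec v) with hw
  have h1 : K ^ 2 * (boxCone κ τ c).mulVec v i =
      ∑ j, (certMat κ τ e c * certMat κ τ (!e) (!c)) i j * (boxCone κ τ c).mulVec w j := by
    have e1 := boxCone_mulVec_eq (κ := κ) (τ := τ) e c v
    have e2 := boxCone_mulVec_eq (κ := κ) (τ := τ) (!e) (!c) ((stepMat κ τ e c).mulVec v)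
    rw [Bool.not_not] at e2
    have e3 : K ^ 2 • (boxCone κ τ c).mulVec v =
        (certMat κ τ e c * certMat κ τ (!e) (!c)).mulVec ((boxCone κ τ c).mulVec w) := by
      rw [← Matrix.mulVec_mulVec, hw, ← e2, Matrix.mulVec_smul, ← e1, smul_smul, sq]
    exact congrFun e3 i
  rw [div_mul_eq_mul_div, div_mul_eq_mul_div, div_le_iff₀ (by positivity),
    le_div_iff₀ (by positivity), mul_comm _ (K ^ 2), h1, Finset.mul_sum, Finset.mul_sum]
  exact ⟨Finset.sum_le_sum fun j _ => mul_le_mul_of_nonneg_right (hb e c i j).1 (h j),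
    Finset.sum_le_sum fun j _ => mul_le_mul_of_nonneg_right (hb e c i j).2 (h j)⟩

lemma prodMat_boxCone_nonneg_of_le (hκ : 0 < κ) (hτ : 0 < τ) (ε : ℕ → Bool) (c : Bool) (k : ℕ)
    (v : Fin 3 → ℝ)
    (h : 0 ≤ (boxCone κ τ (slotIter c (k + 1)) * prodMat κ τ ε c (k + 1)).mulVec v) :
    0 ≤ (boxCone κ τ (slotIter c k) * prodMat κ τ ε c k).mulVec v := by
  rw [← Matrix.mulVec_mulVec] at h ⊢
  refine boxCone_nonneg_of_step hκ hτ (ε k) _ ?_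
  rwa [prodMat, ← Matrix.mulVec_mulVec] at h

include hρ in
/-- A pair (point, line) that stays in the flag box along a word is represented by vectors
that stay in the cones with a constant sign. -/
lemma IsStdRep.exists_vec_nonneg {ε : ℕ → Bool} {θ : Pt 3 × Hyp 3}
    (h : ∀ n, (ρ (wordProd ε n))⁻¹ • θ ∈ flagBox κ τ) (c : Bool) :
    ∃ v, ∃ hv : v ≠ 0, slotOf c θ = Projectivization.mk ℝ v hv ∧
      ∀ n, 0 ≤ (boxCone κ τ (slotIter c n) * prodMat κ τ ε c n).mulVec v := by
  have hanti : ∀ n v, 0 ≤ (boxCone κ τ (slotIter c n) * prodMat κ τ ε c n).mulVec v →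
      0 ≤ (boxCone κ τ c).mulVec v := by
    intro n v
    induction n with
    | zero => rw [prodMat, Matrix.mul_one]; exact id
    | succ n ih => exact fun h => ih (prodMat_boxCone_nonneg_of_le hκ hτ ε c n v h)
  obtain ⟨v, hv, hcv, hpos⟩ : slotOf c θ ∈ coneSet (boxCone κ τ c) := by
    have := h 0 c
    rwa [wordProd, map_one, inv_one, one_smul] at this
  refine ⟨v, hv, hcv, fun n => ?_⟩
  obtain ⟨hn, e⟩ := hρ.slotOf_wordProd_inv_smul ε c hv hcv n
  have h1 := h n (slotIter c n)
  rw [e, mk_mem_coneSet, Matrix.mulVec_mulVec, ← Matrix.mulVec_neg, Matrix.mulVec_mulVec] at h1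
  rcases h1 with h1 | h1
  · exact h1
  · exfalso
    have h2 := hanti n _ h1
    rw [Matrix.mulVec_neg, Left.nonneg_neg_iff] at h2
    exact hv (boxCone_injective c (le_antisymm h2 hpos))

include hρ in
/-- Along words that switch letters infinitely often the flag boxes shrink to a point. -/
lemma IsStdRep.eq_of_forall_mem {ε : ℕ → Bool} (hε : ∀ N, ∃ n, N ≤ n ∧ ε n ≠ ε (n + 1))
    (θ θ' : Pt 3 × Hyp 3) (h : ∀ n, (ρ (wordProd ε n))⁻¹ • θ ∈ flagBox κ τ)
    (h' : ∀ n, (ρ (wordProd ε n))⁻¹ • θ' ∈ flagBox κ τ) : θ = θ' := by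
  have key : ∀ c, slotOf c θ = slotOf c θ' := by
    intro c
    obtain ⟨v, hv, e, hn⟩ := hρ.exists_vec_nonneg h c
    obtain ⟨v', hv', e', hn'⟩ := hρ.exists_vec_nonneg h' c
    obtain ⟨μ, M, hμ, hsw⟩ := boxCone_switch hκ hτ
    obtain ⟨β, hβ⟩ := eq_smul_of_nested_cones
      (fun n => boxCone κ τ (slotIter c n) * prodMat κ τ ε c n) hμ (M := M)
      (fun v hv => boxCone_injective c (by simpa [prodMat, slotIter] using hv))
      (prodMat_boxCone_nonneg_of_le hκ hτ ε c) (fun N => by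
        obtain ⟨k, hk, hne⟩ := hε N
        refine ⟨k, hk, fun v h0 => ?_⟩
        have hek : ε (k + 1) = !ε k := Bool.eq_not.mpr (Ne.symm hne)
        have e2 : (boxCone κ τ (slotIter c (k + 2)) * prodMat κ τ ε c (k + 2)).mulVec v =
            (boxCone κ τ (slotIter c k)).mulVec ((stepMat κ τ (!ε k) (!slotIter c k)).mulVec
              ((stepMat κ τ (ε k) (slotIter c k)).mulVec ((prodMat κ τ ε c k).mulVec v))) := by
          rw [prodMat, prodMat, hek, slotIter, slotIter, Bool.not_not]
          simp only [Matrix.mulVec_mulVec]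
        have e0 : (boxCone κ τ (slotIter c k) * prodMat κ τ ε c k).mulVec v =
            (boxCone κ τ (slotIter c k)).mulVec ((prodMat κ τ ε c k).mulVec v) := by
          rw [Matrix.mulVec_mulVec]
        simp only [e2, e0] at h0 ⊢
        exact hsw _ _ _ h0) hv' hn hn'
    rw [e, e', Projectivization.mk_eq_mk_iff']
    exact ⟨β, hβ.symm⟩
  exact Prod.ext (key true) (key false)

end Standard

section Standard

variable {κ τ : ℝ} {hκ : 0 < κ} {hτ : 0 < τ} {ρ : PSL2Z →* ProjSym}

/-! ### The cusp of the standard box -/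

variable (κ) in
/-- The shears fixing the cusp flag of the standard box. -/
def cuspShear (a : ℝ) : Matrix (Fin 3) (Fin 3) ℝ := !![1, 0, a; 0, 1, κ * a; 0, 0, 1]

lemma cuspShear_mul (a b : ℝ) : cuspShear κ a * cuspShear κ b = cuspShear κ (a + b) := by
  ext i j
  fin_cases i <;> fin_cases j <;>
    simp [cuspShear, Matrix.mul_apply, Fin.sum_univ_succ] <;> ring

lemma cuspShear_zero : cuspShear κ 0 = 1 := by
  ext i j
  fin_cases i <;> fin_cases j <;> simp [cuspShear]

lemma stdMat_transpose_mul_stdAdj_sq (hκ : κ ≠ 0) (hτ : τ ≠ 0) :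
    (stdMat κ τ).transpose * stdAdj κ τ * ((stdMat κ τ).transpose * stdAdj κ τ) =
      (κ * τ * (1 + κ ^ 2 + τ ^ 2)) ^ 2 • cuspShear κ (-((1 + κ ^ 2 + τ ^ 2) / (κ * τ))) := by
  have h : (stdMat κ τ).transpose * stdAdj κ τ = (1 + κ ^ 2 + τ ^ 2) •
      !![0, τ, -τ ^ 2; κ ^ 2 * τ, 0, -(κ * (1 + κ ^ 2)); 0, 0, κ * τ] := by
    ext i j
    fin_cases i <;> fin_cases j <;>
      simp [stdMat, stdAdj, Matrix.mul_apply, Fin.sum_univ_succ] <;> ring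
  rw [h, Matrix.smul_mul, Matrix.mul_smul, smul_smul]
  ext i j
  fin_cases i <;> fin_cases j <;>
    simp [cuspShear] <;> field_simp <;> ring

lemma stdAdj_mul_stdMat_transpose_sq (hκ : κ ≠ 0) (hτ : τ ≠ 0) :
    stdAdj κ τ * (stdMat κ τ).transpose * (stdAdj κ τ * (stdMat κ τ).transpose) =
      (κ * τ * (1 + κ ^ 2 + τ ^ 2)) ^ 2 •
        (cuspShear κ ((1 + κ ^ 2 + τ ^ 2) / (κ * τ))).transpose := by
  have h : stdAdj κ τ * (stdMat κ τ).transpose = (1 + κ ^ 2 + τ ^ 2) •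
      !![0, κ ^ 2 * τ, 0; τ, 0, 0; 1 + κ ^ 2, κ * τ ^ 2, κ * τ] := by
    ext i j
    fin_cases i <;> fin_cases j <;>
      simp [stdMat, stdAdj, Matrix.mul_apply, Fin.sum_univ_succ] <;> ring
  rw [h, Matrix.smul_mul, Matrix.mul_smul, smul_smul]
  ext i j
  fin_cases i <;> fin_cases j <;>
    simp [cuspShear] <;> field_simp <;> ring

variable (κ) in
/-- The shears by which the fourth powers of the inverses of the parabolic generators act. -/
def slotShear (e c : Bool) (a : ℝ) : Matrix (Fin 3) (Fin 3) ℝ :=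
  cond e (cond c (cuspShear κ (-a)) (cuspShear κ a).transpose)
    (cond c (cuspShear κ (-a)).transpose (cuspShear κ a))

lemma slotShear_mul (e c : Bool) (a b : ℝ) :
    slotShear κ e c a * slotShear κ e c b = slotShear κ e c (a + b) := by
  cases e <;> cases c <;>
    simp only [slotShear, cond_true, cond_false, ← Matrix.transpose_mul, cuspShear_mul] <;>
    congr 1 <;> ring_nf

/-- The fourth power is the least one that is unipotent: odd powers are dualities, and the square of
a parabolic generator has an eigenvalue `-1`. -/
lemma stepMat_pow_four (hκ : κ ≠ 0) (hτ : τ ≠ 0) (e c : Bool) :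
    stepMat κ τ e (!c) * stepMat κ τ e c * (stepMat κ τ e (!c) * stepMat κ τ e c) =
      (κ * τ * (1 + κ ^ 2 + τ ^ 2)) ^ 2 • slotShear κ e c ((1 + κ ^ 2 + τ ^ 2) / (κ * τ)) := by
  have h1 := stdMat_transpose_mul_stdAdj_sq hκ hτ
  have h2 := stdAdj_mul_stdMat_transpose_sq hκ hτ
  have h1' := congrArg Matrix.transpose h1
  have h2' := congrArg Matrix.transpose h2
  simp only [Matrix.transpose_mul, Matrix.transpose_transpose, Matrix.transpose_smul] at h1' h2'
  cases e <;> cases c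
  · exact h2'
  · exact h1'
  · exact h2
  · exact h1

lemma slotIter_four_mul (c : Bool) (n : ℕ) : slotIter c (4 * n) = c := by
  induction n with
  | zero => rfl
  | succ n ih =>
    rw [show 4 * (n + 1) = 4 * n + 1 + 1 + 1 + 1 by ring]
    simp [slotIter, ih]

lemma prodMat_const_four_mul (hκ : κ ≠ 0) (hτ : τ ≠ 0) (e c : Bool) (n : ℕ) :
    prodMat κ τ (fun _ => e) c (4 * n) = ((κ * τ * (1 + κ ^ 2 + τ ^ 2)) ^ 2) ^ n •
      slotShear κ e c (n * ((1 + κ ^ 2 + τ ^ 2) / (κ * τ))) := by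
  induction n with
  | zero =>
    cases e <;> cases c <;> simp [prodMat, slotShear, cuspShear_zero]
  | succ n ih =>
    rw [show 4 * (n + 1) = 4 * n + 1 + 1 + 1 + 1 by ring]
    simp only [prodMat, slotIter, slotIter_four_mul, Bool.not_not]
    rw [ih, ← Matrix.mul_assoc, ← Matrix.mul_assoc, ← Matrix.mul_assoc, Matrix.mul_assoc
      (stepMat κ τ e (!c) * stepMat κ τ e c), stepMat_pow_four hκ hτ, Matrix.smul_mul,
      Matrix.mul_smul, slotShear_mul, smul_smul, pow_succ]
    congr 1
    · ring
    · congr 1; push_cast; ring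

lemma nonpos_of_forall_nat_mul_le {x y : ℝ} (h : ∀ n : ℕ, n * x ≤ y) : x ≤ 0 := by
  by_contra! hx
  obtain ⟨n, hn⟩ := exists_nat_gt (y / x)
  rw [div_lt_iff₀ hx] at hn
  linarith [h n]

/-- The only vectors that stay in the cones of the standard box under all the shears are those of
the cusp flag. -/
lemma eq_smul_of_forall_slotShear (hκ : 0 < κ) (hτ : 0 < τ) (e c : Bool) {v : Fin 3 → ℝ}
    (h : ∀ n : ℕ, 0 ≤ (boxCone κ τ c).mulVec
      ((slotShear κ e c (n * ((1 + κ ^ 2 + τ ^ 2) / (κ * τ)))).mulVec v)) :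
    v = if e = c then v 0 • ![1, κ, 0] else v 2 • ![0, 0, 1] := by
  have hb : 0 < (1 + κ ^ 2 + τ ^ 2) / (κ * τ) := by positivity
  set b := (1 + κ ^ 2 + τ ^ 2) / (κ * τ)
  have hS : ∀ a, (cuspShear κ a).mulVec v = ![v 0 + a * v 2, v 1 + κ * a * v 2, v 2] := by
    intro a
    ext i; fin_cases i <;> simp [cuspShear, Matrix.mulVec, dotProduct, Fin.sum_univ_succ]
  have hSt : ∀ a, (cuspShear κ a).transpose.mulVec v = ![v 0, v 1, v 2 + a * (v 0 + κ * v 1)] := by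
    intro a
    ext i; fin_cases i <;> simp [cuspShear, Matrix.mulVec, dotProduct, Fin.sum_univ_succ]
    ring
  cases e <;> cases c <;> simp only [slotShear, cond_true, cond_false, hS, hSt,
    boxCone_true_nonneg, boxCone_false_nonneg] at h <;> simp at h
  · have h0 := h 0
    simp at h0
    have h2 := last_nonneg_of_nonneg hτ h0.1 (by linarith [h0.2.1])
    have h3 : b * v 2 ≤ 0 := nonpos_of_forall_nat_mul_le (y := -v 0) fun n => by
      linarith [(h n).2.2.1]
    have h4 : v 2 = 0 := le_antisymm (nonpos_of_mul_nonpos_right h3 hb) h2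
    rw [h4] at h0
    have h5 : v 1 = κ * v 0 := by nlinarith
    ext i; fin_cases i <;> simp [h4, h5, mul_comm]
  · have h0 := h 0
    simp at h0
    have h3 : b * (v 0 + κ * v 1) ≤ 0 := nonpos_of_forall_nat_mul_le (y := v 2) fun n => by
      have := last_nonneg_of_nonneg (v := ![v 0, v 1, v 2 + -(n * b * (v 0 + κ * v 1))]) hτ
        (by simpa using (h n).2.2.2) (by simpa using (h n).2.2.1)
      simp at this
      linarith
    have h4 := nonpos_of_mul_nonpos_right h3 hb
    have h5 : 0 ≤ κ * v 1 := mul_nonneg hκ.le h0.2.1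
    have h6 : v 0 = 0 := by linarith
    have h7 : v 1 = 0 := by
      have : κ * v 1 = 0 := by linarith
      simpa [hκ.ne'] using this
    ext i; fin_cases i <;> simp [h6, h7]
  · have h0 := h 0
    simp at h0
    have h3 : b * -(v 0 + κ * v 1) ≤ 0 := nonpos_of_forall_nat_mul_le (y := v 2) fun n => by
      have := last_nonneg_of_nonneg (v := ![v 0, v 1, v 2 + n * b * (v 0 + κ * v 1)]) hτ
        (by simpa using (h n).1) (by simpa using (h n).2.1)
      simp at this
      linarith
    have h4 := nonpos_of_mul_nonpos_right h3 hb
    have h5 : κ * v 1 ≤ 0 := mul_nonpos_of_nonneg_of_nonpos hκ.le h0.2.2.2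
    have h6 : v 0 = 0 := by linarith
    have h7 : v 1 = 0 := by
      have : κ * v 1 = 0 := by linarith
      simpa [hκ.ne'] using this
    ext i; fin_cases i <;> simp [h6, h7]
  · have h0 := h 0
    simp at h0
    have h2 := last_nonneg_of_nonneg hτ h0.2.2.2 (by linarith [h0.2.2.1])
    have h3 : b * v 2 ≤ 0 := nonpos_of_forall_nat_mul_le (y := v 0) fun n => by
      linarith [(h n).1]
    have h4 : v 2 = 0 := le_antisymm (nonpos_of_mul_nonpos_right h3 hb) h2
    rw [h4] at h0
    have h5 : v 1 = κ * v 0 := by nlinarith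
    ext i; fin_cases i <;> simp [h4, h5, mul_comm]

variable (hρ : IsStdRep hκ hτ ρ)

lemma wordProd_const (e : Bool) (n : ℕ) : wordProd (fun _ => e) n = letter e ^ n := by
  induction n with
  | zero => rw [wordProd, pow_zero]
  | succ n ih => rw [wordProd, ih, pow_succ]

include hρ in
/-- Along the powers of a parabolic generator the flag boxes shrink to its fixed flag, which is the
cusp flag for `psT` and the cusp flag with its entries exchanged for `psL`. -/
lemma IsStdRep.slotOf_eq_of_forall_letter_pow {e : Bool} {θ : Pt 3 × Hyp 3}
    (h : ∀ n, (ρ (letter e ^ n))⁻¹ • θ ∈ flagBox κ τ) (c : Bool) :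
    slotOf c θ = slotOf (c == e) (cuspFlag κ) := by
  simp only [← wordProd_const] at h
  obtain ⟨v, hv, hcv, hn⟩ := hρ.exists_vec_nonneg h c
  have hK : 0 < (κ * τ * (1 + κ ^ 2 + τ ^ 2)) ^ 2 := by positivity
  have hdir := eq_smul_of_forall_slotShear hκ hτ e c (v := v) fun n i => by
    have := hn (4 * n) i
    rw [← Matrix.mulVec_mulVec, slotIter_four_mul, prodMat_const_four_mul hκ.ne' hτ.ne',
      Matrix.smul_mulVec, Matrix.mulVec_smul] at this
    exact nonneg_of_mul_nonneg_right this (pow_pos hK n)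
  rw [hcv]
  by_cases hec : e = c
  · rw [if_pos hec] at hdir
    rw [hec, beq_self_eq_true]
    exact (Projectivization.mk_eq_mk_iff' ℝ _ _ _ _).mpr ⟨_, hdir.symm⟩
  · rw [if_neg hec] at hdir
    rw [show (c == e) = false by simpa using Ne.symm hec]
    exact (Projectivization.mk_eq_mk_iff' ℝ _ _ _ _).mpr ⟨_, hdir.symm⟩

/-! ### The boundary map of the standard representation -/

include hρ in
theorem IsStdRep.exists_isArcLimit :
    ∃ ξ : OnePoint ℝ → Pt 3 × Hyp 3, ∀ x, IsArcLimit ρ (flagBox κ τ) x (ξ x) := by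
  refine exists_boundaryMap ⟨_, cuspFlag_mem_flagBox hκ hτ⟩ isClosed_flagBox
    (hρ.letter_smul_mem true) (hρ.letter_smul_mem false) (fun ε hε => hρ.eq_of_forall_mem hε)
    (cuspFlag κ) (fun θ h => ?_) (fun θ h => ?_)
  · exact Prod.ext (hρ.slotOf_eq_of_forall_letter_pow (e := true) h true)
      (hρ.slotOf_eq_of_forall_letter_pow (e := true) h false)
  · have h' : ∀ n, (ρ (letter false ^ n))⁻¹ • ρ _root_.genD • θ ∈ flagBox κ τ := by
      intro n
      have := h n
      rwa [map_mul, mul_inv_rev, mul_smul, ← map_inv ρ _root_.genD, genD_inv] at this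
    have h1 := hρ.slotOf_eq_of_forall_letter_pow h' true
    have h2 := hρ.slotOf_eq_of_forall_letter_pow h' false
    rw [hρ.genD_smul] at h1 h2
    exact Prod.ext h2 h1

end Standard

/-! ### Transversality -/

/-- Two pairs (point, line) are opposite if neither point lies on the line of the other pair. -/
def IsOpposite (θ θ' : Pt 3 × Hyp 3) : Prop := ¬ Incident θ.1 θ'.2 ∧ ¬ Incident θ'.1 θ.2

lemma IsOpposite.symm {θ θ' : Pt 3 × Hyp 3} (h : IsOpposite θ θ') : IsOpposite θ' θ := ⟨h.2, h.1⟩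

lemma opposite_smul_iff (g : ProjSym) {θ θ' : Pt 3 × Hyp 3} :
    IsOpposite (g • θ) (g • θ') ↔ IsOpposite θ θ' := by
  rcases ProjSym.right_eq g with hg | hg
  · simp only [IsOpposite, ProjSym.smul_def, ProjSym.incident_act_of_right_one hg]
  · simp only [IsOpposite, ProjSym.smul_def, ProjSym.incident_act_of_right_neg hg]
    exact and_comm

section Standard

variable {κ τ : ℝ} {hκ : 0 < κ} {hτ : 0 < τ} {ρ : PSL2Z →* ProjSym} (hρ : IsStdRep hκ hτ ρ)

include hρ in
/-- The image of the flag box under a product of two different parabolic generators consists of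
pairs in the interior of the cones. -/
lemma IsStdRep.exists_pos_of_mem {θ : Pt 3 × Hyp 3} (hθ : θ ∈ flagBox κ τ) (c : Bool) :
    ∃ v, ∃ hv : v ≠ 0, slotOf c (ρ (psT * psL) • θ) = Projectivization.mk ℝ v hv ∧
      ∀ i, 0 < (boxCone κ τ c).mulVec v i := by
  obtain ⟨μ, M, hμ, hsw⟩ := boxCone_switch hκ hτ
  have key : ∀ v (hv : v ≠ 0), slotOf c (ρ (psT * psL) • θ) = Projectivization.mk ℝ v hv →
      0 ≤ (boxCone κ τ c).mulVec
        ((stepMat κ τ false (!c)).mulVec ((stepMat κ τ true c).mulVec v)) →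
      ∀ i, 0 < (boxCone κ τ c).mulVec v i := by
    intro v hv _ h i
    have hw := stepMat_mulVec_ne_zero hκ hτ false (!c) (stepMat_mulVec_ne_zero hκ hτ true c hv)
    refine lt_of_lt_of_le (mul_pos hμ ?_) (hsw true c v h i).1
    refine (Finset.sum_nonneg fun j _ => h j).lt_of_ne fun e =>
      hw (boxCone_injective (κ := κ) (τ := τ) c ?_)
    exact funext fun j => (Finset.sum_eq_zero_iff_of_nonneg fun j _ => h j).mp e.symm j
      (Finset.mem_univ j)
  obtain ⟨v, hv, hcv⟩ : ∃ v hv, slotOf c (ρ (psT * psL) • θ) = Projectivization.mk ℝ v hv :=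
    ⟨_, Projectivization.rep_nonzero _, (Projectivization.mk_rep _).symm⟩
  have h1 := hρ.slotOf_letter_inv_smul true c hv hcv
  have h2 := hρ.slotOf_letter_inv_smul false (!c) _ h1
  have e : (ρ (letter false))⁻¹ • (ρ (letter true))⁻¹ • ρ (psT * psL) • θ = θ := by
    rw [map_mul, mul_smul]
    change (ρ psL)⁻¹ • (ρ psT)⁻¹ • ρ psT • ρ psL • θ = θ
    rw [inv_smul_smul, inv_smul_smul]
  rw [e, Bool.not_not] at h2
  have h3 := hθ c
  rw [h2, mk_mem_coneSet] at h3
  rcases h3 with h3 | h3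
  · exact ⟨v, hv, hcv, key v hv hcv h3⟩
  · have hcv' : slotOf c (ρ (psT * psL) • θ) = Projectivization.mk ℝ (-v) (neg_ne_zero.mpr hv) := by
      rw [hcv, Projectivization.mk_eq_mk_iff']
      exact ⟨-1, by simp⟩
    exact ⟨-v, neg_ne_zero.mpr hv, hcv', key _ _ hcv' (by simpa only [Matrix.mulVec_neg] using h3)⟩

lemma last_pos_of_pos (hτ : 0 < τ) {v : Fin 3 → ℝ} (h1 : 0 < κ * v 0 - v 1 + τ * v 2)
    (h2 : 0 < -(κ * τ) * v 0 + τ * v 1 + (1 + κ ^ 2) * v 2) : 0 < v 2 := by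
  have h : 0 < (1 + κ ^ 2 + τ ^ 2) * v 2 := by nlinarith
  exact pos_of_mul_pos_right h (by positivity)

lemma eq_zero_of_dotProduct_pos {a b : Fin 3 → ℝ} (ha : ∀ i, 0 < a i) (hb : ∀ i, 0 ≤ b i)
    (h : a ⬝ᵥ b = 0) : b = 0 := by
  funext i
  have := (Finset.sum_eq_zero_iff_of_nonneg fun i _ => mul_nonneg (ha i).le (hb i)).mp h i
    (Finset.mem_univ i)
  exact (mul_eq_zero.mp this).resolve_left (ha i).ne'

/-- Points of the interior of a cone are not incident with lines of the opposite cone, because of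
the signs of coordinates. -/
lemma not_incident_of_pos (hτ : 0 < τ) (c : Bool) {v l : Fin 3 → ℝ} (hv : v ≠ 0) (hl : l ≠ 0)
    (h : ∀ i, 0 < (boxCone κ τ c).mulVec v i) (h' : 0 ≤ (boxCone κ τ c).mulVec l) :
    ¬ Incident (Projectivization.mk ℝ v hv) (Projectivization.mk ℝ l hl) := by
  rw [incident_mk, dotProduct_comm]
  intro h0
  cases c
  · have h1 := h 0
    have h2 := h 1
    have h3 := h 2
    have h4 := h 3
    simp [boxCone, Matrix.mulVec, dotProduct, Fin.sum_univ_succ] at h1 h2 h3 h4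
    have h5 := last_pos_of_pos (κ := κ) (v := v) hτ (by linarith) (by linarith)
    obtain ⟨k1, k2, k3, k4⟩ := boxCone_false_nonneg.mp h'
    have k5 := last_nonneg_of_nonneg hτ k1 k2
    have := eq_zero_of_dotProduct_pos (a := ![-v 0, -v 1, v 2]) (b := ![-l 0, -l 1, l 2])
      (by intro i; fin_cases i <;> simp <;> assumption)
      (by intro i; fin_cases i <;> simp <;> assumption)
      (by simp [dotProduct, Fin.sum_univ_succ] at h0 ⊢; exact h0)
    apply hl
    ext i
    have := congrFun this i
    fin_cases i <;> simpa using this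
  · have h1 := h 0
    have h2 := h 1
    have h3 := h 2
    have h4 := h 3
    simp [boxCone, Matrix.mulVec, dotProduct, Fin.sum_univ_succ] at h1 h2 h3 h4
    have h5 := last_pos_of_pos (κ := κ) (v := v) hτ (by linarith) (by linarith)
    obtain ⟨k1, k2, k3, k4⟩ := boxCone_true_nonneg.mp h'
    have k5 := last_nonneg_of_nonneg hτ k4 k3
    exact hl (eq_zero_of_dotProduct_pos (by intro i; fin_cases i <;> simpa)
      (by intro i; fin_cases i <;> simpa) h0)

lemma opposite_of_pos (hτ : 0 < τ) {θ θ' : Pt 3 × Hyp 3}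
    (h : ∀ c, ∃ v, ∃ hv : v ≠ 0, slotOf c θ = Projectivization.mk ℝ v hv ∧
      ∀ i, 0 < (boxCone κ τ c).mulVec v i)
    (h' : (θ'.2, θ'.1) ∈ flagBox κ τ) : IsOpposite θ θ' := by
  have key : ∀ c, ¬ Incident (slotOf c θ) (slotOf c (θ'.2, θ'.1)) := by
    intro c
    obtain ⟨v, hv, e, hpos⟩ := h c
    obtain ⟨l, hl, e', hnn⟩ := h' c
    rw [e, e']
    exact not_incident_of_pos hτ c hv hl hpos hnn
  exact ⟨key true, fun h => key false ((incident_swap _ _).mp h)⟩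

/-- The arc `[1, 2]` is a translate of the arc `[0, ∞]`. -/
lemma psT_mul_psL_inv_smul_mem {s : ℝ} (h1 : 1 ≤ s) (h2 : s ≤ 2) :
    (psT * psL)⁻¹ • (s : OnePoint ℝ) ∈ nonnegArc := by
  rw [psT, psL, psl_mul, psl_inv, psl_smul_coe, hpt_mem_nonnegArc]
  push_cast
  nlinarith [mul_nonneg (sub_nonneg.mpr h1) (sub_nonneg.mpr h2)]

variable {ξ : OnePoint ℝ → Pt 3 × Hyp 3} (hξ : ∀ x, IsArcLimit ρ (flagBox κ τ) x (ξ x))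

include hξ in
lemma equivariant_of_flagBox (hκ : 0 < κ) (hτ : 0 < τ) (g : PSL2Z) (x : OnePoint ℝ) :
    ξ (g • x) = ρ g • ξ x :=
  equivariant_of_isArcLimit hξ ⟨_, cuspFlag_mem_flagBox hκ hτ⟩ g x

include hρ hξ in
lemma IsStdRep.mem_flagBox {x : OnePoint ℝ} (hx : x ∈ nonnegArc) : ξ x ∈ flagBox κ τ :=
  mem_of_isArcLimit hξ ⟨_, cuspFlag_mem_flagBox hκ hτ⟩ isClosed_flagBox
    (hρ.letter_smul_mem true) (hρ.letter_smul_mem false) hx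

include hρ hξ in
/-- The flags over `[1, 2]` lie in the interior of the flag box, while those over `[-∞, 0]` have
their entries exchanged by the polarity and then lie in the flag box. -/
lemma IsStdRep.opposite_of_mem_Icc {s : ℝ} (h1 : 1 ≤ s) (h2 : s ≤ 2) {y : OnePoint ℝ}
    (hy : y ∈ nonposArc) : IsOpposite (ξ s) (ξ y) := by
  refine opposite_of_pos (κ := κ) hτ (fun c => ?_) ?_
  · have := hρ.exists_pos_of_mem (hρ.mem_flagBox hξ (psT_mul_psL_inv_smul_mem h1 h2)) c
    rwa [← equivariant_of_flagBox hξ hκ hτ, smul_inv_smul] at this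
  · have := hρ.mem_flagBox hξ (genD_smul_mem_nonnegArc.mpr hy)
    rwa [equivariant_of_flagBox hξ hκ hτ, hρ.genD_smul] at this

include hξ in
lemma opposite_of_smul_flagBox (hκ : 0 < κ) (hτ : 0 < τ) (g : PSL2Z) {x y : OnePoint ℝ}
    (h : IsOpposite (ξ (g • x)) (ξ (g • y))) : IsOpposite (ξ x) (ξ y) := by
  rwa [equivariant_of_flagBox hξ hκ hτ, equivariant_of_flagBox hξ hκ hτ, opposite_smul_iff] at h

include hρ hξ in
lemma IsStdRep.opposite_infty (r : ℝ) : IsOpposite (ξ r) (ξ OnePoint.infty) := by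
  refine opposite_of_smul_flagBox hξ hκ hτ (psT ^ (1 - ⌊r⌋)) ?_
  rw [psT_zpow_smul_coe, psT_zpow_smul_infty]
  refine hρ.opposite_of_mem_Icc hξ ?_ ?_ (Or.inl rfl)
  · push_cast; linarith [Int.floor_le r]
  · push_cast; linarith [Int.lt_floor_add_one r]

include hρ hξ in
lemma IsStdRep.opposite_of_one_le {s s' : ℝ} (h : 1 ≤ s) (h' : s' < 0) :
    IsOpposite (ξ s) (ξ s') := by
  refine opposite_of_smul_flagBox hξ hκ hτ (psT ^ (1 - ⌊s⌋)) ?_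
  rw [psT_zpow_smul_coe, psT_zpow_smul_coe]
  refine hρ.opposite_of_mem_Icc hξ ?_ ?_ (coe_mem_nonposArc.mpr ?_)
  · push_cast; linarith [Int.floor_le s]
  · push_cast; linarith [Int.lt_floor_add_one s]
  · have : (1 : ℝ) ≤ ⌊s⌋ := by exact_mod_cast Int.le_floor.mpr (by exact_mod_cast h)
    push_cast; linarith

lemma genD_smul_coe {s : ℝ} (hs : s ≠ 0) :
    genD • (s : OnePoint ℝ) = ((-s⁻¹ : ℝ) : OnePoint ℝ) := by
  rw [← hpt_one s, genD_smul_hpt (Or.inr one_ne_zero), hpt_of_ne (neg_ne_zero.mpr hs)]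
  congr 1
  field_simp

include hρ hξ in
lemma IsStdRep.opposite_of_pos_of_neg {s s' : ℝ} (h : 0 < s) (h' : s' < 0) :
    IsOpposite (ξ s) (ξ s') := by
  -- a power of the lower triangular parabolic moves `s` beyond `1` and keeps `s'` negative
  refine opposite_of_smul_flagBox hξ hκ hτ (_root_.genD * (psT ^ (⌈s⁻¹⌉ - 1) * _root_.genD)) ?_
  have h1 : (0 : ℝ) < s⁻¹ := by positivity
  have h2 : s'⁻¹ < 0 := inv_lt_zero.mpr h'
  have h3 : (1 : ℝ) ≤ ⌈s⁻¹⌉ := by exact_mod_cast Int.one_le_ceil_iff.mpr h1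
  have h4 := Int.ceil_lt_add_one s⁻¹
  have h5 := Int.le_ceil s⁻¹
  have e1 : -s⁻¹ + ((⌈s⁻¹⌉ - 1 : ℤ) : ℝ) < 0 := by push_cast; linarith
  have e2 : 0 < -s'⁻¹ + ((⌈s⁻¹⌉ - 1 : ℤ) : ℝ) := by push_cast; linarith
  rw [mul_smul, mul_smul, genD_smul_coe h.ne', psT_zpow_smul_coe, genD_smul_coe e1.ne,
    mul_smul, mul_smul, genD_smul_coe h'.ne, psT_zpow_smul_coe, genD_smul_coe e2.ne']
  refine hρ.opposite_of_one_le hξ ?_ ?_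
  · rw [← inv_neg, one_le_inv₀ (by linarith)]
    push_cast; linarith
  · simpa using e2

include hρ hξ in
/-- The boundary map is transverse: a rational point is moved to `∞`, and two irrational points are
moved to opposite sides of `0` and `∞`. -/
lemma IsStdRep.opposite {x y : OnePoint ℝ} (hxy : x ≠ y) : IsOpposite (ξ x) (ξ y) := by
  have hrat : ∀ (k : PSL2Z) (z : OnePoint ℝ), z ≠ k • (OnePoint.infty : OnePoint ℝ) →
      IsOpposite (ξ z) (ξ (k • OnePoint.infty)) := by
    intro k z hz
    refine opposite_of_smul_flagBox hξ hκ hτ k⁻¹ ?_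
    rw [inv_smul_smul]
    obtain ⟨r, hr⟩ := OnePoint.ne_infty_iff_exists.mp
      (fun e => hz (by rw [← e, smul_inv_smul]) : k⁻¹ • z ≠ OnePoint.infty)
    rw [← hr]
    exact hρ.opposite_infty hξ r
  rcases rational_or_irrational y with ⟨k, rfl⟩ | ⟨r, hr, rfl⟩
  · exact hrat k x hxy
  rcases rational_or_irrational x with ⟨k, rfl⟩ | ⟨r', hr', rfl⟩
  · exact (hrat k _ hxy.symm).symm
  obtain ⟨g, s, s', hs, hs', e, e'⟩ := exists_separating hr' hr fun h => hxy (by rw [h])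
  rw [← e, ← e', equivariant_of_flagBox hξ hκ hτ, equivariant_of_flagBox hξ hκ hτ,
    opposite_smul_iff]
  exact hρ.opposite_of_pos_of_neg hξ hs hs'

end Standard

/-! ### Dynamics of sequences of projective transformations -/

/-- A vector orthogonal to the orthogonal complement of `p` is a multiple of `p`. -/
lemma exists_smul_of_forall_orthogonal {p w : Fin 3 → ℝ} (hp : p ≠ 0)
    (h : ∀ l : Fin 3 → ℝ, l ⬝ᵥ p = 0 → l ⬝ᵥ w = 0) : ∃ a : ℝ, a • p = w := by
  have hpp : p ⬝ᵥ p ≠ 0 := fun e => hp (dotProduct_self_eq_zero.mp e)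
  set a := (p ⬝ᵥ w) / (p ⬝ᵥ p)
  have h1 : (w - a • p) ⬝ᵥ p = 0 := by
    rw [sub_dotProduct, smul_dotProduct, smul_eq_mul, div_mul_cancel₀ _ hpp, dotProduct_comm w,
      sub_self]
  have h2 : (w - a • p) ⬝ᵥ (w - a • p) = 0 := by
    rw [dotProduct_sub, dotProduct_smul, h1, h _ h1, smul_zero, sub_zero]
  exact ⟨a, (sub_eq_zero.mp (dotProduct_self_eq_zero.mp h2)).symm⟩

/-- A sequence of projective transformations that contracts a spanning set of points to `p`, and
whose inverses contract a spanning set of lines to `q`, contracts the complement of `q` to `p`: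
limits of rescaled matrices have rank one, with image `p` and kernel `q`. -/
lemma tendsto_pgl_smul_of_contracting {g : ℕ → PGL(3, ℝ)} {p q : Pt 3} {U W : Set (Pt 3)}
    (hU : ∀ l, ∃ u ∈ U, ¬ Incident u l) (hW : ∀ l, ∃ w ∈ W, ¬ Incident w l)
    (hgU : ∀ u ∈ U, Tendsto (fun n => g n • u) atTop (𝓝 p))
    (hgW : ∀ w ∈ W, Tendsto (fun n => contra 3 (g n)⁻¹ • w) atTop (𝓝 q))
    {v : Pt 3} (hv : ¬ Incident v q) : Tendsto (fun n => g n • v) atTop (𝓝 p) := by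
  choose L hL using fun n => Matrix.ProjGenLinGroup.mk_surjective (g n)
  refine tendsto_of_subseq_tendsto fun ns hns => ?_
  let N : ℕ → Fin 3 → Fin 3 → ℝ := fun n => (L n).val
  have hN0 : ∀ n, N n ≠ 0 := fun n h => (L n).ne_zero h
  have hsph : ∀ n, ‖N (ns n)‖⁻¹ • N (ns n) ∈ Metric.sphere (0 : Fin 3 → Fin 3 → ℝ) 1 := fun n => by
    rw [mem_sphere_zero_iff_norm, norm_smul, norm_inv, norm_norm,
      inv_mul_cancel₀ (norm_ne_zero_iff.mpr (hN0 _))]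
  obtain ⟨A, hA, ψ, hψ, hlim⟩ := (isCompact_sphere (0 : Fin 3 → Fin 3 → ℝ) 1).tendsto_subseq hsph
  have hA0 : Matrix.of A ≠ 0 := by
    intro h
    have : A = 0 := h
    rw [this, mem_sphere_zero_iff_norm, norm_zero] at hA
    exact zero_ne_one hA
  have hent : ∀ i j, Tendsto (fun n => ‖N (ns (ψ n))‖⁻¹ * N (ns (ψ n)) i j) atTop (𝓝 (A i j)) :=
    fun i j => ((continuous_apply j).tendsto _).comp (((continuous_apply i).tendsto _).comp hlim)
  have hψns : Tendsto (fun n => ns (ψ n)) atTop atTop := hns.comp hψ.tendsto_atTop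
  have hrescale : ∀ (h : GL (Fin 3) ℝ) {c : ℝ} (hc : c ≠ 0) {x : Fin 3 → ℝ} (hx : x ≠ 0),
      ∃ hne : c • h.val.mulVec x ≠ 0, (Matrix.ProjGenLinGroup.mk h : PGL(3, ℝ)) •
        Projectivization.mk ℝ x hx = Projectivization.mk ℝ _ hne := by
    intro h c hc x hx
    refine ⟨smul_ne_zero hc (gl_smul_ne_zero h hx), ?_⟩
    rw [pgl_smul_mk, Projectivization.mk_eq_mk_iff']
    exact ⟨c⁻¹, by rw [smul_smul, inv_mul_cancel₀ hc, one_smul]⟩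
  have hc : ∀ n, ‖N n‖⁻¹ ≠ 0 := fun n => inv_ne_zero (norm_ne_zero_iff.mpr (hN0 n))
  have hpt : ∀ {x : Fin 3 → ℝ} (hx : x ≠ 0) (hAx : (Matrix.of A).mulVec x ≠ 0),
      Tendsto (fun n => g (ns (ψ n)) • Projectivization.mk ℝ x hx) atTop
        (𝓝 (Projectivization.mk ℝ _ hAx)) := by
    intro x hx hAx
    have hres := fun n => hrescale (L (ns (ψ n))) (hc (ns (ψ n))) hx
    choose hne he using hres
    refine (tendsto_projMk hne hAx ?_).congr fun n => ?_
    · rw [tendsto_pi_nhds]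
      intro i
      change Tendsto _ _ (𝓝 (∑ j, A i j * x j))
      refine (tendsto_finsetSum _ fun j _ => (hent i j).mul_const (x j)).congr fun n => ?_
      simp only [Pi.smul_apply, Matrix.mulVec, dotProduct, smul_eq_mul, Finset.mul_sum, mul_assoc]
      rfl
    · rw [← he, hL]
  have hln : ∀ {x : Fin 3 → ℝ} (hx : x ≠ 0) (hAx : (Matrix.of A).transpose.mulVec x ≠ 0),
      Tendsto (fun n => contra 3 (g (ns (ψ n)))⁻¹ • Projectivization.mk ℝ x hx) atTop
        (𝓝 (Projectivization.mk ℝ _ hAx)) := by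
    intro x hx hAx
    have hres := fun n => hrescale (glContra 3 (L (ns (ψ n)))⁻¹) (hc (ns (ψ n))) hx
    choose hne he using hres
    refine (tendsto_projMk hne hAx ?_).congr fun n => ?_
    · rw [tendsto_pi_nhds]
      intro i
      change Tendsto _ _ (𝓝 (∑ j, A j i * x j))
      refine (tendsto_finsetSum _ fun j _ => (hent j i).mul_const (x j)).congr fun n => ?_
      have : (glContra 3 (L (ns (ψ n)))⁻¹).val = (L (ns (ψ n))).val.transpose := by
        change ((L (ns (ψ n)))⁻¹⁻¹).val.transpose = _
        rw [inv_inv]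
      rw [this]
      simp only [Pi.smul_apply, Matrix.mulVec, dotProduct, smul_eq_mul, Finset.mul_sum, mul_assoc]
      rfl
    · rw [← he, ← hL, ← map_inv, contra_mk]
  -- the image of the limit matrix is the line spanned by `p`
  have himg : ∀ l : Fin 3 → ℝ, l ⬝ᵥ p.rep = 0 → (Matrix.of A).transpose.mulVec l = 0 := by
    intro l hlp
    by_contra hne
    obtain ⟨u, huU, hu⟩ := hU (Projectivization.mk ℝ _ hne)
    have hgu := (hgU u huU).comp hψns
    induction u using Projectivization.ind with | h x hx => ?_
    rw [incident_mk, Matrix.mulVec_transpose, ← Matrix.dotProduct_mulVec] at hu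
    have hAx : (Matrix.of A).mulVec x ≠ 0 := fun e => hu (by rw [e, dotProduct_zero])
    have := tendsto_nhds_unique hgu (hpt hx hAx)
    rw [← Projectivization.mk_rep p, Projectivization.mk_eq_mk_iff'] at this
    obtain ⟨a, ha⟩ := this
    have ha0 : a ≠ 0 := by
      rintro rfl
      rw [zero_smul] at ha
      exact p.rep_nonzero ha.symm
    apply hu
    have h2 : a • (l ⬝ᵥ (Matrix.of A).mulVec x) = 0 := by rw [← dotProduct_smul, ha, hlp]
    exact (smul_eq_zero.mp h2).resolve_left ha0
  induction v using Projectivization.ind with | h x hx => ?_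
  -- the kernel of the limit matrix is the line `q`
  have hAx : (Matrix.of A).mulVec x ≠ 0 := by
    intro hAx
    obtain ⟨y, hy⟩ : ∃ y, (Matrix.of A).mulVec y ≠ 0 := by
      by_contra! h
      exact hA0 (Matrix.ext_of_mulVec_single fun i => by rw [h, Matrix.zero_mulVec])
    obtain ⟨w, hwW, hw⟩ := hW (Projectivization.mk ℝ _ hy)
    have hgw := (hgW w hwW).comp hψns
    induction w using Projectivization.ind with | h z hz => ?_
    rw [incident_mk, dotProduct_comm, Matrix.dotProduct_mulVec, ← Matrix.mulVec_transpose] at hw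
    have hAz : (Matrix.of A).transpose.mulVec z ≠ 0 := fun e => hw (by rw [e, zero_dotProduct])
    have := tendsto_nhds_unique hgw (hln hz hAz)
    apply hv
    rw [this, incident_mk, Matrix.mulVec_transpose, ← Matrix.dotProduct_mulVec, hAx,
      dotProduct_zero]
  refine ⟨ψ, ?_⟩
  have hlim := hpt hx hAx
  have hp : Projectivization.mk ℝ _ hAx = p := by
    conv_rhs => rw [← Projectivization.mk_rep p]
    rw [Projectivization.mk_eq_mk_iff']
    refine exists_smul_of_forall_orthogonal p.rep_nonzero fun l hl => ?_
    rw [Matrix.dotProduct_mulVec, ← Matrix.mulVec_transpose, himg l hl, zero_dotProduct]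
  rwa [hp] at hlim

/-! ### Strongly dynamics preserving boundary maps -/

/-- Continuous, equivariant, transverse boundary maps that are strongly dynamics preserving with
respect to the convergence of sequences in the compactification of the modular group as a
convergence group. -/
structure IsStrongBoundaryMap (ρ : PSL2Z →* ProjSym) (ξ : OnePoint ℝ → Pt 3 × Hyp 3) : Prop where
  continuous : Continuous ξ
  equivariant : ∀ (g : PSL2Z) (x : OnePoint ℝ), ξ (g • x) = ρ g • ξ x
  opposite : ∀ x y : OnePoint ℝ, x ≠ y → IsOpposite (ξ x) (ξ y)
  tendsto : ∀ (γ : ℕ → PSL2Z) (x y : OnePoint ℝ),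
    TendsToBoundary γ x → TendsToBoundary (fun n => (γ n)⁻¹) y →
    ∀ (v : Pt 3) (l : Hyp 3), ¬ Incident v (ξ y).2 → ¬ Incident (ξ y).1 l →
      Tendsto (fun n => ρ (γ n) • ((v, l) : Pt 3 × Hyp 3)) atTop (𝓝 (ξ x))

lemma TendsToAway.subseq {Γ M : Type*} [Group Γ] [TopologicalSpace M] [MulAction Γ M] {γ : ℕ → Γ}
    {x y : M} (h : TendsToAway γ x y) {φ : ℕ → ℕ} (hφ : Tendsto φ atTop atTop) :
    TendsToAway (fun n => γ (φ n)) x y :=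
  fun K hK hy U hU => hφ.eventually (h K hK hy U hU)

section ArcLimit

variable {ρ : PSL2Z →* ProjSym} {X : Set (Pt 3 × Hyp 3)} {ξ : OnePoint ℝ → Pt 3 × Hyp 3}
  (hξ : ∀ x, IsArcLimit ρ X x (ξ x)) (hspan : ∀ c l, ∃ θ ∈ X, ¬ Incident (slotOf c θ) l)

include hspan in
/-- Translates of a spanning set of pairs (point, line) are spanning. -/
lemma exists_not_incident_smul (g : ProjSym) (c : Bool) (l : Pt 3) :
    ∃ θ ∈ X, ¬ Incident (slotOf c (g • θ)) l := by
  have h2 : ∃ f : Pt 3 × Hyp 3, slotOf (!c) (g • f) = l :=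
    ⟨g⁻¹ • (l, l), by rw [smul_inv_smul]; cases c <;> rfl⟩
  obtain ⟨f, rfl⟩ := h2
  rcases ProjSym.right_eq g with hg | hg <;> cases c
  · obtain ⟨θ, hθ, h⟩ := hspan false f.1
    exact ⟨θ, hθ, fun h' => h ((incident_swap _ _).mp
      ((ProjSym.incident_act_of_right_one hg f θ).mp ((incident_swap _ _).mp h')))⟩
  · obtain ⟨θ, hθ, h⟩ := hspan true f.2
    exact ⟨θ, hθ, fun h' => h ((ProjSym.incident_act_of_right_one hg θ f).mp h')⟩
  · obtain ⟨θ, hθ, h⟩ := hspan true f.2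
    exact ⟨θ, hθ, fun h' => h
      ((ProjSym.incident_act_of_right_neg hg f θ).mp ((incident_swap _ _).mp h'))⟩
  · obtain ⟨θ, hθ, h⟩ := hspan false f.1
    exact ⟨θ, hθ, fun h' => h ((incident_swap _ _).mp
      ((ProjSym.incident_act_of_right_neg hg θ f).mp h'))⟩

lemma exists_smul_nonnegArc_ne (y : OnePoint ℝ) : ∃ δ : PSL2Z, ∀ z ∈ nonnegArc, δ • z ≠ y := by
  obtain ⟨x, hx, -⟩ := exists_ne_and_ne y y
  exact exists_smul_nonnegArc_subset (isOpen_compl_singleton.mem_nhds hx)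

include hξ hspan in
/-- If `ρ(g) X` converges along shrinking arcs, then a convergence sequence of constant parity
contracts translates of `X`, and so do its inverses; hence it is strongly dynamics preserving. -/
lemma tendsto_smul_of_tendsToAway {γ : ℕ → PSL2Z} {x y : OnePoint ℝ} (h : TendsToAway γ x y)
    (h' : TendsToAway (fun n => (γ n)⁻¹) y x) {e : ℤˣ} (he : ∀ n, (ρ (γ n)).right = e)
    {v : Pt 3} {l : Hyp 3} (hv : ¬ Incident v (ξ y).2) (hl : ¬ Incident (ξ y).1 l) :
    Tendsto (fun n => ρ (γ n) • ((v, l) : Pt 3 × Hyp 3)) atTop (𝓝 (ξ x)) := by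
  obtain ⟨δ, hδ⟩ := exists_smul_nonnegArc_ne y
  obtain ⟨δ', hδ'⟩ := exists_smul_nonnegArc_ne x
  have hatt : ∀ c, ∀ θ ∈ X, Tendsto (fun n => slotOf c (ρ (γ n) • ρ δ • θ)) atTop
      (𝓝 (slotOf c (ξ x))) := by
    intro c θ hθ
    have := tendsto_smul_of_isArcLimit hξ h hδ hθ
    cases c
    · exact (continuous_snd.tendsto _).comp this
    · exact (continuous_fst.tendsto _).comp this
  have hrep : ∀ c, ∀ θ ∈ X, Tendsto (fun n => slotOf c ((ρ (γ n))⁻¹ • ρ δ' • θ)) atTop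
      (𝓝 (slotOf c (ξ y))) := by
    intro c θ hθ
    have := tendsto_smul_of_isArcLimit hξ h' hδ' hθ
    simp only [map_inv] at this
    cases c
    · exact (continuous_snd.tendsto _).comp this
    · exact (continuous_fst.tendsto _).comp this
  let U : Bool → Set (Pt 3) := fun c => (fun θ => slotOf c (ρ δ • θ)) '' X
  let W : Bool → Set (Pt 3) := fun c => (fun θ => slotOf c (ρ δ' • θ)) '' X
  have hU : ∀ c l, ∃ u ∈ U c, ¬ Incident u l := fun c l => by
    obtain ⟨θ, hθ, h⟩ := exists_not_incident_smul hspan (ρ δ) c l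
    exact ⟨_, ⟨θ, hθ, rfl⟩, h⟩
  have hW : ∀ c l, ∃ u ∈ W c, ¬ Incident u l := fun c l => by
    obtain ⟨θ, hθ, h⟩ := exists_not_incident_smul hspan (ρ δ') c l
    exact ⟨_, ⟨θ, hθ, rfl⟩, h⟩
  have hl' : ¬ Incident l (ξ y).1 := fun h => hl ((incident_swap _ _).mp h)
  rcases Int.units_eq_one_or e with rfl | rfl
  · have hact : ∀ n (θ : Pt 3 × Hyp 3), ρ (γ n) • θ =
        ((ρ (γ n)).left • θ.1, contra 3 (ρ (γ n)).left • θ.2) :=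
      fun n θ => ProjSym.act_of_right_one (he n) θ
    have hinv : ∀ n (θ : Pt 3 × Hyp 3), (ρ (γ n))⁻¹ • θ =
        ((ρ (γ n)).left⁻¹ • θ.1, contra 3 (ρ (γ n)).left⁻¹ • θ.2) := by
      intro n θ
      rw [inv_smul_eq_iff, hact]
      simp only [map_inv, smul_inv_smul, Prod.mk.eta]
    simp only [hact, hinv] at hatt hrep ⊢
    refine Tendsto.prodMk_nhds ?_ ?_
    · refine tendsto_pgl_smul_of_contracting (hU true) (hW false) ?_ ?_ hv
      · rintro _ ⟨θ, hθ, rfl⟩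
        exact hatt true θ hθ
      · rintro _ ⟨θ, hθ, rfl⟩
        exact hrep false θ hθ
    · refine tendsto_pgl_smul_of_contracting (hU false) (hW true) ?_ ?_ hl'
      · rintro _ ⟨θ, hθ, rfl⟩
        exact hatt false θ hθ
      · rintro _ ⟨θ, hθ, rfl⟩
        simp only [← map_inv, contra_contra]
        exact hrep true θ hθ
  · have hact : ∀ n (θ : Pt 3 × Hyp 3), ρ (γ n) • θ =
        ((ρ (γ n)).left • θ.2, contra 3 (ρ (γ n)).left • θ.1) :=
      fun n θ => ProjSym.act_of_right_neg (he n) θ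
    have hinv : ∀ n (θ : Pt 3 × Hyp 3), (ρ (γ n))⁻¹ • θ =
        (contra 3 (ρ (γ n)).left⁻¹ • θ.2, (ρ (γ n)).left⁻¹ • θ.1) := by
      intro n θ
      rw [inv_smul_eq_iff, hact]
      simp only [map_inv, smul_inv_smul, Prod.mk.eta]
    simp only [hact, hinv] at hatt hrep ⊢
    refine Tendsto.prodMk_nhds ?_ ?_
    · refine tendsto_pgl_smul_of_contracting (hU false) (hW false) ?_ ?_ hl'
      · rintro _ ⟨θ, hθ, rfl⟩
        exact hatt true θ hθ
      · rintro _ ⟨θ, hθ, rfl⟩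
        exact hrep true θ hθ
    · refine tendsto_pgl_smul_of_contracting (hU true) (hW true) ?_ ?_ hv
      · rintro _ ⟨θ, hθ, rfl⟩
        exact hatt false θ hθ
      · rintro _ ⟨θ, hθ, rfl⟩
        simp only [← map_inv, contra_contra]
        exact hrep false θ hθ

include hξ hspan in
lemma tendsto_smul_of_tendsToBoundary {γ : ℕ → PSL2Z} {x y : OnePoint ℝ}
    (h : TendsToBoundary γ x) (h' : TendsToBoundary (fun n => (γ n)⁻¹) y)
    {v : Pt 3} {l : Hyp 3} (hv : ¬ Incident v (ξ y).2) (hl : ¬ Incident (ξ y).1 l) :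
    Tendsto (fun n => ρ (γ n) • ((v, l) : Pt 3 × Hyp 3)) atTop (𝓝 (ξ x)) := by
  refine tendsto_of_subseq_tendsto fun ns hns => ?_
  obtain ⟨φ, hφ, hnsφ⟩ := strictMono_subseq_of_tendsto_atTop hns
  obtain ⟨ψ, hψ, y', hxy⟩ := h _ hnsφ
  obtain ⟨ψ', hψ', x', hyx⟩ := h' _ (hnsφ.comp hψ)
  have hxy := hxy.subseq hψ'.tendsto_atTop
  obtain rfl := hxy.eq_of_inv hyx
  obtain rfl : x' = x := hyx.eq_of_inv (x' := y') (by simpa using hxy)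
  -- pass to a further subsequence of constant parity
  obtain ⟨e, χ, hχ, he⟩ : ∃ (e : ℤˣ) (χ : ℕ → ℕ), StrictMono χ ∧
      ∀ n, (ρ (γ (ns (φ (ψ (ψ' (χ n))))))).right = e := by
    by_cases hf : ∃ᶠ n in atTop, (ρ (γ (ns (φ (ψ (ψ' n)))))).right = 1
    · obtain ⟨χ, hχ, he⟩ := extraction_of_frequently_atTop hf
      exact ⟨1, χ, hχ, he⟩
    · obtain ⟨χ, hχ, he⟩ := extraction_of_eventually_atTop (not_frequently.mp hf)
      exact ⟨-1, χ, hχ, fun n => (ProjSym.right_eq _).resolve_left (he n)⟩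
  refine ⟨fun n => φ (ψ (ψ' (χ n))), ?_⟩
  exact tendsto_smul_of_tendsToAway hξ hspan (hxy.subseq hχ.tendsto_atTop)
    (hyx.subseq hχ.tendsto_atTop) he hv hl

end ArcLimit

section Standard

variable {κ τ : ℝ} {hκ : 0 < κ} {hτ : 0 < τ} {ρ : PSL2Z →* ProjSym} (hρ : IsStdRep hκ hτ ρ)

/-- The points, and the lines, of the flag box are spanning. -/
lemma exists_mem_flagBox_not_incident (hκ : 0 < κ) (hτ : 0 < τ) (c : Bool) (l : Pt 3) :
    ∃ θ ∈ flagBox κ τ, ¬ Incident (slotOf c θ) l := by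
  have key : ∃ x ∈ coneSet (boxCone κ τ c), ¬ Incident x l := by
    by_contra! hall
    induction l using Projectivization.ind with | h l hl => ?_
    have hall' : ∀ w : Fin 3 → ℝ, w ≠ 0 → 0 ≤ (boxCone κ τ c).mulVec w → l ⬝ᵥ w = 0 := by
      intro w hw h
      exact (incident_mk hw hl).mp (hall _ ⟨w, hw, rfl, h⟩)
    have h3 := hall' ![0, 0, 1] e3_ne_zero (by
      cases c
      · rw [boxCone_false_nonneg]; simp; constructor <;> positivity
      · rw [boxCone_true_nonneg]; simp; constructor <;> positivity)
    simp [dotProduct, Fin.sum_univ_three] at h3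
    have hzero : l 0 = 0 → l 1 = 0 → False := fun h0 h1 => hl (by
      ext i; fin_cases i <;> assumption)
    cases c
    · have h1 := hall' ![-1, -κ, 0] (fun h => by simpa using congrFun h 0) (by
        rw [boxCone_false_nonneg]; simp [hκ.le]; linarith)
      have h2 := hall' ![-τ, 0, κ] (fun h => hτ.ne' (by simpa using congrFun h 0)) (by
        rw [boxCone_false_nonneg]; simp [hτ.le, mul_comm]; positivity)
      simp [dotProduct, Fin.sum_univ_three, h3, hτ.ne'] at h2
      simp [dotProduct, Fin.sum_univ_three, h2, hκ.ne'] at h1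
      exact hzero h2 h1
    · have hK : 1 + κ ^ 2 ≠ 0 := by positivity
      have h1 := hall' ![1, κ, 0] vec3_ne_zero_of_fst (by
        rw [boxCone_true_nonneg]; simp [hκ.le]; linarith)
      have h2 := hall' ![1 + κ ^ 2, 0, κ * τ] (fun h => hK (by simpa using congrFun h 0)) (by
        rw [boxCone_true_nonneg]
        simp
        refine ⟨by positivity, by linarith, by positivity⟩)
      simp [dotProduct, Fin.sum_univ_three, h3, hK] at h2
      simp [dotProduct, Fin.sum_univ_three, h2, hκ.ne'] at h1
      exact hzero h2 h1
  obtain ⟨x, hx, hxl⟩ := key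
  cases c
  · refine ⟨((cuspFlag κ).1, x), fun c => ?_, hxl⟩
    cases c
    · exact hx
    · exact cuspFlag_mem_flagBox hκ hτ true
  · refine ⟨(x, (cuspFlag κ).2), fun c => ?_, hxl⟩
    cases c
    · exact cuspFlag_mem_flagBox hκ hτ false
    · exact hx

include hρ in
theorem IsStdRep.exists_isStrongBoundaryMap :
    ∃ ξ, IsStrongBoundaryMap ρ ξ ∧ ξ OnePoint.infty = cuspFlag κ := by
  obtain ⟨ξ, hξ⟩ := hρ.exists_isArcLimit
  refine ⟨ξ, ⟨continuous_of_isArcLimit hξ ⟨_, cuspFlag_mem_flagBox hκ hτ⟩,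
    equivariant_of_flagBox hξ hκ hτ, fun x y hxy => hρ.opposite hξ hxy,
    fun γ x y h h' v l hv hl => tendsto_smul_of_tendsToBoundary hξ
      (exists_mem_flagBox_not_incident hκ hτ) h h' hv hl⟩, ?_⟩
  -- the value at `∞` is fixed by the parabolic element and lies in the flag box
  have h : ∀ n : ℕ, (ρ (letter true ^ n))⁻¹ • ξ OnePoint.infty ∈ flagBox κ τ := fun n => by
    have h1 : ρ (letter true ^ n) • ξ OnePoint.infty = ξ OnePoint.infty := by
      rw [← equivariant_of_flagBox hξ hκ hτ]
      refine congrArg ξ ?_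
      have := psT_zpow_smul_infty n
      rwa [zpow_natCast] at this
    rw [inv_smul_eq_iff.mpr h1.symm]
    exact hρ.mem_flagBox hξ infty_mem_nonnegArc
  exact Prod.ext (hρ.slotOf_eq_of_forall_letter_pow h true)
    (hρ.slotOf_eq_of_forall_letter_pow h false)

end Standard

/-! ### Marked boxes and projective symmetries -/

-- `join` is written `_root_.join` below, to distinguish it from `Filter.join`

lemma eq_join_of_incident {v w : Pt 3} {l : Hyp 3} (h : v ≠ w) (hv : Incident v l)
    (hw : Incident w l) : _root_.join v w = l := by
  induction v using Projectivization.ind with | h v hv0 => ?_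
  induction w using Projectivization.ind with | h w hw0 => ?_
  induction l using Projectivization.ind with | h l hl0 => ?_
  rw [incident_mk] at hv hw
  rw [_root_.join, Projectivization.cross_mk_of_ne hv0 hw0 h,
    Projectivization.mk_eq_mk_iff_crossProduct_eq_zero]
  simp only [dotProduct, Fin.sum_univ_three] at hv hw
  ext i
  fin_cases i <;> simp [crossProduct]
  · linear_combination w 0 * hv - v 0 * hw
  · linear_combination w 1 * hv - v 1 * hw
  · linear_combination w 2 * hv - v 2 * hw

lemma eq_meet_of_incident {l m : Hyp 3} {v : Pt 3} (h : l ≠ m) (hl : Incident v l)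
    (hm : Incident v m) : meet l m = v :=
  eq_join_of_incident h ((incident_swap _ _).mp hl) ((incident_swap _ _).mp hm)

lemma incident_join {v w : Pt 3} (h : v ≠ w) :
    Incident v (_root_.join v w) ∧ Incident w (_root_.join v w) :=
  ⟨Projectivization.cross_orthogonal_left h, Projectivization.cross_orthogonal_right h⟩

lemma incident_meet {l m : Hyp 3} (h : l ≠ m) : Incident (meet l m) l ∧ Incident (meet l m) m :=
  ⟨Projectivization.orthogonal_cross_left h, Projectivization.orthogonal_cross_right h⟩

lemma hypAct_injective {d : ℕ} (g : PGL(d, ℝ)) : Function.Injective (hypAct g) :=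
  MulAction.injective (contra d g)

lemma join_smul (g : PGL(3, ℝ)) {v w : Pt 3} (h : v ≠ w) :
    _root_.join (g • v) (g • w) = hypAct g (_root_.join v w) :=
  eq_join_of_incident ((MulAction.injective g).ne h)
    ((incident_smul g _ _).mpr (incident_join h).1) ((incident_smul g _ _).mpr (incident_join h).2)

lemma meet_hypAct (g : PGL(3, ℝ)) {l m : Hyp 3} (h : l ≠ m) :
    meet (hypAct g l) (hypAct g m) = g • meet l m :=
  eq_meet_of_incident ((hypAct_injective g).ne h)
    ((incident_smul g _ _).mpr (incident_meet h).1) ((incident_smul g _ _).mpr (incident_meet h).2)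

lemma join_comm (v w : Pt 3) : _root_.join v w = _root_.join w v := Projectivization.cross_comm v w

lemma meet_comm (l m : Hyp 3) : meet l m = meet m l := Projectivization.cross_comm l m

namespace BoxData

lemma act_of_right_one {g : ProjSym} (hg : g.right = 1) (Θ : BoxData) : Θ.act g =
    ⟨g.left • Θ.p, g.left • Θ.q, g.left • Θ.r, g.left • Θ.s, g.left • Θ.t, g.left • Θ.b,
      hypAct g.left Θ.P, hypAct g.left Θ.Q, hypAct g.left Θ.R, hypAct g.left Θ.S,
      hypAct g.left Θ.T, hypAct g.left Θ.B⟩ := by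
  rw [act, if_pos hg]

lemma act_of_right_neg {g : ProjSym} (hg : g.right = -1) (Θ : BoxData) : Θ.act g =
    ⟨g.left • Θ.P, g.left • Θ.Q, g.left • Θ.S, g.left • Θ.R, g.left • Θ.T, g.left • Θ.B,
      hypAct g.left Θ.q, hypAct g.left Θ.p, hypAct g.left Θ.r, hypAct g.left Θ.s,
      hypAct g.left Θ.t, hypAct g.left Θ.b⟩ := by
  rw [act, if_neg (by rw [hg]; decide)]

lemma act_one (Θ : BoxData) : Θ.act 1 = Θ := by
  rw [act_of_right_one rfl]
  simp [hypAct_one]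

/-- Composition of symmetries on boxes. (For two dualities it holds only up to the flip.) -/
lemma act_mul_of_right_one_right (g : ProjSym) {h : ProjSym} (hh : h.right = 1) (Θ : BoxData) :
    Θ.act (g * h) = (Θ.act h).act g := by
  rcases ProjSym.right_eq g with hg | hg
  · have : (g * h).right = 1 := by simp [hg, hh]
    rw [act_of_right_one this, act_of_right_one hh, act_of_right_one hg]
    simp [hg, mul_smul, hypAct_mul]
  · have : (g * h).right = -1 := by simp [hg, hh]
    have hl : (g * h).left = g.left * contra 3 h.left := by
      rw [SemidirectProduct.mul_left, hg, signAct_neg_one_apply]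
    rw [act_of_right_neg this, act_of_right_one hh, act_of_right_neg hg, hl]
    simp [mul_smul, hypAct_mul, hypAct_contra]
    simp [hypAct]

lemma act_mul_of_right_one_left {g : ProjSym} (hg : g.right = 1) (h : ProjSym) (Θ : BoxData) :
    Θ.act (g * h) = (Θ.act h).act g := by
  rcases ProjSym.right_eq h with hh | hh
  · exact act_mul_of_right_one_right g hh Θ
  · have : (g * h).right = -1 := by simp [hg, hh]
    have hl : (g * h).left = g.left * h.left := by
      rw [SemidirectProduct.mul_left, hg, signAct_one_apply]
    rw [act_of_right_neg this, act_of_right_neg hh, act_of_right_one hg, hl]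
    simp [mul_smul, hypAct_mul]

lemma flip_flip (Θ : BoxData) : Θ.flip.flip = Θ := rfl

lemma act_flip (g : ProjSym) (Θ : BoxData) : Θ.flip.act g = (Θ.act g).flip := by
  rcases ProjSym.right_eq g with hg | hg
  · rw [act_of_right_one hg, act_of_right_one hg]; rfl
  · rw [act_of_right_neg hg, act_of_right_neg hg]; rfl

lemma dual_act {g : ProjSym} (hg : g.right = 1) (Θ : BoxData) : (Θ.act g).dual = Θ.dual.act g := by
  rw [act_of_right_one hg, act_of_right_one hg]; rfl

lemma dual_flip (Θ : BoxData) : Θ.flip.dual = Θ.dual.flip := rfl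

lemma dualTop_flip (Θ : BoxData) : Θ.flip.dualTop = Θ.dualTop.flip := by
  simp only [dualTop, flip]
  rw [meet_comm (_root_.join Θ.p Θ.r), join_comm (meet Θ.P Θ.S)]

/-- The entries of a box between which lines and intersection points are taken are distinct. -/
structure Generic (Θ : BoxData) : Prop where
  PS : Θ.P ≠ Θ.S
  QR : Θ.Q ≠ Θ.R
  qs : Θ.q ≠ Θ.s
  pr : Θ.p ≠ Θ.r
  diag : _root_.join Θ.q Θ.s ≠ _root_.join Θ.p Θ.r
  pappus : meet Θ.Q Θ.R ≠ meet Θ.P Θ.S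

variable {Θ : BoxData} (hΘ : Θ.Generic) {g : ProjSym} (hg : g.right = 1)

include hΘ hg

lemma dualTop_act : (Θ.act g).dualTop = Θ.dualTop.act g := by
  rw [act_of_right_one hg, act_of_right_one hg]
  simp only [dualTop, meet_hypAct _ hΘ.PS, meet_hypAct _ hΘ.QR, join_smul _ hΘ.qs,
    join_smul _ hΘ.pr, meet_hypAct _ hΘ.diag, join_smul _ hΘ.pappus]

lemma dualBottom_act : (Θ.act g).dualBottom = Θ.dualBottom.act g := by
  rw [act_of_right_one hg, act_of_right_one hg]
  simp only [dualBottom, meet_hypAct _ hΘ.PS, meet_hypAct _ hΘ.QR, join_smul _ hΘ.qs,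
    join_smul _ hΘ.pr, meet_hypAct _ hΘ.diag, join_smul _ hΘ.pappus]

omit hΘ

lemma act_injective_of_right_one : Function.Injective (fun Θ : BoxData => Θ.act g) := by
  intro Θ Θ' h
  have h' : (Θ.act g).act g⁻¹ = (Θ'.act g).act g⁻¹ := congrArg (fun X : BoxData => X.act g⁻¹) h
  rwa [← act_mul_of_right_one_right _ hg, ← act_mul_of_right_one_right _ hg, inv_mul_cancel,
    act_one, act_one] at h'

lemma sameMarkedBox_act_iff {Θ Θ' : BoxData} :
    SameMarkedBox (Θ.act g) (Θ'.act g) ↔ SameMarkedBox Θ Θ' := by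
  rw [SameMarkedBox, SameMarkedBox, ← act_flip, (act_injective_of_right_one hg).eq_iff,
    (act_injective_of_right_one hg).eq_iff]

end BoxData

/-- Conjugating a representation by a projective transformation moves its box. -/
lemma isPappusSchwartz_conj_iff {Θ : BoxData} (hΘ : Θ.Generic) {c : ProjSym} (hc : c.right = 1)
    (ρ : PSL2Z →* ProjSym) : IsPappusSchwartz (Θ.act c) ρ ↔
      IsPappusSchwartz Θ ((MulAut.conj c⁻¹).toMonoidHom.comp ρ) := by
  have hc' : c⁻¹.right = 1 := by simp [hc]
  have hr : ∀ g, (((MulAut.conj c⁻¹).toMonoidHom.comp ρ) g).right = (ρ g).right := by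
    intro g; simp [hc]
  have hact : ∀ g (Θ : BoxData), (Θ.act c).act (ρ g) =
      (Θ.act (((MulAut.conj c⁻¹).toMonoidHom.comp ρ) g)).act c := by
    intro g Θ
    rw [← BoxData.act_mul_of_right_one_left hc, ← BoxData.act_mul_of_right_one_right _ hc]
    congr 1
    simp [mul_assoc]
  constructor
  · rintro ⟨h1, h2, h3, h4, h5, h6⟩
    rw [hact, BoxData.dual_act hc, BoxData.sameMarkedBox_act_iff hc] at h2
    rw [hact, BoxData.dualTop_act hΘ hc, BoxData.sameMarkedBox_act_iff hc] at h4
    rw [BoxData.dualTop_act hΘ hc, BoxData.dualBottom_act hΘ hc, hact,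
      BoxData.sameMarkedBox_act_iff hc] at h5
    rw [BoxData.dualBottom_act hΘ hc, hact, BoxData.sameMarkedBox_act_iff hc] at h6
    exact ⟨(hr _).trans h1, h2, (hr _).trans h3, h4, h5, h6⟩
  · rintro ⟨h1, h2, h3, h4, h5, h6⟩
    refine ⟨(hr _).symm.trans h1, ?_, (hr _).symm.trans h3, ?_, ?_, ?_⟩
    · rwa [hact, BoxData.dual_act hc, BoxData.sameMarkedBox_act_iff hc]
    · rwa [hact, BoxData.dualTop_act hΘ hc, BoxData.sameMarkedBox_act_iff hc]
    · rwa [BoxData.dualTop_act hΘ hc, BoxData.dualBottom_act hΘ hc, hact,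
        BoxData.sameMarkedBox_act_iff hc]
    · rwa [BoxData.dualBottom_act hΘ hc, hact, BoxData.sameMarkedBox_act_iff hc]

/-! ### The standard box -/

lemma vec3_ne_zero {v : Fin 3 → ℝ} (i : Fin 3) (h : v i ≠ 0) : v ≠ 0 :=
  fun e => h (by rw [e]; rfl)

lemma mk_ne_mk {v w : Fin 3 → ℝ} (hv : v ≠ 0) (hw : w ≠ 0) (i j : Fin 3)
    (h : v i * w j ≠ v j * w i) : Projectivization.mk ℝ v hv ≠ Projectivization.mk ℝ w hw := by
  intro e
  obtain ⟨a, ha⟩ := (Projectivization.mk_eq_mk_iff' ℝ _ _ _ _).mp e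
  apply h
  rw [← ha]
  simp only [Pi.smul_apply, smul_eq_mul]
  ring

section Standard

variable (κ τ : ℝ)

/-- The vectors of the points and lines of the standard box and of the boxes derived from it. The
points `p`, `q`, `r`, `s`, `t`, `b` of the box have the indices `0` to `5`, and its lines `P`, `Q`,
`R`, `S`, `T`, `B` have the vectors with indices `2`, `3`, `0`, `1`, `5`, `4`. The derived points
and lines are `PS`, `QR`, `(qs)(pr)` with indices `6`, `7`, `8` and `qs`, `pr`, `(QR)(PS)` with
indices `9`, `10`, `11`. -/
def stdVec : Fin 12 → Fin 3 → ℝ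
  | 0 => ![1, 0, 0]
  | 1 => ![0, 1, 0]
  | 2 => ![-(κ * τ), τ, 1 + κ ^ 2]
  | 3 => ![κ, -1, τ]
  | 4 => ![1, κ, 0]
  | 5 => ![0, 0, 1]
  | 6 => ![1 + κ ^ 2, 0, κ * τ]
  | 7 => ![0, τ, 1]
  | 8 => ![κ * (1 + κ ^ 2), τ ^ 2, τ * (1 + κ ^ 2)]
  | 9 => ![-τ, 0, κ]
  | 10 => ![0, 1 + κ ^ 2, -τ]
  | 11 => ![κ * τ ^ 2, 1 + κ ^ 2, -(τ * (1 + κ ^ 2))]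

variable {κ τ}

lemma stdVec_ne_zero (hκ : 0 < κ) (hτ : 0 < τ) (i : Fin 12) : stdVec κ τ i ≠ 0 := by
  have hK : 1 + κ ^ 2 ≠ 0 := by positivity
  fin_cases i
  · exact vec3_ne_zero 0 (by simp [stdVec])
  · exact vec3_ne_zero 1 (by simp [stdVec])
  · exact vec3_ne_zero 2 (by simp [stdVec, hK])
  · exact vec3_ne_zero 1 (by simp [stdVec])
  · exact vec3_ne_zero 0 (by simp [stdVec])
  · exact vec3_ne_zero 2 (by simp [stdVec])
  · exact vec3_ne_zero 0 (by simp [stdVec, hK])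
  · exact vec3_ne_zero 2 (by simp [stdVec])
  · exact vec3_ne_zero 1 (by simp [stdVec, hτ.ne'])
  · exact vec3_ne_zero 0 (by simp [stdVec, hτ.ne'])
  · exact vec3_ne_zero 1 (by simp [stdVec, hK])
  · exact vec3_ne_zero 1 (by simp [stdVec, hK])

/-- The points and lines of the standard box and of the boxes derived from it. -/
def stdPt (hκ : 0 < κ) (hτ : 0 < τ) (i : Fin 12) : Pt 3 :=
  Projectivization.mk ℝ (stdVec κ τ i) (stdVec_ne_zero hκ hτ i)

variable (hκ : 0 < κ) (hτ : 0 < τ)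

lemma stdPt_ne {i j : Fin 12} (k l : Fin 3)
    (h : stdVec κ τ i k * stdVec κ τ j l ≠ stdVec κ τ i l * stdVec κ τ j k) :
    stdPt hκ hτ i ≠ stdPt hκ hτ j :=
  mk_ne_mk _ _ k l h

lemma incident_stdPt {i j : Fin 12} (h : stdVec κ τ j ⬝ᵥ stdVec κ τ i = 0) :
    Incident (stdPt hκ hτ i) (stdPt hκ hτ j) :=
  (incident_mk _ _).mpr h

/-- The standard overmarked box. The standard polarity maps it to its dual box. -/
def stdBox : BoxData :=
  ⟨stdPt hκ hτ 0, stdPt hκ hτ 1, stdPt hκ hτ 2, stdPt hκ hτ 3, stdPt hκ hτ 4, stdPt hκ hτ 5,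
    stdPt hκ hτ 2, stdPt hκ hτ 3, stdPt hκ hτ 0, stdPt hκ hτ 1, stdPt hκ hτ 5, stdPt hκ hτ 4⟩

lemma stdPt_ne_0_2 : stdPt hκ hτ 0 ≠ stdPt hκ hτ 2 :=
  stdPt_ne hκ hτ 0 1 (by simp [stdVec, hτ.ne'])

lemma stdPt_ne_1_3 : stdPt hκ hτ 1 ≠ stdPt hκ hτ 3 :=
  stdPt_ne hκ hτ 0 1 (by simp [stdVec, hκ.ne])

lemma stdPt_ne_9_10 : stdPt hκ hτ 9 ≠ stdPt hκ hτ 10 := by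
  have hK : 1 + κ ^ 2 ≠ 0 := by positivity
  exact stdPt_ne hκ hτ 0 1 (by simp [stdVec, hτ.ne', hK])

lemma stdPt_ne_7_6 : stdPt hκ hτ 7 ≠ stdPt hκ hτ 6 := by
  have hK : 1 + κ ^ 2 ≠ 0 := by positivity
  exact stdPt_ne hκ hτ 0 1 (by simp [stdVec, hτ.ne', hK])

lemma meet_stdPt_2_1 : meet (stdPt hκ hτ 2) (stdPt hκ hτ 1) = stdPt hκ hτ 6 := by
  have hK : 1 + κ ^ 2 ≠ 0 := by positivity
  refine eq_meet_of_incident (stdPt_ne hκ hτ 1 2 ?_) (incident_stdPt hκ hτ ?_)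
    (incident_stdPt hκ hτ ?_) <;>
  simp [stdVec, hK.symm, dotProduct, Fin.sum_univ_three]
  ring

lemma meet_stdPt_3_0 : meet (stdPt hκ hτ 3) (stdPt hκ hτ 0) = stdPt hκ hτ 7 := by
  refine eq_meet_of_incident (stdPt_ne hκ hτ 0 1 ?_) (incident_stdPt hκ hτ ?_)
    (incident_stdPt hκ hτ ?_) <;>
  simp [stdVec, dotProduct, Fin.sum_univ_three]

lemma join_stdPt_1_3 : _root_.join (stdPt hκ hτ 1) (stdPt hκ hτ 3) = stdPt hκ hτ 9 := by
  refine eq_join_of_incident (stdPt_ne_1_3 hκ hτ) (incident_stdPt hκ hτ ?_)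
    (incident_stdPt hκ hτ ?_) <;>
  simp [stdVec, dotProduct, Fin.sum_univ_three]
  ring

lemma join_stdPt_0_2 : _root_.join (stdPt hκ hτ 0) (stdPt hκ hτ 2) = stdPt hκ hτ 10 := by
  refine eq_join_of_incident (stdPt_ne_0_2 hκ hτ) (incident_stdPt hκ hτ ?_)
    (incident_stdPt hκ hτ ?_) <;>
  simp [stdVec, dotProduct, Fin.sum_univ_three]
  ring

lemma meet_stdPt_9_10 : meet (stdPt hκ hτ 9) (stdPt hκ hτ 10) = stdPt hκ hτ 8 := by
  refine eq_meet_of_incident (stdPt_ne_9_10 hκ hτ) (incident_stdPt hκ hτ ?_)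
    (incident_stdPt hκ hτ ?_) <;>
  simp [stdVec, dotProduct, Fin.sum_univ_three] <;> ring

lemma join_stdPt_7_6 : _root_.join (stdPt hκ hτ 7) (stdPt hκ hτ 6) = stdPt hκ hτ 11 := by
  refine eq_join_of_incident (stdPt_ne_7_6 hκ hτ) (incident_stdPt hκ hτ ?_)
    (incident_stdPt hκ hτ ?_) <;>
  simp [stdVec, dotProduct, Fin.sum_univ_three] <;> ring

lemma stdBox_generic : (stdBox hκ hτ).Generic where
  PS := by
    have hK : 1 + κ ^ 2 ≠ 0 := by positivity
    exact stdPt_ne hκ hτ 1 2 (by simp [stdVec, hK.symm])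
  QR := stdPt_ne hκ hτ 0 1 (by simp [stdVec])
  qs := stdPt_ne_1_3 hκ hτ
  pr := stdPt_ne_0_2 hκ hτ
  diag := by
    rw [stdBox, join_stdPt_1_3, join_stdPt_0_2]
    exact stdPt_ne_9_10 hκ hτ
  pappus := by
    rw [stdBox, meet_stdPt_3_0, meet_stdPt_2_1]
    exact stdPt_ne_7_6 hκ hτ

lemma stdBox_dualTop : (stdBox hκ hτ).dualTop =
    ⟨stdPt hκ hτ 6, stdPt hκ hτ 7, stdPt hκ hτ 0, stdPt hκ hτ 1, stdPt hκ hτ 8, stdPt hκ hτ 4,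
      stdPt hκ hτ 9, stdPt hκ hτ 10, stdPt hκ hτ 3, stdPt hκ hτ 2, stdPt hκ hτ 11,
      stdPt hκ hτ 5⟩ := by
  simp only [stdBox, BoxData.dualTop, meet_stdPt_2_1, meet_stdPt_3_0, join_stdPt_0_2,
    join_stdPt_1_3, meet_stdPt_9_10, join_stdPt_7_6]

lemma stdBox_dualBottom : (stdBox hκ hτ).dualBottom =
    ⟨stdPt hκ hτ 3, stdPt hκ hτ 2, stdPt hκ hτ 6, stdPt hκ hτ 7, stdPt hκ hτ 5, stdPt hκ hτ 8,
      stdPt hκ hτ 0, stdPt hκ hτ 1, stdPt hκ hτ 10, stdPt hκ hτ 9, stdPt hκ hτ 4,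
      stdPt hκ hτ 11⟩ := by
  simp only [stdBox, BoxData.dualBottom, meet_stdPt_2_1, meet_stdPt_3_0, join_stdPt_0_2,
    join_stdPt_1_3, meet_stdPt_9_10, join_stdPt_7_6]

/-- The standard transformation of order three on the points of the derived boxes. -/
lemma stdGL_smul_stdPt :
    ∀ x ∈ [((0, 7) : Fin 12 × Fin 12), (1, 6), (2, 1), (3, 0), (4, 8), (5, 4), (6, 2), (7, 3),
      (8, 5)], (Matrix.ProjGenLinGroup.mk (stdGL hκ hτ) : PGL(3, ℝ)) • stdPt hκ hτ x.1 =
        stdPt hκ hτ x.2 := by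
  have hσ : 1 + κ ^ 2 + τ ^ 2 ≠ 0 := by positivity
  have key : ∀ (i j : Fin 12) (c : ℝ), (stdMat κ τ).mulVec (stdVec κ τ i) = c • stdVec κ τ j →
      (Matrix.ProjGenLinGroup.mk (stdGL hκ hτ) : PGL(3, ℝ)) • stdPt hκ hτ i = stdPt hκ hτ j := by
    intro i j c h
    rw [stdPt, pgl_smul_mk]
    exact (Projectivization.mk_eq_mk_iff' ℝ _ _ _ _).mpr ⟨c, h.symm⟩
  simp only [List.forall_mem_cons, List.not_mem_nil, false_imp_iff, implies_true, and_true]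
  refine ⟨key _ _ τ ?_, key _ _ 1 ?_, key _ _ (-(κ * τ * (1 + κ ^ 2 + τ ^ 2))) ?_,
    key _ _ (-(1 + κ ^ 2 + τ ^ 2)) ?_, key _ _ 1 ?_, key _ _ (-τ) ?_, key _ _ τ ?_,
    key _ _ (κ * τ) ?_, key _ _ (κ * τ * (1 + κ ^ 2 + τ ^ 2)) ?_⟩ <;>
  (ext i; fin_cases i) <;>
  simp [stdMat, stdVec, Matrix.mulVec, dotProduct, Fin.sum_univ_three] <;> ring

/-- The standard transformation of order three on the lines of the derived boxes. -/
lemma hypAct_stdGL_stdPt :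
    ∀ x ∈ [((0, 2) : Fin 12 × Fin 12), (1, 3), (2, 10), (3, 9), (4, 5), (5, 11), (9, 1), (10, 0),
      (11, 4)], hypAct (Matrix.ProjGenLinGroup.mk (stdGL hκ hτ) : PGL(3, ℝ)) (stdPt hκ hτ x.1) =
        stdPt hκ hτ x.2 := by
  have hσ : -(κ * τ * (1 + κ ^ 2 + τ ^ 2)) ≠ 0 := neg_ne_zero.mpr (by positivity)
  have key : ∀ (i j : Fin 12) (c : ℝ),
      (stdAdj κ τ).transpose.mulVec (stdVec κ τ i) = c • stdVec κ τ j →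
      hypAct (Matrix.ProjGenLinGroup.mk (stdGL hκ hτ) : PGL(3, ℝ)) (stdPt hκ hτ i) =
        stdPt hκ hτ j := by
    intro i j c h
    rw [stdPt, hypAct, contra_mk, pgl_smul_mk]
    refine (Projectivization.mk_eq_mk_iff' ℝ _ _ _ _).mpr
      ⟨(-(κ * τ * (1 + κ ^ 2 + τ ^ 2)))⁻¹ * c, ?_⟩
    rw [mul_smul, ← h, ← Matrix.smul_mulVec, ← Matrix.transpose_smul]
    rfl
  simp only [List.forall_mem_cons, List.not_mem_nil, false_imp_iff, implies_true, and_true]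
  refine ⟨key _ _ (-κ) ?_, key _ _ (-τ) ?_, key _ _ (1 + κ ^ 2 + τ ^ 2) ?_,
    key _ _ (-(κ * (1 + κ ^ 2 + τ ^ 2))) ?_, key _ _ (-(κ * (1 + κ ^ 2 + τ ^ 2))) ?_,
    key _ _ 1 ?_, key _ _ (κ * (1 + κ ^ 2 + τ ^ 2)) ?_,
    key _ _ (-(κ * τ * (1 + κ ^ 2 + τ ^ 2))) ?_, key _ _ (-(κ * τ * (1 + κ ^ 2 + τ ^ 2))) ?_⟩ <;>
  (ext i; fin_cases i) <;>
  simp [stdAdj, stdVec, Matrix.mulVec, dotProduct, Fin.sum_univ_three] <;> ring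

variable {hκ hτ} {ρ : PSL2Z →* ProjSym} (hρ : IsStdRep hκ hτ ρ)

include hρ

lemma IsStdRep.box_to_dual : (stdBox hκ hτ).act (ρ _root_.genD) = (stdBox hκ hτ).dual.flip := by
  rw [BoxData.act_of_right_neg (by rw [hρ.genD]), hρ.genD]
  simp [hypAct_one, stdBox, BoxData.dual, BoxData.flip]

lemma IsStdRep.box_to_top : (stdBox hκ hτ).act (ρ _root_.genA) = (stdBox hκ hτ).dualTop.flip := by
  have h1 := stdGL_smul_stdPt hκ hτ
  have h2 := hypAct_stdGL_stdPt hκ hτ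
  simp only [List.forall_mem_cons, List.not_mem_nil, false_imp_iff, implies_true, and_true]
    at h1 h2
  rw [BoxData.act_of_right_one (by rw [hρ.genA]), hρ.genA, stdBox_dualTop]
  simp [stdBox, BoxData.flip, h1, h2]

lemma IsStdRep.top_to_bottom :
    (stdBox hκ hτ).dualTop.act (ρ _root_.genA) = (stdBox hκ hτ).dualBottom.flip := by
  have h1 := stdGL_smul_stdPt hκ hτ
  have h2 := hypAct_stdGL_stdPt hκ hτ
  simp only [List.forall_mem_cons, List.not_mem_nil, false_imp_iff, implies_true, and_true]
    at h1 h2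
  rw [BoxData.act_of_right_one (by rw [hρ.genA]), hρ.genA, stdBox_dualTop, stdBox_dualBottom]
  simp [BoxData.flip, h1, h2]

lemma IsStdRep.bottom_to_box : (stdBox hκ hτ).dualBottom.act (ρ _root_.genA) = stdBox hκ hτ := by
  have h1 := stdGL_smul_stdPt hκ hτ
  have h2 := hypAct_stdGL_stdPt hκ hτ
  simp only [List.forall_mem_cons, List.not_mem_nil, false_imp_iff, implies_true, and_true]
    at h1 h2
  rw [BoxData.act_of_right_one (by rw [hρ.genA]), hρ.genA, stdBox_dualBottom]
  simp [stdBox, h1, h2]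

theorem IsStdRep.isPappusSchwartz : IsPappusSchwartz (stdBox hκ hτ) ρ where
  duality := by rw [ProjSym.IsDuality, hρ.genD]
  box_to_dual := Or.inr hρ.box_to_dual
  projective := by rw [ProjSym.IsProjective, hρ.genA]
  box_to_top := Or.inr hρ.box_to_top
  top_to_bottom := Or.inr hρ.top_to_bottom
  bottom_to_box := Or.inl hρ.bottom_to_box

end Standard

/-! ### Normal form of marked boxes -/

lemma eq_mk_of_submodule_eq {d : ℕ} {x : Pt d} {v : Fin d → ℝ} (hv : v ≠ 0)
    (h : x.submodule = Submodule.span ℝ {v}) : x = Projectivization.mk ℝ v hv := by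
  apply Projectivization.submodule_injective
  rw [h, Projectivization.submodule_mk]

lemma eq_hypAct_of_incident {g : PGL(3, ℝ)} {v w : Pt 3} {l l' : Hyp 3} (hne : v ≠ w)
    (hv : Incident v l) (hw : Incident w l) (hv' : Incident (g • v) l')
    (hw' : Incident (g • w) l') : l' = hypAct g l := by
  rw [← eq_join_of_incident ((MulAction.injective g).ne hne) hv' hw',
    ← eq_join_of_incident ((MulAction.injective g).ne hne) ((incident_smul g v l).mpr hv)
      ((incident_smul g w l).mpr hw)]

section Standard

variable {κ τ : ℝ} (hκ : 0 < κ) (hτ : 0 < τ)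

lemma stdBox_incidences : (stdBox hκ hτ).Incidences := by
  constructor <;> refine incident_stdPt hκ hτ ?_ <;>
    simp [stdVec, dotProduct, Fin.sum_univ_three] <;> ring

/-- A box whose points are the images of those of the standard box is the image of the standard
box, since its lines are determined by its points. -/
lemma eq_act_stdBox {Θ : BoxData} (hΘ : Θ.Incidences) {g : ProjSym} (hg : g.right = 1)
    (hp : Θ.p = g.left • stdPt hκ hτ 0) (hq : Θ.q = g.left • stdPt hκ hτ 1)
    (hr : Θ.r = g.left • stdPt hκ hτ 2) (hs : Θ.s = g.left • stdPt hκ hτ 3)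
    (ht : Θ.t = g.left • stdPt hκ hτ 4) (hb : Θ.b = g.left • stdPt hκ hτ 5) :
    Θ = (stdBox hκ hτ).act g := by
  have h := stdBox_incidences hκ hτ
  have hK : 1 + κ ^ 2 ≠ 0 := by positivity
  have ne01 : stdPt hκ hτ 0 ≠ stdPt hκ hτ 1 := stdPt_ne hκ hτ 0 1 (by simp [stdVec])
  have ne35 : stdPt hκ hτ 3 ≠ stdPt hκ hτ 5 := stdPt_ne hκ hτ 1 2 (by simp [stdVec])
  have ne34 : stdPt hκ hτ 3 ≠ stdPt hκ hτ 4 := stdPt_ne hκ hτ 0 2 (by simp [stdVec, hτ.ne])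
  have ne24 : stdPt hκ hτ 2 ≠ stdPt hκ hτ 4 := stdPt_ne hκ hτ 0 2 (by simp [stdVec, hK.symm])
  have ne15 : stdPt hκ hτ 1 ≠ stdPt hκ hτ 5 := stdPt_ne hκ hτ 1 2 (by simp [stdVec])
  have ne05 : stdPt hκ hτ 0 ≠ stdPt hκ hτ 5 := stdPt_ne hκ hτ 0 2 (by simp [stdVec])
  rw [BoxData.act_of_right_one hg]
  refine BoxData.ext hp hq hr hs ht hb ?_ ?_ ?_ ?_ ?_ ?_
  · exact eq_hypAct_of_incident ne34 h.sP h.tP (hs ▸ hΘ.sP) (ht ▸ hΘ.tP)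
  · exact eq_hypAct_of_incident ne24 h.rQ h.tQ (hr ▸ hΘ.rQ) (ht ▸ hΘ.tQ)
  · exact eq_hypAct_of_incident ne15 h.qR h.bR (hq ▸ hΘ.qR) (hb ▸ hΘ.bR)
  · exact eq_hypAct_of_incident ne05 h.pS h.bS (hp ▸ hΘ.pS) (hb ▸ hΘ.bS)
  · exact eq_hypAct_of_incident ne01 h.pT h.qT (hp ▸ hΘ.pT) (hq ▸ hΘ.qT)
  · exact eq_hypAct_of_incident ne35 h.sB h.bB (hs ▸ hΘ.sB) (hb ▸ hΘ.bB)

end Standard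

/-- Every overmarked box is projectively equivalent to a standard one. -/
theorem BoxData.IsOvermarkedBox.exists_eq_act_stdBox {Θ : BoxData} (hΘ : Θ.IsOvermarkedBox) :
    ∃ (κ τ : ℝ) (hκ : 0 < κ) (hτ : 0 < τ) (c : ProjSym), c.right = 1 ∧
      Θ = (stdBox hκ hτ).act c := by
  obtain ⟨p, q, r, s, k, l, hli, hs, hk, hl, ep, eq, er, es, et, eb⟩ := hΘ.convex
  obtain rfl : s = p + r - q := by rw [hs, add_sub_cancel_left]
  have hκ : 0 < √k := Real.sqrt_pos.mpr hk
  have hτ : 0 < √(l * (1 + k)) := Real.sqrt_pos.mpr (by positivity)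
  have hκ2 : √k ^ 2 = k := Real.sq_sqrt hk.le
  have hτ2 : √(l * (1 + k)) ^ 2 = l * (1 + k) := Real.sq_sqrt (by positivity)
  generalize √k = κ at *
  generalize √(l * (1 + k)) = τ at *
  have hdet0 : (Matrix.of ![p, q, r]).det ≠ 0 := by
    have h := (Matrix.isUnit_iff_isUnit_det _).mp
      (Matrix.linearIndependent_rows_iff_isUnit (A := Matrix.of ![p, q, r]).mp hli)
    exact h.ne_zero
  -- the columns are the images of `p`, `q` and `b`, scaled so that `r`, `s` and `t` match
  let C : Matrix (Fin 3) (Fin 3) ℝ :=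
    (Matrix.of ![κ⁻¹ • p, q, τ⁻¹ • (r + l • (p + r - q))]).transpose
  have hdet : C.det ≠ 0 := by
    have : C.det = κ⁻¹ * τ⁻¹ * (1 + l) * (Matrix.of ![p, q, r]).det := by
      rw [Matrix.det_transpose]
      simp only [Matrix.det_fin_three, Matrix.of_apply, Matrix.cons_val, Pi.smul_apply,
        Pi.add_apply, Pi.sub_apply, smul_eq_mul]
      ring
    rw [this]
    have : 1 + l ≠ 0 := by positivity
    exact mul_ne_zero (by positivity) hdet0
  have hC : ∀ v : Fin 3 → ℝ, C.mulVec v =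
      (v 0 * κ⁻¹) • p + v 1 • q + (v 2 * τ⁻¹) • (r + l • (p + r - q)) := by
    intro v
    ext i
    simp only [C, Matrix.mulVec, dotProduct, Fin.sum_univ_three, Matrix.transpose_apply,
      Matrix.of_apply, Matrix.cons_val, Pi.smul_apply, Pi.add_apply, Pi.sub_apply, smul_eq_mul]
    ring
  let g : PGL(3, ℝ) :=
    Matrix.ProjGenLinGroup.mk (Matrix.GeneralLinearGroup.mkOfDetNeZero C hdet)
  have key : ∀ (x : Pt 3) (i : Fin 12) (v : Fin 3 → ℝ) (a : ℝ), a ≠ 0 →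
      x.submodule = Submodule.span ℝ {v} → C.mulVec (stdVec κ τ i) = a • v →
      x = g • stdPt hκ hτ i := by
    intro x i v a ha hx h
    have hv : v ≠ 0 := by
      rintro rfl
      rw [Submodule.span_zero_singleton] at hx
      have := x.finrank_submodule
      rw [hx, finrank_bot] at this
      exact zero_ne_one this
    rw [eq_mk_of_submodule_eq hv hx, stdPt]
    symm
    exact (Projectivization.mk_eq_mk_iff' ℝ _ _ _ _).mpr ⟨a, h.symm⟩
  refine ⟨κ, τ, hκ, hτ, ⟨g, 1⟩, rfl, eq_act_stdBox hκ hτ hΘ.incidences rfl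
    (key _ _ _ κ⁻¹ (by positivity) ep ?_) (key _ _ _ 1 one_ne_zero eq ?_)
    (key _ _ _ (τ⁻¹ * (1 + k) * (1 + l)) (by positivity) er ?_)
    (key _ _ _ (1 + l) (by positivity) es ?_)
    (key _ _ _ κ⁻¹ (by positivity) et ?_) (key _ _ _ τ⁻¹ (by positivity) eb ?_)⟩ <;>
    rw [hC] <;> ext i <;>
    simp only [stdVec, Matrix.cons_val, Pi.smul_apply, Pi.add_apply, Pi.sub_apply, smul_eq_mul]
  · ring
  · ring
  · field_simp
    rw [hτ2, hκ2]
    ring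
  · field_simp
    ring
  · field_simp
    rw [hκ2]
    ring
  · ring

/-! ### Uniqueness of Pappus–Schwartz representations up to the flip -/

lemma BoxData.act_injective (g : ProjSym) : Function.Injective (BoxData.act g) := by
  intro Θ Θ' h
  have h1 := MulAction.injective (α := PGL(3, ℝ)) (β := Pt 3) g.left
  have h2 := hypAct_injective g.left
  rcases ProjSym.right_eq g with hg | hg
  · rw [act_of_right_one hg, act_of_right_one hg] at h
    simp only [BoxData.mk.injEq, h1.eq_iff, h2.eq_iff] at h
    ext1 <;> tauto
  · rw [act_of_right_neg hg, act_of_right_neg hg] at h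
    simp only [BoxData.mk.injEq, h1.eq_iff, h2.eq_iff] at h
    ext1 <;> tauto

section Standard

variable {κ τ : ℝ} {hκ : 0 < κ} {hτ : 0 < τ}

/-- A projective transformation fixing the points `p`, `q`, `b`, `t` and `r` of the standard box
is trivial. -/
lemma eq_one_of_act_stdBox {g : ProjSym} (hg : g.right = 1)
    (h : (stdBox hκ hτ).act g = stdBox hκ hτ) : g = 1 := by
  rw [BoxData.act_of_right_one hg, BoxData.ext_iff] at h
  obtain ⟨h0, h1, h2, -, h4, h5, -⟩ := h
  refine SemidirectProduct.ext ?_ hg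
  rw [SemidirectProduct.one_left]
  generalize g.left = G at *
  induction G using Matrix.ProjGenLinGroup.induction_on with | mk G => ?_
  have key : ∀ i, Matrix.ProjGenLinGroup.mk G • stdPt hκ hτ i = stdPt hκ hτ i →
      ∃ a : ℝ, a ≠ 0 ∧ G.val.mulVec (stdVec κ τ i) = a • stdVec κ τ i := by
    intro i hi
    rw [stdPt, pgl_smul_mk] at hi
    obtain ⟨a, ha⟩ := (Projectivization.mk_eq_mk_iff' ℝ _ _ _ _).mp hi
    refine ⟨a, ?_, ha.symm⟩
    rintro rfl
    rw [zero_smul] at ha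
    exact gl_smul_ne_zero G (stdVec_ne_zero hκ hτ i) ha.symm
  obtain ⟨a, ha, e0⟩ := key 0 h0
  obtain ⟨b, -, e1⟩ := key 1 h1
  obtain ⟨c, -, e5⟩ := key 5 h5
  obtain ⟨d, -, e4⟩ := key 4 h4
  obtain ⟨e, -, e2⟩ := key 2 h2
  simp only [funext_iff, Fin.forall_fin_succ, stdVec, Matrix.mulVec, dotProduct,
    Fin.sum_univ_three, Pi.smul_apply, smul_eq_mul] at e0 e1 e2 e4 e5
  simp at e0 e1 e2 e4 e5
  have hK : 1 + κ ^ 2 ≠ 0 := by positivity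
  obtain ⟨e00, e10, e20⟩ := e0
  obtain ⟨e01, e11, e21⟩ := e1
  obtain ⟨e02, e12, e22⟩ := e5
  simp only [e00, e10, e20, e01, e11, e21, e02, e12, e22] at e2 e4
  obtain ⟨e40, e41, -⟩ := e4
  obtain ⟨e200, e21', e22'⟩ := e2
  have hba : b = a := by
    have : κ * (b - a) = 0 := by linear_combination e41 - κ * e40
    exact sub_eq_zero.mp ((mul_eq_zero.mp this).resolve_left hκ.ne')
  have hbe : b = e := by
    have : τ * (b - e) = 0 := by linear_combination e21'
    exact sub_eq_zero.mp ((mul_eq_zero.mp this).resolve_left hτ.ne')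
  have hce : c = e := by
    have : (1 + κ ^ 2) * (c - e) = 0 := by linear_combination e22'
    exact sub_eq_zero.mp ((mul_eq_zero.mp this).resolve_left hK)
  rw [← map_one Matrix.ProjGenLinGroup.mk]
  refine pgl_mk_eq_of_smul ha ?_
  ext i j
  fin_cases i <;> fin_cases j <;> simp [e00, e10, e20, e01, e11, e21, e02, e12, e22] <;> linarith

lemma eq_of_act_stdBox {g h : ProjSym} (hgh : g.right = h.right)
    (he : (stdBox hκ hτ).act g = (stdBox hκ hτ).act h) : g = h := by
  have hr : (h⁻¹ * g).right = 1 := by simp [hgh]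
  have h1 : (stdBox hκ hτ).act (h * (h⁻¹ * g)) = (stdBox hκ hτ).act h := by
    rw [mul_inv_cancel_left, he]
  rw [BoxData.act_mul_of_right_one_right _ hr] at h1
  have h2 := eq_one_of_act_stdBox hr (BoxData.act_injective h h1)
  exact (inv_mul_eq_one.mp h2).symm

lemma act_inv_mul_eq_flip {g h : ProjSym} (hgh : g.right = h.right)
    (he : (stdBox hκ hτ).act g = ((stdBox hκ hτ).act h).flip) :
    (stdBox hκ hτ).act (h⁻¹ * g) = (stdBox hκ hτ).flip := by
  have hr : (h⁻¹ * g).right = 1 := by simp [hgh]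
  apply BoxData.act_injective h
  rw [← BoxData.act_mul_of_right_one_right _ hr, mul_inv_cancel_left, he, BoxData.act_flip]

lemma stdBox_flip_ne : (stdBox hκ hτ).flip ≠ stdBox hκ hτ := by
  intro h
  exact stdPt_ne hκ hτ 0 1 (by simp [stdVec]) (congrArg BoxData.q h)

variable {ρ₀ ρ : PSL2Z →* ProjSym} (hρ₀ : IsStdRep hκ hτ ρ₀)

include hρ₀ in
/-- A symmetry inducing the flip of the standard box is an involution centralizing the standard
representation. -/
lemma IsStdRep.commute_of_act_eq_flip {j : ProjSym} (hj : j.right = 1)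
    (h : (stdBox hκ hτ).act j = (stdBox hκ hτ).flip) :
    j * j = 1 ∧ ∀ g, Commute (ρ₀ g) j := by
  have hA : Commute (ρ₀ _root_.genA) j := by
    refine eq_of_act_stdBox (hκ := hκ) (hτ := hτ) (by simp [hj]) ?_
    rw [BoxData.act_mul_of_right_one_right _ hj, BoxData.act_mul_of_right_one_left hj, h,
      BoxData.act_flip, hρ₀.box_to_top, BoxData.flip_flip, BoxData.act_flip,
      ← BoxData.dualTop_act (stdBox_generic hκ hτ) hj, h, BoxData.dualTop_flip, BoxData.flip_flip]
  have hD : Commute (ρ₀ _root_.genD) j := by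
    refine eq_of_act_stdBox (hκ := hκ) (hτ := hτ) (by simp [hj]) ?_
    rw [BoxData.act_mul_of_right_one_right _ hj, BoxData.act_mul_of_right_one_left hj, h,
      BoxData.act_flip, hρ₀.box_to_dual, BoxData.flip_flip, BoxData.act_flip,
      ← BoxData.dual_act hj, h, BoxData.dual_flip, BoxData.flip_flip]
  refine ⟨eq_one_of_act_stdBox (hκ := hκ) (hτ := hτ) (by simp [hj]) ?_, fun g => ?_⟩
  · rw [BoxData.act_mul_of_right_one_right _ hj, h, BoxData.act_flip, h, BoxData.flip_flip]
  · induction g using psl2z_induction with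
    | h1 => rw [map_one]; exact Commute.one_left j
    | hA g hg => rw [map_mul]; exact hA.mul_left hg
    | hD g hg => rw [map_mul]; exact hD.mul_left hg

include hρ₀ in
/-- A Pappus–Schwartz representation of the standard box differs from the standard representation
by values in a group of order at most two which centralizes it and fixes the cusp. -/
theorem IsStdRep.eq_or_eq_mul_of_isPappusSchwartz (hρ : IsPappusSchwartz (stdBox hκ hτ) ρ) :
    ∃ j : ProjSym, j • cuspFlag κ = cuspFlag κ ∧ (∀ g, Commute (ρ₀ g) j) ∧
      ∀ g, ρ g = ρ₀ g ∨ ρ g = ρ₀ g * j := by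
  have hA : ρ _root_.genA = ρ₀ _root_.genA := by
    have hr : (ρ _root_.genA).right = (ρ₀ _root_.genA).right := by
      rw [hρ₀.genA]; exact hρ.projective
    rcases hρ.box_to_top with h | h
    · exfalso
      rw [← BoxData.flip_flip (BoxData.dualTop _), ← hρ₀.box_to_top] at h
      have hj := act_inv_mul_eq_flip hr h
      obtain ⟨h2, hc⟩ := hρ₀.commute_of_act_eq_flip (by simp [hr]) hj
      set j := (ρ₀ _root_.genA)⁻¹ * ρ _root_.genA with hj_def
      have e : ρ _root_.genA = ρ₀ _root_.genA * j := by rw [hj_def, mul_inv_cancel_left]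
      have h3 : ρ _root_.genA ^ 3 = 1 := by rw [← map_pow, genA_cube, map_one]
      rw [e, (hc _).mul_pow, ← map_pow, genA_cube, map_one, one_mul, pow_succ, sq, h2,
        one_mul] at h3
      rw [h3, BoxData.act_one] at hj
      exact stdBox_flip_ne hj.symm
    · exact eq_of_act_stdBox hr (h.trans hρ₀.box_to_top.symm)
  have hr : (ρ _root_.genD).right = (ρ₀ _root_.genD).right := by
    rw [hρ₀.genD]; exact hρ.duality
  obtain ⟨j, hjc, h2, hc, hj⟩ : ∃ j : ProjSym, j • cuspFlag κ = cuspFlag κ ∧ j * j = 1 ∧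
      (∀ g, Commute (ρ₀ g) j) ∧ (ρ _root_.genD = ρ₀ _root_.genD ∨
        ρ _root_.genD = ρ₀ _root_.genD * j) := by
    rcases hρ.box_to_dual with h | h
    · rw [← BoxData.flip_flip (BoxData.dual _), ← hρ₀.box_to_dual] at h
      have hj := act_inv_mul_eq_flip hr h
      have hj1 : ((ρ₀ _root_.genD)⁻¹ * ρ _root_.genD).right = 1 := by simp [hr]
      obtain ⟨h2, hc⟩ := hρ₀.commute_of_act_eq_flip hj1 hj
      refine ⟨_, ?_, h2, hc, Or.inr (by rw [mul_inv_cancel_left])⟩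
      rw [ProjSym.smul_def, ProjSym.act_of_right_one hj1]
      rw [BoxData.act_of_right_one hj1] at hj
      exact Prod.ext (congrArg BoxData.t hj) (congrArg BoxData.T hj)
    · exact ⟨1, one_smul _ _, one_mul 1, fun g => Commute.one_right _,
        Or.inl (eq_of_act_stdBox hr (h.trans hρ₀.box_to_dual.symm))⟩
  refine ⟨j, hjc, hc, fun g => ?_⟩
  induction g using psl2z_induction with
  | h1 => left; rw [map_one, map_one]
  | hA g hg =>
    rw [map_mul, map_mul, hA]
    exact hg.imp (fun h => by rw [h]) (fun h => by rw [h, mul_assoc])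
  | hD g hg =>
    rw [map_mul, map_mul]
    rcases hj with hj | hj <;> rcases hg with hg | hg <;> rw [hj, hg]
    · exact Or.inl rfl
    · exact Or.inr (mul_assoc _ _ _).symm
    · right; rw [mul_assoc, mul_assoc, (hc g).eq]
    · left; rw [mul_assoc, ← mul_assoc j, ← (hc g).eq, mul_assoc, h2, mul_one]

end Standard

/-! ### Boundary maps of Pappus–Schwartz representations -/

/-- A boundary map of `ρ₀` is also one of a representation whose values differ from those of `ρ₀` by
an element centralizing `ρ₀` and fixing the flag at `∞`: this element then fixes all flags of the
boundary map, as the orbit of `∞` is dense. -/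
theorem IsStrongBoundaryMap.of_eq_or_eq_mul {ρ₀ ρ : PSL2Z →* ProjSym}
    {ξ : OnePoint ℝ → Pt 3 × Hyp 3} (hξ : IsStrongBoundaryMap ρ₀ ξ) {j : ProjSym}
    (hj : j • ξ OnePoint.infty = ξ OnePoint.infty) (hc : ∀ g, Commute (ρ₀ g) j)
    (hρ : ∀ g, ρ g = ρ₀ g ∨ ρ g = ρ₀ g * j) : IsStrongBoundaryMap ρ ξ := by
  have horb : ∀ g : PSL2Z, j • ξ (g • OnePoint.infty) = ξ (g • OnePoint.infty) := fun g => by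
    rw [hξ.equivariant, ← mul_smul, ← (hc g).eq, mul_smul, hj]
  have hclosed : IsClosed {x | j • ξ x = ξ x} :=
    isClosed_eq ((ProjSym.continuous_act j).comp hξ.continuous) hξ.continuous
  have hfix : ∀ x, j • ξ x = ξ x := by
    intro x
    induction x using OnePoint.rec with
    | infty => exact hj
    | coe r =>
      have h : ∀ r : ℝ, r ∈ ((↑) : ℝ → OnePoint ℝ) ⁻¹' {x | j • ξ x = ξ x} := by
        intro r
        refine Rat.denseRange_cast.induction_on r (hclosed.preimage OnePoint.continuous_coe) ?_
        intro q
        obtain ⟨g, hg⟩ := exists_smul_infty_eq_ratCast q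
        change j • ξ _ = ξ _
        rw [← hg]
        exact horb g
      exact h r
  refine ⟨hξ.continuous, fun g x => ?_, hξ.opposite, fun γ x y h h' v l hv hl => ?_⟩
  · rw [hξ.equivariant]
    rcases hρ g with h | h <;> rw [h]
    rw [mul_smul, hfix]
  · have h1 := hξ.tendsto γ x y h h' v l hv hl
    have hop : IsOpposite (j • ((v, l) : Pt 3 × Hyp 3)) (ξ y) := by
      rw [← hfix y, opposite_smul_iff]
      exact ⟨hv, hl⟩
    have h2 := hξ.tendsto γ x y h h' _ _ hop.1 hop.2
    rw [Prod.mk.eta] at h2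
    rw [tendsto_def] at h1 h2 ⊢
    intro U hU
    filter_upwards [h1 U hU, h2 U hU] with n hn1 hn2
    rcases hρ (γ n) with e | e
    · rwa [Set.mem_preimage, e]
    · rwa [Set.mem_preimage, e, mul_smul]

/-- Conjugation transports boundary maps. -/
theorem IsStrongBoundaryMap.conj {ρ₀ ρ : PSL2Z →* ProjSym} {ξ : OnePoint ℝ → Pt 3 × Hyp 3}
    (hξ : IsStrongBoundaryMap ρ₀ ξ) (c : ProjSym) (hρ : ∀ g, ρ g = c * ρ₀ g * c⁻¹) :
    IsStrongBoundaryMap ρ (fun x => c • ξ x) := by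
  refine ⟨(ProjSym.continuous_act c).comp hξ.continuous, fun g x => ?_,
    fun x y hxy => (opposite_smul_iff c).mpr (hξ.opposite x y hxy),
    fun γ x y h h' v l hv hl => ?_⟩
  · rw [hρ, mul_smul, inv_smul_smul, mul_smul, hξ.equivariant]
  · have hop : IsOpposite (c⁻¹ • ((v, l) : Pt 3 × Hyp 3)) (ξ y) := by
      rw [← opposite_smul_iff c, smul_inv_smul]
      exact ⟨hv, hl⟩
    have h1 := ((ProjSym.continuous_act c).tendsto _).comp
      (hξ.tendsto γ x y h h' _ _ hop.1 hop.2)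
    refine h1.congr fun n => ?_
    change c • ρ₀ (γ n) • c⁻¹ • ((v, l) : Pt 3 × Hyp 3) = _
    rw [hρ, mul_smul, mul_smul]

lemma conj_inv_apply {G : Type*} [Group G] (ρ : PSL2Z →* G) (c : G) (g : PSL2Z) :
    ρ g = c * ((MulAut.conj c⁻¹).toMonoidHom.comp ρ) g * c⁻¹ := by
  simp [mul_assoc]

theorem BoxData.IsOvermarkedBox.exists_isPappusSchwartz {Θ : BoxData} (hΘ : Θ.IsOvermarkedBox) :
    ∃ ρ : PSL2Z →* ProjSym, IsPappusSchwartz Θ ρ := by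
  obtain ⟨κ, τ, hκ, hτ, c, hc, rfl⟩ := hΘ.exists_eq_act_stdBox
  obtain ⟨ρ, hρ⟩ := exists_isStdRep hκ hτ
  refine ⟨(MulAut.conj c).toMonoidHom.comp ρ, ?_⟩
  rw [isPappusSchwartz_conj_iff (stdBox_generic hκ hτ) hc]
  have h : (MulAut.conj c⁻¹).toMonoidHom.comp ((MulAut.conj c).toMonoidHom.comp ρ) = ρ :=
    MonoidHom.ext fun g => by simp [mul_assoc]
  rw [h]
  exact hρ.isPappusSchwartz

theorem IsPappusSchwartz.exists_isStrongBoundaryMap {Θ : BoxData} (hΘ : Θ.IsOvermarkedBox)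
    {ρ : PSL2Z →* ProjSym} (hρ : IsPappusSchwartz Θ ρ) : ∃ ξ, IsStrongBoundaryMap ρ ξ := by
  obtain ⟨κ, τ, hκ, hτ, c, hc, rfl⟩ := hΘ.exists_eq_act_stdBox
  rw [isPappusSchwartz_conj_iff (stdBox_generic hκ hτ) hc] at hρ
  obtain ⟨ρ₀, hρ₀⟩ := exists_isStdRep hκ hτ
  obtain ⟨ξ, hξ, hinf⟩ := hρ₀.exists_isStrongBoundaryMap
  obtain ⟨j, hj, hcomm, hor⟩ := hρ₀.eq_or_eq_mul_of_isPappusSchwartz hρ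
  exact ⟨_, (hξ.of_eq_or_eq_mul (by rw [hinf, hj]) hcomm hor).conj c (conj_inv_apply ρ c)⟩

theorem IsStrongBoundaryMap.isPappusBoundaryMap {ρ : PSL2Z →* ProjSym}
    {ξ : OnePoint ℝ → Pt 3 × Hyp 3} (hξ : IsStrongBoundaryMap ρ ξ) : IsPappusBoundaryMap ρ ξ :=
  ⟨hξ.continuous, hξ.equivariant, fun x y hxy => (hξ.opposite x y hxy).1,
    fun γ x y h h' v l hv hl => hξ.tendsto γ x y h.tendsToBoundary h'.tendsToBoundary v l hv hl⟩

/-! ### The subgroup of projective transformations -/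

/-- On projective transformations the strong dynamics reduces to that on points; any line opposite
to the repelling flag can be added. -/
theorem IsStrongBoundaryMap.isAnosovBoundaryMap {ρ : PSL2Z →* ProjSym}
    {ξ : OnePoint ℝ → Pt 3 × Hyp 3} (hξ : IsStrongBoundaryMap ρ ξ) :
    IsAnosovBoundaryMap (projRestrict ρ) ξ := by
  have hact : ∀ (g : projSubgroup ρ) (θ : Pt 3 × Hyp 3), ρ g • θ =
      (projRestrict ρ g • θ.1, hypAct (projRestrict ρ g) θ.2) := fun g θ =>
    ProjSym.act_of_right_one g.2 θ
  refine ⟨hξ.continuous, fun g x => ?_, fun x y hxy => (hξ.opposite x y hxy).1,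
    fun γ x y h h' v hv => ?_⟩
  · rw [← hact]
    exact hξ.equivariant g x
  · obtain ⟨z, hz, -⟩ := exists_ne_and_ne y y
    have h1 := hξ.tendsto (fun n => γ n) x y h h' v (ξ z).2 hv (hξ.opposite y z hz.symm).1
    simp only [hact] at h1
    exact (continuous_fst.tendsto _).comp h1

instance fg_projSubgroup (ρ : PSL2Z →* ProjSym) : Group.FG (projSubgroup ρ) := by
  have : (projSubgroup ρ).FiniteIndex := ⟨by
    rw [projSubgroup, Subgroup.index_ker]
    exact Nat.card_pos.ne'⟩
  exact Subgroup.fg_of_index_ne_zero (projSubgroup ρ)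

theorem IsPappusSchwartz.isBowditchBoundary_projSubgroup {Θ : BoxData} {ρ : PSL2Z →* ProjSym}
    (hρ : IsPappusSchwartz Θ ρ) {Ps : Set (Subgroup (projSubgroup ρ))}
    (hPs : IsParabolicRepresentatives (OnePoint ℝ) Ps) : IsBowditchBoundary (OnePoint ℝ) Ps := by
  refine isBowditchBoundary_of_hom (projSubgroup ρ).subtype (fun _ _ => rfl)
    (projSubgroup ρ).subtype_injective (fun g => ?_) Ps hPs
  rw [Subgroup.range_subtype]
  rcases ProjSym.right_eq (ρ g) with h | h
  · exact Or.inl h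
  · right
    have hA : (ρ genA).right = 1 := hρ.projective
    have hD : (ρ genD).right = -1 := hρ.duality
    change (ρ (psT * g)).right = 1
    rw [← genA_mul_genD]
    simp [hA, hD, h]

end

theorem mainTheorem11 (Θ : BoxData) (hΘ : Θ.IsOvermarkedBox) :
    (∃ ρ : PSL2Z →* ProjSym, IsPappusSchwartz Θ ρ) ∧
    ∀ ρ : PSL2Z →* ProjSym, IsPappusSchwartz Θ ρ →
      (∃ ξ : OnePoint ℝ → Pt 3 × Hyp 3, IsPappusBoundaryMap ρ ξ) ∧
      (∀ Ps : Set (Subgroup PSL2Z), IsParabolicRepresentatives (OnePoint ℝ) Ps →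
        IsBowditchBoundary (OnePoint ℝ) Ps) ∧
      (∀ Ps : Set (Subgroup (projSubgroup ρ)), IsParabolicRepresentatives (OnePoint ℝ) Ps →
        IsP1AnosovRelative Ps (projRestrict ρ)) := by
  refine ⟨hΘ.exists_isPappusSchwartz, fun ρ hρ => ?_⟩
  obtain ⟨ξ, hξ⟩ := hρ.exists_isStrongBoundaryMap hΘ
  exact ⟨⟨ξ, hξ.isPappusBoundaryMap⟩,
    fun Ps hPs => isBowditchBoundary_of_hom (MonoidHom.id _) (fun _ _ => rfl)
      Function.injective_id (fun g => Or.inl ⟨g, rfl⟩) Ps hPs,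
    fun Ps hPs => ⟨OnePoint ℝ, inferInstance, inferInstance,
      hρ.isBowditchBoundary_projSubgroup hPs, ξ, hξ.isAnosovBoundaryMap⟩⟩
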